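/- Let $\underline{\mathbb{Z}/2}$ be the constant $C_2$-Mackey ring. A $\underline{\mathbb{Z}/2}$-module $M$ is a pair of $\mathbb{F}_2$-vector spaces $M_\Theta, M_\bullet$ with linear maps $t\colon M_\Theta\to M_\Theta$, $p_*\colon M_\Theta\to M_\bullet$, $p^*\colon M_\bullet\to M_\Theta$ such that $tp^*=p^*$, $p_*t=p_*$, $t^2=1$, $p^*p_*=1+t$ and $p_*p^*=0$. Let $H=\underline{\mathbb{Z}/2}$ be the free module on a generator in $H_\bullet$, and let $F$ be the free module on a generator $g\in F_\Theta$. Let $p$ denote the nonzero map $H\to F$ and also the nonzero map $F\to H$. Let $\mathcal{D}$ be the derived category of $\underline{\mathbb{Z}/2}$-modules, with derived box product $\Box$ and suspension $\Sigma$; write $X\simeq Y$ if the complexes $X$ and $Y$ are isomorphic in $\mathcal{D}$ (quasi-isomorphic). A complex is perfect if it is quasi-isomorphic to a bounded complex which in each degree is a finite direct sum of copies of $H$ and $F$. For $k,r\ge 0$ and $n\in\mathbb{Z}$ define the following complexes (homological grading; all maps $F\to F$ are $1+t$ and all maps between $H$ and $F$ are $p$): * $A_k$: $F\to F\to\cdots\to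 F$ in degrees $k,\dots,0$; * $H(0)$ is $H$ in degree $0$; for $n>0$, $H(n)$ is $F\to\cdots\to F\to H$ with $F$ in degrees $0,\dots,-(n-1)$ and $H$ in degree $-n$, and $H(-n)$ is $H\to F\to\cdots\to F$ with $H$ in degree $n$ and $F$ in degrees $n-1,\dots,0$; * $B_r$: $H\to F\to\cdots\to F\to H$ with $H$ in degrees $0$ and $-(r+2)$ and $F$ in the $r+1$ degrees in between. For a complex $X$ put $H^{p,q}(X)=\mathcal{D}(X,\Sigma^pH(q))$. Using the unique equivalences $H(q)\,\Box\,H(s)\simeq H(q+s)$, the derived box product makes $\mathbb{M}_2=H^{*,*}(H)$ a bigraded ring and $H^{*,*}(X)$ a bigraded $\mathbb{M}_2$-module. 1. Let $X$ and $Y$ be finite direct sums of complexes of the form $\Sigma^mA_k$, $\Sigma^mH(n)$ and $\Sigma^mB_r$ (repetitions allowed). If $X\simeq Y$, then there is a bijection between the summands of $X$ and those of $Y$ under which corresponding summands have the same type ($A$, $H$ or $B$), the same index ($k$, $n$ or $r$) and the same suspension $m$. In particular, a decomposition, up to quasi-isomorphism, of a perfect complex as such a direct sum is unique up to permutation of the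 summands. 2. Let $X$ and $Y$ be perfect complexes of $\underline{\mathbb{Z}/2}$-modules. Then $X\simeq Y$ if and only if $H^{*,*}(X)\cong H^{*,*}(Y)$ as bigraded $\mathbb{M}_2$-modules. -/

import Mathlib

open CategoryTheory CategoryTheory.Limits

/-- A module over the constant `C₂`-Mackey ring `ℤ/2`. A Mackey functor admits at most one such
structure, and it does precisely when `M_Θ` and `M_•` are `𝔽₂`-vector spaces and `p_* p^* = 2`
(that is, `0`). So a module is a diagram `M_Θ ⇄ M_•` of `𝔽₂`-vector spaces with maps `t`, `p_*`,
`p^*` satisfying `t p^* = p^*`, `p_* t = p_*`, `t² = 1`, `p^* p_* = 1 + t` and `p_* p^* = 0`.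
Here `top = M_Θ`, `bot = M_•`, `tr = p_*`, `res = p^*`; composition is written in diagrammatic
order, so `res ≫ t` is `t p^*`. -/
structure MackeyMod : Type 1 where
  top : ModuleCat.{0} (ZMod 2)
  bot : ModuleCat.{0} (ZMod 2)
  t : top ⟶ top
  tr : top ⟶ bot
  res : bot ⟶ top
  res_t : res ≫ t = res
  t_tr : t ≫ tr = tr
  t_t : t ≫ t = 𝟙 top
  tr_res : tr ≫ res = 𝟙 top + t
  res_tr : res ≫ tr = 0

namespace MackeyMod

attribute [simp] res_t t_tr t_t tr_res res_tr

/-- Morphisms are pairs of linear maps commuting with `t`, `p_*` and `p^*`. -/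
structure Hom (M N : MackeyMod) : Type where
  top : M.top ⟶ N.top
  bot : M.bot ⟶ N.bot
  t_comm : M.t ≫ top = top ≫ N.t
  tr_comm : M.tr ≫ bot = top ≫ N.tr
  res_comm : M.res ≫ top = bot ≫ N.res

instance : Category MackeyMod where
  Hom := Hom
  id M := ⟨𝟙 _, 𝟙 _, by simp, by simp, by simp⟩
  comp f g := ⟨f.top ≫ g.top, f.bot ≫ g.bot,
    by rw [← Category.assoc, f.t_comm, Category.assoc, g.t_comm, Category.assoc],
    by rw [← Category.assoc, f.tr_comm, Category.assoc, g.tr_comm, Category.assoc],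
    by rw [← Category.assoc, f.res_comm, Category.assoc, g.res_comm, Category.assoc]⟩

@[ext]
lemma hom_ext {M N : MackeyMod} {f g : M ⟶ N} (h₁ : f.top = g.top) (h₂ : f.bot = g.bot) :
    f = g := by
  obtain ⟨_, _, _, _, _⟩ : Hom M N := f
  obtain ⟨_, _, _, _, _⟩ : Hom M N := g
  cases h₁; cases h₂; rfl

@[simp] lemma id_top (M : MackeyMod) : Hom.top (𝟙 M) = 𝟙 M.top := rfl
@[simp] lemma id_bot (M : MackeyMod) : Hom.bot (𝟙 M) = 𝟙 M.bot := rfl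
@[simp] lemma comp_top {M N P : MackeyMod} (f : M ⟶ N) (g : N ⟶ P) :
    Hom.top (f ≫ g) = f.top ≫ g.top := rfl
@[simp] lemma comp_bot {M N P : MackeyMod} (f : M ⟶ N) (g : N ⟶ P) :
    Hom.bot (f ≫ g) = f.bot ≫ g.bot := rfl

instance (M N : MackeyMod) : Add (M ⟶ N) where
  add f g := ⟨f.top + g.top, f.bot + g.bot, by simp [f.t_comm, g.t_comm],
    by simp [f.tr_comm, g.tr_comm], by simp [f.res_comm, g.res_comm]⟩

instance (M N : MackeyMod) : Zero (M ⟶ N) where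
  zero := ⟨0, 0, by simp, by simp, by simp⟩

instance (M N : MackeyMod) : Neg (M ⟶ N) where
  neg f := ⟨-f.top, -f.bot, by simp [f.t_comm], by simp [f.tr_comm], by simp [f.res_comm]⟩

@[simp] lemma add_top {M N : MackeyMod} (f g : M ⟶ N) : Hom.top (f + g) = f.top + g.top := rfl
@[simp] lemma add_bot {M N : MackeyMod} (f g : M ⟶ N) : Hom.bot (f + g) = f.bot + g.bot := rfl
@[simp] lemma zero_top {M N : MackeyMod} : Hom.top (0 : M ⟶ N) = 0 := rfl
@[simp] lemma zero_bot {M N : MackeyMod} : Hom.bot (0 : M ⟶ N) = 0 := rfl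
@[simp] lemma neg_top {M N : MackeyMod} (f : M ⟶ N) : Hom.top (-f) = -f.top := rfl
@[simp] lemma neg_bot {M N : MackeyMod} (f : M ⟶ N) : Hom.bot (-f) = -f.bot := rfl

instance (M N : MackeyMod) : AddCommGroup (M ⟶ N) where
  add_assoc _ _ _ := by ext1 <;> simp [add_assoc]
  zero_add _ := by ext1 <;> simp
  add_zero _ := by ext1 <;> simp
  add_comm _ _ := by ext1 <;> simp [add_comm]
  neg_add_cancel _ := by ext1 <;> simp
  nsmul := nsmulRec
  zsmul := zsmulRec

instance : Preadditive MackeyMod where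
  add_comp _ _ _ _ _ _ := by ext1 <;> simp
  comp_add _ _ _ _ _ _ := by ext1 <;> simp

/-- Evaluation `M ↦ M_Θ`. -/
def evTop : MackeyMod ⥤ ModuleCat.{0} (ZMod 2) where
  obj M := M.top
  map f := f.top

/-- Evaluation `M ↦ M_•`. -/
def evBot : MackeyMod ⥤ ModuleCat.{0} (ZMod 2) where
  obj M := M.bot
  map f := f.bot

instance : evTop.Additive where
instance : evBot.Additive where

/-- The structure maps `t`, `p_*`, `p^*` as natural transformations. -/
def tNat : evTop ⟶ evTop where
  app M := M.t
  naturality _ _ f := f.t_comm.symm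
def trNat : evTop ⟶ evBot where
  app M := M.tr
  naturality _ _ f := f.tr_comm.symm
def resNat : evBot ⟶ evTop where
  app M := M.res
  naturality _ _ f := f.res_comm.symm

lemma resNat_tNat : resNat ≫ tNat = resNat := by ext1; ext1 M; exact M.res_t
lemma tNat_trNat : tNat ≫ trNat = trNat := by ext1; ext1 M; exact M.t_tr
lemma tNat_tNat : tNat ≫ tNat = 𝟙 _ := by ext1; ext1 M; exact M.t_t
lemma trNat_resNat : trNat ≫ resNat = 𝟙 _ + tNat := by ext1; ext1 M; exact M.tr_res
lemma resNat_trNat : resNat ≫ trNat = 0 := by ext1; ext1 M; exact M.res_tr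

lemma isIso_of_top_bot {M N : MackeyMod} (f : M ⟶ N) (h₁ : IsIso f.top) (h₂ : IsIso f.bot) :
    IsIso f :=
  ⟨⟨inv f.top, inv f.bot,
    by rw [IsIso.comp_inv_eq, Category.assoc, IsIso.eq_inv_comp, f.t_comm],
    by rw [IsIso.comp_inv_eq, Category.assoc, IsIso.eq_inv_comp, f.tr_comm],
    by rw [IsIso.comp_inv_eq, Category.assoc, IsIso.eq_inv_comp, f.res_comm]⟩,
    by ext1 <;> simp, by ext1 <;> simp⟩

section Limits

variable {J : Type} [SmallCategory J] (K : J ⥤ MackeyMod)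

/-- Limits are computed on `Θ` and on `•`. -/
noncomputable def limitObj : MackeyMod where
  top := limit (K ⋙ evTop)
  bot := limit (K ⋙ evBot)
  t := lim.map (Functor.whiskerLeft K tNat)
  tr := lim.map (Functor.whiskerLeft K trNat)
  res := lim.map (Functor.whiskerLeft K resNat)
  res_t := by rw [← Functor.map_comp, ← Functor.whiskerLeft_comp, resNat_tNat]
  t_tr := by rw [← Functor.map_comp, ← Functor.whiskerLeft_comp, tNat_trNat]
  t_t := by
    rw [← Functor.map_comp, ← Functor.whiskerLeft_comp, tNat_tNat, Functor.whiskerLeft_id']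
    exact lim.map_id _
  tr_res := by
    rw [← Functor.map_comp, ← Functor.whiskerLeft_comp, trNat_resNat]
    refine limit.hom_ext fun j => ?_
    rw [Preadditive.add_comp]
    erw [limMap_π, limMap_π, Category.id_comp]
    exact Preadditive.comp_add _ _ _ _ (𝟙 _) _ |>.trans (by rw [Category.comp_id]; rfl)
  res_tr := by
    rw [← Functor.map_comp, ← Functor.whiskerLeft_comp, resNat_trNat]
    refine limit.hom_ext fun j => ?_
    rw [zero_comp]
    erw [limMap_π]
    exact comp_zero

/-- The limit cone. -/
noncomputable def limitCone : Cone K where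
  pt := limitObj K
  π :=
    { app := fun j => ⟨limit.π (K ⋙ evTop) j, limit.π (K ⋙ evBot) j,
        limMap_π (Functor.whiskerLeft K tNat) j, limMap_π (Functor.whiskerLeft K trNat) j,
        limMap_π (Functor.whiskerLeft K resNat) j⟩
      naturality := fun i j f => by
        ext1
        · exact (limit.cone (K ⋙ evTop)).π.naturality f
        · exact (limit.cone (K ⋙ evBot)).π.naturality f }

/-- The limit cone is a limit. -/
noncomputable def limitConeIsLimit : IsLimit (limitCone K) where
  lift s := ⟨limit.lift (K ⋙ evTop) (evTop.mapCone s), limit.lift (K ⋙ evBot) (evBot.mapCone s),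
    limit.hom_ext fun j => by
      erw [Category.assoc, limit.lift_π, Category.assoc, limMap_π, limit.lift_π_assoc]
      exact (s.π.app j).t_comm,
    limit.hom_ext fun j => by
      erw [Category.assoc, limit.lift_π, Category.assoc, limMap_π, limit.lift_π_assoc]
      exact (s.π.app j).tr_comm,
    limit.hom_ext fun j => by
      erw [Category.assoc, limit.lift_π, Category.assoc, limMap_π, limit.lift_π_assoc]
      exact (s.π.app j).res_comm⟩
  fac s j := by
    ext1
    · exact limit.lift_π (evTop.mapCone s) j
    · exact limit.lift_π (evBot.mapCone s) j
  uniq s m h := by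
    ext1
    · refine limit.hom_ext fun j => (congrArg Hom.top (h j)).trans ?_
      exact (limit.lift_π (evTop.mapCone s) j).symm
    · refine limit.hom_ext fun j => (congrArg Hom.bot (h j)).trans ?_
      exact (limit.lift_π (evBot.mapCone s) j).symm

instance : HasLimitsOfShape J MackeyMod where
  has_limit K := ⟨⟨⟨limitCone K, limitConeIsLimit K⟩⟩⟩

instance : PreservesLimitsOfShape J evTop where
  preservesLimit {K} := preservesLimit_of_preserves_limit_cone (limitConeIsLimit K)
    (limit.isLimit (K ⋙ evTop))

instance : PreservesLimitsOfShape J evBot where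
  preservesLimit {K} := preservesLimit_of_preserves_limit_cone (limitConeIsLimit K)
    (limit.isLimit (K ⋙ evBot))

/-- Colimits are computed on `Θ` and on `•`. -/
noncomputable def colimitObj : MackeyMod where
  top := colimit (K ⋙ evTop)
  bot := colimit (K ⋙ evBot)
  t := colim.map (Functor.whiskerLeft K tNat)
  tr := colim.map (Functor.whiskerLeft K trNat)
  res := colim.map (Functor.whiskerLeft K resNat)
  res_t := by rw [← Functor.map_comp, ← Functor.whiskerLeft_comp, resNat_tNat]
  t_tr := by rw [← Functor.map_comp, ← Functor.whiskerLeft_comp, tNat_trNat]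
  t_t := by
    rw [← Functor.map_comp, ← Functor.whiskerLeft_comp, tNat_tNat, Functor.whiskerLeft_id']
    exact colim.map_id _
  tr_res := by
    rw [← Functor.map_comp, ← Functor.whiskerLeft_comp, trNat_resNat]
    refine colimit.hom_ext fun j => ?_
    rw [Preadditive.comp_add]
    erw [ι_colimMap, ι_colimMap, Category.comp_id]
    exact Preadditive.add_comp _ _ _ (𝟙 _) _ _ |>.trans (by rw [Category.id_comp]; rfl)
  res_tr := by
    rw [← Functor.map_comp, ← Functor.whiskerLeft_comp, resNat_trNat]
    refine colimit.hom_ext fun j => ?_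
    rw [comp_zero]
    erw [ι_colimMap]
    exact zero_comp

/-- The colimit cocone. -/
noncomputable def colimitCocone : Cocone K where
  pt := colimitObj K
  ι :=
    { app := fun j => ⟨colimit.ι (K ⋙ evTop) j, colimit.ι (K ⋙ evBot) j,
        (ι_colimMap (Functor.whiskerLeft K tNat) j).symm,
        (ι_colimMap (Functor.whiskerLeft K trNat) j).symm,
        (ι_colimMap (Functor.whiskerLeft K resNat) j).symm⟩
      naturality := fun i j f => by
        ext1
        · exact (colimit.cocone (K ⋙ evTop)).ι.naturality f
        · exact (colimit.cocone (K ⋙ evBot)).ι.naturality f }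

/-- The colimit cocone is a colimit. -/
noncomputable def colimitCoconeIsColimit : IsColimit (colimitCocone K) where
  desc s := ⟨colimit.desc (K ⋙ evTop) (evTop.mapCocone s),
    colimit.desc (K ⋙ evBot) (evBot.mapCocone s),
    colimit.hom_ext fun j => by
      erw [ι_colimMap_assoc, colimit.ι_desc, colimit.ι_desc_assoc]
      exact (s.ι.app j).t_comm,
    colimit.hom_ext fun j => by
      erw [ι_colimMap_assoc, colimit.ι_desc, colimit.ι_desc_assoc]
      exact (s.ι.app j).tr_comm,
    colimit.hom_ext fun j => by
      erw [ι_colimMap_assoc, colimit.ι_desc, colimit.ι_desc_assoc]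
      exact (s.ι.app j).res_comm⟩
  fac s j := by
    ext1
    · exact colimit.ι_desc (evTop.mapCocone s) j
    · exact colimit.ι_desc (evBot.mapCocone s) j
  uniq s m h := by
    ext1
    · refine colimit.hom_ext fun j => (congrArg Hom.top (h j)).trans ?_
      exact (colimit.ι_desc (evTop.mapCocone s) j).symm
    · refine colimit.hom_ext fun j => (congrArg Hom.bot (h j)).trans ?_
      exact (colimit.ι_desc (evBot.mapCocone s) j).symm

instance : HasColimitsOfShape J MackeyMod where
  has_colimit K := ⟨⟨⟨colimitCocone K, colimitCoconeIsColimit K⟩⟩⟩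

instance : PreservesColimitsOfShape J evTop where
  preservesColimit {K} := preservesColimit_of_preserves_colimit_cocone (colimitCoconeIsColimit K)
    (colimit.isColimit (K ⋙ evTop))

instance : PreservesColimitsOfShape J evBot where
  preservesColimit {K} := preservesColimit_of_preserves_colimit_cocone (colimitCoconeIsColimit K)
    (colimit.isColimit (K ⋙ evBot))

end Limits

instance : HasFiniteLimits MackeyMod where
  out _ _ _ := inferInstance

instance : HasFiniteColimits MackeyMod where
  out _ _ _ := inferInstance

instance : HasFiniteProducts MackeyMod := hasFiniteProducts_of_hasFiniteLimits _

noncomputable instance : Abelian MackeyMod :=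
  haveI {M N : MackeyMod} (f : M ⟶ N) : IsIso (Abelian.coimageImageComparison f) := by
    apply isIso_of_top_bot
    · exact ((MorphismProperty.isomorphisms _).arrow_mk_iso_iff
        (Abelian.PreservesCoimageImageComparison.iso evTop f)).mpr
          (inferInstanceAs (IsIso (Abelian.coimageImageComparison (evTop.map f))))
    · exact ((MorphismProperty.isomorphisms _).arrow_mk_iso_iff
        (Abelian.PreservesCoimageImageComparison.iso evBot f)).mpr
          (inferInstanceAs (IsIso (Abelian.coimageImageComparison (evBot.map f))))
  Abelian.ofCoimageImageComparisonIsIso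


section Box

open TensorProduct

variable (M N : MackeyMod)

/-- The relations defining `(M □ N)_•` as a quotient of `(M_• ⊗ N_•) ⊕ (M_Θ ⊗ N_Θ)`; an element
`z` of the second summand stands for `p_*(z)`:
* `p_*(p^* m ⊗ n) = m ⊗ p_* n`,
* `p_*(m ⊗ p^* n) = p_* m ⊗ n`,
* `p_*(t m ⊗ t n) = p_*(m ⊗ n)`. -/
def boxRel : Submodule (ZMod 2) ((M.bot ⊗[ZMod 2] N.bot) × (M.top ⊗[ZMod 2] N.top)) :=
  Submodule.span (ZMod 2)
    ({z | ∃ (m : M.bot) (n : N.top), z = (0, M.res.hom m ⊗ₜ n) - (m ⊗ₜ N.tr.hom n, 0)} ∪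
     {z | ∃ (m : M.top) (n : N.bot), z = (0, m ⊗ₜ N.res.hom n) - (M.tr.hom m ⊗ₜ n, 0)} ∪
     {z | ∃ (m : M.top) (n : N.top), z = (0, M.t.hom m ⊗ₜ N.t.hom n) - (0, m ⊗ₜ n)})

lemma t_t_apply (x : M.top) : M.t.hom (M.t.hom x) = x := congr($(M.t_t) x)
lemma res_t_apply (x : M.bot) : M.t.hom (M.res.hom x) = M.res.hom x := congr($(M.res_t) x)
lemma t_tr_apply (x : M.top) : M.tr.hom (M.t.hom x) = M.tr.hom x := congr($(M.t_tr) x)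
lemma tr_res_apply (x : M.top) : M.res.hom (M.tr.hom x) = x + M.t.hom x := congr($(M.tr_res) x)
lemma res_tr_apply (x : M.bot) : M.tr.hom (M.res.hom x) = 0 := congr($(M.res_tr) x)

/-- `t` on `(M □ N)_Θ` is `t ⊗ t`. -/
noncomputable def boxT : M.top ⊗[ZMod 2] N.top →ₗ[ZMod 2] M.top ⊗[ZMod 2] N.top :=
  TensorProduct.map M.t.hom N.t.hom

/-- `p_*` is the inclusion of the second summand. -/
noncomputable def boxTr : M.top ⊗[ZMod 2] N.top →ₗ[ZMod 2]
    ((M.bot ⊗[ZMod 2] N.bot) × (M.top ⊗[ZMod 2] N.top)) ⧸ boxRel M N :=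
  (boxRel M N).mkQ ∘ₗ LinearMap.inr _ _ _

/-- `p^*` on representatives: `m ⊗ n ↦ p^* m ⊗ p^* n` and `p_*(z) ↦ z + t z`. -/
noncomputable def boxResPre :
    (M.bot ⊗[ZMod 2] N.bot) × (M.top ⊗[ZMod 2] N.top) →ₗ[ZMod 2] M.top ⊗[ZMod 2] N.top :=
  (TensorProduct.map M.res.hom N.res.hom).coprod (LinearMap.id + boxT M N)

lemma boxRel_le_ker : boxRel M N ≤ LinearMap.ker (boxResPre M N) := by
  refine Submodule.span_le.mpr ?_
  rintro z ((⟨m, n, rfl⟩ | ⟨m, n, rfl⟩) | ⟨m, n, rfl⟩)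
  · simp [boxResPre, boxT, TensorProduct.tmul_add, res_t_apply, tr_res_apply]
  · simp [boxResPre, boxT, TensorProduct.add_tmul, res_t_apply, tr_res_apply]
  · simp [boxResPre, boxT, t_t_apply, add_comm]

/-- `p^*` on `(M □ N)_•`. -/
noncomputable def boxRes : (((M.bot ⊗[ZMod 2] N.bot) × (M.top ⊗[ZMod 2] N.top)) ⧸ boxRel M N)
    →ₗ[ZMod 2] M.top ⊗[ZMod 2] N.top :=
  (boxRel M N).liftQ (boxResPre M N) (boxRel_le_ker M N)

lemma boxRes_t : boxT M N ∘ₗ boxRes M N = boxRes M N := by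
  refine Submodule.linearMap_qext _ (LinearMap.prod_ext ?_ ?_)
  · ext m n
    simp [boxRes, boxResPre, boxT, res_t_apply]
  · ext m n
    simp [boxRes, boxResPre, boxT, t_t_apply, add_comm]

lemma boxT_tr : boxTr M N ∘ₗ boxT M N = boxTr M N := by
  ext m n
  exact (Submodule.Quotient.eq _).mpr (Submodule.subset_span (Or.inr ⟨m, n, rfl⟩))

lemma boxT_t : boxT M N ∘ₗ boxT M N = LinearMap.id := by
  ext m n
  simp [boxT, t_t_apply]

lemma boxTr_res : boxRes M N ∘ₗ boxTr M N = LinearMap.id + boxT M N := by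
  ext m n
  simp [boxRes, boxResPre, boxTr]

lemma boxRes_tr : boxTr M N ∘ₗ boxRes M N = 0 := by
  refine Submodule.linearMap_qext _ (LinearMap.prod_ext ?_ ?_)
  · ext m n
    refine (Submodule.Quotient.mk_eq_zero _).mpr (Submodule.subset_span (Or.inl (Or.inl
      ⟨m, N.res.hom n, ?_⟩)))
    rw [res_tr_apply, TensorProduct.tmul_zero, Prod.mk_zero_zero, sub_zero]
    rfl
  · ext m n
    have h := LinearMap.congr_fun (boxT_tr M N) (m ⊗ₜ n)
    have e : boxRes M N (boxTr M N (m ⊗ₜ n)) = m ⊗ₜ n + boxT M N (m ⊗ₜ n) :=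
      LinearMap.congr_fun (boxTr_res M N) (m ⊗ₜ n)
    change boxTr M N (boxRes M N (boxTr M N (m ⊗ₜ n))) = 0
    rw [e, map_add, ← LinearMap.comp_apply, h, ← two_smul (ZMod 2)]
    exact zero_smul _ _

/-- The box product `M □ N`. -/
noncomputable def boxObj : MackeyMod where
  top := ModuleCat.of (ZMod 2) (M.top ⊗[ZMod 2] N.top)
  bot := ModuleCat.of (ZMod 2)
    (((M.bot ⊗[ZMod 2] N.bot) × (M.top ⊗[ZMod 2] N.top)) ⧸ boxRel M N)
  t := ModuleCat.ofHom (boxT M N)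
  tr := ModuleCat.ofHom (boxTr M N)
  res := ModuleCat.ofHom (boxRes M N)
  res_t := ModuleCat.hom_ext (boxRes_t M N)
  t_tr := ModuleCat.hom_ext (boxT_tr M N)
  t_t := ModuleCat.hom_ext (boxT_t M N)
  tr_res := ModuleCat.hom_ext (boxTr_res M N)
  res_tr := ModuleCat.hom_ext (boxRes_tr M N)

variable {M N} {M' N' : MackeyMod} (f : M ⟶ M') (g : N ⟶ N')

/-- `f □ g` on representatives. -/
noncomputable def boxPre : ((M.bot ⊗[ZMod 2] N.bot) × (M.top ⊗[ZMod 2] N.top)) →ₗ[ZMod 2]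
    ((M'.bot ⊗[ZMod 2] N'.bot) × (M'.top ⊗[ZMod 2] N'.top)) :=
  (TensorProduct.map f.bot.hom g.bot.hom).prodMap (TensorProduct.map f.top.hom g.top.hom)

lemma t_apply (x : M.top) : M'.t.hom (f.top.hom x) = f.top.hom (M.t.hom x) :=
  congr($(f.t_comm.symm) x)
lemma tr_apply (x : M.top) : M'.tr.hom (f.top.hom x) = f.bot.hom (M.tr.hom x) :=
  congr($(f.tr_comm.symm) x)
lemma res_apply (x : M.bot) : M'.res.hom (f.bot.hom x) = f.top.hom (M.res.hom x) :=
  congr($(f.res_comm.symm) x)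

lemma boxRel_le_comap : boxRel M N ≤ (boxRel M' N').comap (boxPre f g) := by
  refine Submodule.span_le.mpr ?_
  rintro z ((⟨m, n, rfl⟩ | ⟨m, n, rfl⟩) | ⟨m, n, rfl⟩)
  · exact Submodule.subset_span (Or.inl (Or.inl ⟨f.bot.hom m, g.top.hom n, by
      simp [boxPre, res_apply, tr_apply]⟩))
  · exact Submodule.subset_span (Or.inl (Or.inr ⟨f.top.hom m, g.bot.hom n, by
      simp [boxPre, res_apply, tr_apply]⟩))
  · exact Submodule.subset_span (Or.inr ⟨f.top.hom m, g.top.hom n, by simp [boxPre, t_apply]⟩)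

/-- `(f □ g)_•`. -/
noncomputable def boxMapBot : (((M.bot ⊗[ZMod 2] N.bot) × (M.top ⊗[ZMod 2] N.top)) ⧸ boxRel M N)
    →ₗ[ZMod 2] (((M'.bot ⊗[ZMod 2] N'.bot) × (M'.top ⊗[ZMod 2] N'.top)) ⧸ boxRel M' N') :=
  (boxRel M N).mapQ (boxRel M' N') (boxPre f g) (boxRel_le_comap f g)

/-- `f □ g`. -/
noncomputable def boxMap : boxObj M N ⟶ boxObj M' N' where
  top := ModuleCat.ofHom (TensorProduct.map f.top.hom g.top.hom)
  bot := ModuleCat.ofHom (boxMapBot f g)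
  t_comm := ModuleCat.hom_ext <| by
    change TensorProduct.map f.top.hom g.top.hom ∘ₗ boxT M N =
      boxT M' N' ∘ₗ TensorProduct.map f.top.hom g.top.hom
    ext m n
    simp [boxT, t_apply]
  tr_comm := ModuleCat.hom_ext <| by
    change boxMapBot f g ∘ₗ boxTr M N = boxTr M' N' ∘ₗ TensorProduct.map f.top.hom g.top.hom
    ext m n
    simp [boxTr, boxMapBot, boxPre]
  res_comm := ModuleCat.hom_ext <| by
    change TensorProduct.map f.top.hom g.top.hom ∘ₗ boxRes M N = boxRes M' N' ∘ₗ boxMapBot f g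
    refine Submodule.linearMap_qext _ (LinearMap.prod_ext ?_ ?_)
    · ext m n
      simp [boxRes, boxMapBot, boxResPre, boxPre, res_apply]
    · ext m n
      simp [boxRes, boxMapBot, boxResPre, boxPre, boxT, t_apply]

lemma box_hom_ext {P : MackeyMod} {a b : boxObj M N ⟶ P}
    (h₁ : ∀ (x : M.top) (y : N.top), a.top.hom (x ⊗ₜ[ZMod 2] y) = b.top.hom (x ⊗ₜ[ZMod 2] y))
    (h₂ : ∀ (x : M.bot) (y : N.bot),
      a.bot.hom ((boxRel M N).mkQ (x ⊗ₜ y, 0)) = b.bot.hom ((boxRel M N).mkQ (x ⊗ₜ y, 0))) :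
    a = b := by
  have e : a.top = b.top := ModuleCat.hom_ext (TensorProduct.ext' h₁)
  refine hom_ext e (ModuleCat.hom_ext (Submodule.linearMap_qext _ (LinearMap.prod_ext ?_ ?_)))
  · exact TensorProduct.ext' h₂
  · have k : (boxObj M N).tr ≫ a.bot = (boxObj M N).tr ≫ b.bot := by
      rw [a.tr_comm, b.tr_comm, e]
    exact congr($(k).hom)

/-- The box product as a bifunctor. -/
noncomputable def box : MackeyMod ⥤ MackeyMod ⥤ MackeyMod where
  obj M :=
    { obj := fun N => boxObj M N
      map := fun g => boxMap (𝟙 M) g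
      map_id := fun N => box_hom_ext (fun _ _ => rfl) (fun _ _ => rfl)
      map_comp := fun g h => box_hom_ext (fun _ _ => rfl) (fun _ _ => rfl) }
  map f :=
    { app := fun N => boxMap f (𝟙 N)
      naturality := fun _ _ g => box_hom_ext (fun _ _ => rfl) (fun _ _ => rfl) }
  map_id M := by
    ext N : 2
    exact box_hom_ext (fun _ _ => rfl) (fun _ _ => rfl)
  map_comp f g := by
    ext N : 2
    exact box_hom_ext (fun _ _ => rfl) (fun _ _ => rfl)

instance : box.Additive where
  map_add {M M' f g} := by
    ext N : 2
    refine box_hom_ext (fun x y => TensorProduct.add_tmul (f.top.hom x) (g.top.hom x) y)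
      (fun x y => ?_)
    refine (congrArg (boxRel M' N).mkQ (?_ : boxPre (f + g) (𝟙 N) (x ⊗ₜ y, 0) =
      boxPre f (𝟙 N) (x ⊗ₜ y, 0) + boxPre g (𝟙 N) (x ⊗ₜ y, 0)))
    ext
    · exact TensorProduct.add_tmul (f.bot.hom x) (g.bot.hom x) y
    · simp [boxPre]

instance (M : MackeyMod) : (box.obj M).Additive where
  map_add {N N' f g} := by
    refine box_hom_ext (fun x y => TensorProduct.tmul_add x (f.top.hom y) (g.top.hom y))
      (fun x y => ?_)
    refine (congrArg (boxRel M N').mkQ (?_ : boxPre (𝟙 M) (f + g) (x ⊗ₜ y, 0) =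
      boxPre (𝟙 M) f (x ⊗ₜ y, 0) + boxPre (𝟙 M) g (x ⊗ₜ y, 0)))
    ext
    · exact TensorProduct.tmul_add x (f.bot.hom y) (g.bot.hom y)
    · simp [boxPre]

end Box


/-- The free module `F = F_Θ`: `F_Θ = 𝔽₂⟨g, t g⟩`, `F_• = 𝔽₂⟨p_* g⟩`, with `t` the swap, `p_*` the
fold map and `p^*` the diagonal. -/
noncomputable def F : MackeyMod where
  top := ModuleCat.of (ZMod 2) (ZMod 2 × ZMod 2)
  bot := ModuleCat.of (ZMod 2) (ZMod 2)
  t := ModuleCat.ofHom ((LinearMap.snd _ _ _).prod (LinearMap.fst _ _ _))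
  tr := ModuleCat.ofHom (LinearMap.fst _ _ _ + LinearMap.snd _ _ _)
  res := ModuleCat.ofHom (LinearMap.id.prod LinearMap.id)
  res_t := rfl
  t_tr := by ext <;> simp
  t_t := rfl
  tr_res := by ext <;> simp
  res_tr := by ext; simp; decide

/-- The constant Mackey functor `H = ℤ/2`: `H_Θ = H_• = 𝔽₂`, `t = p^* = id`, `p_* = 2 = 0`. -/
noncomputable def H : MackeyMod where
  top := ModuleCat.of (ZMod 2) (ZMod 2)
  bot := ModuleCat.of (ZMod 2) (ZMod 2)
  t := 𝟙 _
  tr := 0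
  res := 𝟙 _
  res_t := by simp
  t_tr := by simp
  t_t := by simp
  tr_res := by ext; simp; decide
  res_tr := by simp

/-- `t : F ⟶ F`. -/
noncomputable def tF : F ⟶ F where
  top := F.t
  bot := 𝟙 _
  t_comm := rfl
  tr_comm := by simp
  res_comm := by simp

/-- `p : H ⟶ F`, sending the generator `1 ∈ H_•` to `p_* g`. -/
noncomputable def pHF : H ⟶ F where
  top := F.res
  bot := 𝟙 _
  t_comm := F.res_t.symm
  tr_comm := F.res_tr.symm
  res_comm := rfl

/-- `p : F ⟶ H`, sending the generator `g ∈ F_Θ` to `1 ∈ H_Θ`. -/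
noncomputable def pFH : F ⟶ H where
  top := F.tr
  bot := 0
  t_comm := F.t_tr
  tr_comm := rfl
  res_comm := F.res_tr


lemma pHF_bot : pHF.bot = 𝟙 _ := rfl
lemma pFH_bot : pFH.bot = 0 := rfl
lemma tF_bot : tF.bot = 𝟙 _ := rfl
lemma two_nsmul_hom {M N : MackeyMod} (f : M ⟶ N) : f + f = 0 := by
  ext1 <;> ext x
  · exact (two_smul (ZMod 2) (f.top.hom x)).symm.trans (zero_smul _ _)
  · exact (two_smul (ZMod 2) (f.bot.hom x)).symm.trans (zero_smul _ _)

lemma tF_tF : tF ≫ tF = 𝟙 F := hom_ext F.t_t (Category.comp_id _)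
lemma pHF_tF : pHF ≫ tF = pHF := hom_ext F.res_t (Category.comp_id _)
lemma tF_pFH : tF ≫ pFH = pFH := hom_ext F.t_tr (Category.id_comp _)
lemma pHF_pFH : pHF ≫ pFH = 0 := hom_ext F.res_tr comp_zero

/-- The possible terms of a strand: `0`, `F` or `H`. -/
inductive Cell : Type
  | zero
  | free
  | fixed

instance : HasFiniteBiproducts MackeyMod := HasFiniteBiproducts.of_hasFiniteProducts

instance : HasFiniteBiproducts (CochainComplex MackeyMod ℤ) :=
  HasFiniteBiproducts.of_hasFiniteProducts

open ZeroObject in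
/-- The module of a cell. -/
noncomputable def Cell.obj : Cell → MackeyMod
  | zero => 0
  | free => F
  | fixed => H

/-- The differential of a strand between consecutive terms: `1 + t : F ⟶ F`, `p : H ⟶ F` and
`p : F ⟶ H`. -/
noncomputable def Cell.d : (c c' : Cell) → (c.obj ⟶ c'.obj)
  | free, free => 𝟙 F + tF
  | fixed, free => pHF
  | free, fixed => pFH
  | _, _ => 0

lemma Cell.d_comp_d (c c' c'' : Cell) (h : ¬(c = free ∧ c' = fixed ∧ c'' = free)) :
    Cell.d c c' ≫ Cell.d c' c'' = 0 := by
  cases c <;> cases c' <;> cases c'' <;> first | exact zero_comp | exact comp_zero | skip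
  · change (𝟙 F + tF) ≫ (𝟙 F + tF) = 0
    rw [Preadditive.comp_add, Preadditive.add_comp, Preadditive.add_comp, tF_tF, Category.id_comp,
      Category.id_comp, Category.comp_id, add_comm tF]
    exact two_nsmul_hom _
  · change (𝟙 F + tF) ≫ pFH = 0
    rw [Preadditive.add_comp, tF_pFH, Category.id_comp]
    exact two_nsmul_hom _
  · exact absurd ⟨rfl, rfl, rfl⟩ h
  · change pHF ≫ (𝟙 F + tF) = 0
    rw [Preadditive.comp_add, pHF_tF, Category.comp_id]
    exact two_nsmul_hom _
  · exact pHF_pFH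

/-- The complex with the given cells. Complexes are indexed cohomologically: the term of
homological degree `j` sits in cohomological degree `-j`. -/
noncomputable def cellComplex (w : ℤ → Cell)
    (hw : ∀ i, ¬(w i = .free ∧ w (i + 1) = .fixed ∧ w (i + 1 + 1) = .free)) :
    CochainComplex MackeyMod ℤ :=
  CochainComplex.of (fun i => (w i).obj) (fun i => Cell.d (w i) (w (i + 1)))
    (fun i => Cell.d_comp_d _ _ _ (hw i))

/-- The complex `A_k`: copies of `F` in homological degrees `0, …, k`. -/
noncomputable def complexA (k : ℕ) : CochainComplex MackeyMod ℤ :=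
  cellComplex (fun i => if -(k : ℤ) ≤ i ∧ i ≤ 0 then .free else .zero) (by grind)

/-- The complex `H(n)`, `n ∈ ℤ`: a copy of `H` in homological degree `-n` and, for `n > 0`, copies
of `F` in homological degrees `0, -1, …, -(n-1)`, while for `n < 0` there are copies of `F` in
homological degrees `0, 1, …, -n - 1`. -/
noncomputable def complexH (n : ℤ) : CochainComplex MackeyMod ℤ :=
  cellComplex (fun i => if i = n then .fixed
    else if (0 ≤ i ∧ i < n) ∨ (n < i ∧ i ≤ 0) then .free else .zero) (by grind)

/-- The complex `B_r`: copies of `H` in homological degrees `0` and `-(r+2)` and copies of `F` in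
the `r + 1` degrees in between. -/
noncomputable def complexB (r : ℕ) : CochainComplex MackeyMod ℤ :=
  cellComplex (fun i => if i = 0 ∨ i = (r : ℤ) + 2 then .fixed
    else if 0 < i ∧ i < (r : ℤ) + 2 then .free else .zero) (by grind)

/-- Names for the fundamental complexes. -/
inductive Strand : Type
  | A (k : ℕ)
  | H (n : ℤ)
  | B (r : ℕ)

/-- The fundamental complex with a given name. -/
noncomputable def Strand.complex : Strand → CochainComplex MackeyMod ℤ
  | .A k => complexA k
  | .H n => complexH n
  | .B r => complexB r

/-- The direct sum of the suspensions `Σ^{s i}` of the fundamental complexes `S i`. -/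
noncomputable def strandSum {ι : Type} [Finite ι] (S : ι → Strand) (s : ι → ℤ) :
    CochainComplex MackeyMod ℤ :=
  ⨁ fun i => (S i).complex⟦s i⟧

noncomputable instance : HasDerivedCategory MackeyMod := HasDerivedCategory.standard _

open DerivedCategory

/-- Two complexes are quasi-isomorphic if they are isomorphic in the derived category. -/
def QIso (X Y : CochainComplex MackeyMod ℤ) : Prop := Nonempty (Q.obj X ≅ Q.obj Y)

/-- A complex is perfect if it is quasi-isomorphic to a bounded complex which in each degree is a
direct sum of finitely many copies of `H` and `F`. -/
def IsPerfect (X : CochainComplex MackeyMod ℤ) : Prop :=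
  ∃ C : CochainComplex MackeyMod ℤ, QIso X C ∧
    (∃ a b : ℤ, ∀ i, i < a ∨ b < i → IsZero (C.X i)) ∧
    ∀ i, ∃ m n : ℕ, Nonempty (C.X i ≅ (⨁ fun _ : Fin m => H) ⊞ (⨁ fun _ : Fin n => F))

/-- The bigraded cohomology `H^{p,q}(X) = 𝒟(X, Σ^p H(q))`. -/
abbrev Coh (X : CochainComplex MackeyMod ℤ) (p q : ℤ) : Type 1 :=
  Q.obj X ⟶ (Q.obj (complexH q))⟦p⟧

/-- The homogeneous components `H^{p,q}(H)` of the bigraded ring `𝕄₂`. -/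
abbrev M2 (p q : ℤ) : Type 1 := Coh (complexH 0) p q

instance : Projective H where
  factors {E N} f e he := by
    have : Epi e.bot := inferInstanceAs (Epi (evBot.map e))
    obtain ⟨y, hy⟩ := (ModuleCat.epi_iff_surjective _).mp this (f.bot.hom (1 : ZMod 2))
    let g₀ : (ZMod 2) →ₗ[ZMod 2] E.bot := LinearMap.toSpanSingleton _ _ y
    let g : H ⟶ E :=
      { top := ModuleCat.ofHom (E.res.hom ∘ₗ g₀)
        bot := ModuleCat.ofHom g₀
        t_comm := ModuleCat.hom_ext (LinearMap.ext fun c => (res_t_apply E (g₀ c)).symm)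
        tr_comm := ModuleCat.hom_ext (LinearMap.ext fun c =>
          (map_zero g₀).trans (res_tr_apply E (g₀ c)).symm)
        res_comm := rfl }
    have h : (g ≫ e).bot = f.bot := ModuleCat.hom_ext (LinearMap.ext_ring (by
      change e.bot.hom (g₀ 1) = _
      rw [LinearMap.toSpanSingleton_apply_one]
      exact hy))
    refine ⟨g, hom_ext ?_ h⟩
    have e₁ : H.res ≫ (g ≫ e).top = H.res ≫ f.top := by
      rw [(g ≫ e).res_comm, f.res_comm, h]
    exact e₁

open ZeroObject in
lemma complexH_zero_X_of_ne (i : ℤ) (hi : i ≠ 0) : (complexH 0).X i = 0 := by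
  have h : ¬((0 ≤ i ∧ i < 0) ∨ (0 < i ∧ i ≤ 0)) := by grind
  change Cell.obj (if i = 0 then .fixed
    else if (0 ≤ i ∧ i < 0) ∨ (0 < i ∧ i ≤ 0) then .free else .zero) = 0
  rw [if_neg hi, if_neg h]
  rfl

instance : (complexH 0).IsKProjective := by
  have : (complexH 0).IsStrictlyLE 0 := by
    rw [CochainComplex.isStrictlyLE_iff]
    intro i hi
    rw [complexH_zero_X_of_ne i hi.ne']
    exact isZero_zero _
  have (i : ℤ) : Projective ((complexH 0).X i) := by
    by_cases hi : i = 0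
    · subst hi
      exact inferInstanceAs (Projective H)
    · rw [complexH_zero_X_of_ne i hi]
      exact Projective.zero_projective
  exact CochainComplex.isKProjective_of_projective _ 0

lemma exists_rep {K L : CochainComplex MackeyMod ℤ} [K.IsKProjective] (a : Q.obj K ⟶ Q.obj L) :
    ∃ f : K ⟶ L, Q.map f = a := by
  obtain ⟨g, hg⟩ := (CochainComplex.IsKProjective.Qh_map_bijective K
    ((HomotopyCategory.quotient _ _).obj L)).surjective
    ((quotientCompQhIso MackeyMod).hom.app K ≫ a ≫ (quotientCompQhIso MackeyMod).inv.app L)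
  obtain ⟨f, rfl⟩ := (HomotopyCategory.quotient _ _).map_surjective g
  refine ⟨f, ?_⟩
  rw [← cancel_epi ((quotientCompQhIso MackeyMod).hom.app K), ← quotientCompQhIso_hom_naturality, hg]
  simp

/-- The box product of complexes (total complex of the bicomplex of box products). -/
noncomputable abbrev boxC (K L : CochainComplex MackeyMod ℤ) : CochainComplex MackeyMod ℤ :=
  CochainComplex.mapBifunctor K L box

lemma exists_rep_M2 {p q : ℤ} (a : M2 p q) : ∃ f : complexH 0 ⟶ (complexH q)⟦p⟧,
    Q.map f ≫ (Q.commShiftIso p).hom.app (complexH q) = a := by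
  obtain ⟨f, hf⟩ := exists_rep (a ≫ (Q.commShiftIso p).inv.app (complexH q))
  exact ⟨f, by rw [hf]; simp⟩

/-- A chain map representing `a ∈ H^{p,q}(H)`. -/
noncomputable def rep {p q : ℤ} (a : M2 p q) : complexH 0 ⟶ (complexH q)⟦p⟧ :=
  (exists_rep_M2 a).choose

/-- The unique equivalence `H(q) □ H(s) ≃ H(q + s)` in the derived category. -/
noncomputable def boxEquiv (q s : ℤ) : Q.obj (boxC (complexH q) (complexH s)) ⟶
    Q.obj (complexH (q + s)) :=
  Classical.epsilon fun e => IsIso e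

/-- The unique equivalence `H(s) ≃ H □ H(s)` in the derived category. -/
noncomputable def boxUnit (s : ℤ) : Q.obj (complexH s) ⟶
    Q.obj (boxC (complexH 0) (complexH s)) :=
  Classical.epsilon fun e => IsIso e

/-- Multiplication by `a : H ⟶ Σ^p H(q)` on the coefficients: the composite
`H(s) ≃ H □ H(s) ⟶ (Σ^p H(q)) □ H(s) ≅ Σ^p (H(q) □ H(s)) ≃ Σ^p H(q + s)`
whose second map is `a □ H(s)`. All complexes involved are bounded complexes of projectives, so the
box product of complexes computes the derived box product. -/
noncomputable def mulMap {p q : ℤ} (a : M2 p q) (s : ℤ) :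
    Q.obj (complexH s) ⟶ (Q.obj (complexH (q + s)))⟦p⟧ :=
  boxUnit s ≫ Q.map (HomologicalComplex.mapBifunctorMap (rep a) (𝟙 (complexH s)) box (.up ℤ)) ≫
    Q.map (CochainComplex.mapBifunctorShift₁Iso (complexH q) (complexH s) box p).hom ≫
    (Q.commShiftIso p).hom.app (boxC (complexH q) (complexH s)) ≫ (boxEquiv q s)⟦p⟧'

/-- The action `H^{p,q}(H) × H^{r,s}(X) ⟶ H^{p+r,q+s}(X)` of `𝕄₂` on the cohomology of `X`. The
product of `a` and `x` is the derived box product `a □ x : X ≃ H □ X ⟶ Σ^p H(q) □ Σ^r H(s)`,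
which by bifunctoriality is `x` followed by `a □ Σ^r H(s)`. -/
noncomputable def act {X : CochainComplex MackeyMod ℤ} {p q r s : ℤ} (a : M2 p q)
    (x : Coh X r s) : Coh X (p + r) (q + s) :=
  x ≫ (mulMap a s)⟦r⟧' ≫ (shiftFunctorAdd (DerivedCategory MackeyMod) p r).inv.app _

/-- The bigraded cohomologies of `X` and `Y` are isomorphic as bigraded `𝕄₂`-modules: there are
additive bijections `H^{p,q}(X) ≃ H^{p,q}(Y)` for all `p, q` which commute with multiplication by
every homogeneous element of `𝕄₂`. -/
def CohomologyIso (X Y : CochainComplex MackeyMod ℤ) : Prop :=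
  ∃ φ : ∀ p q : ℤ, Coh X p q ≃+ Coh Y p q,
    ∀ (p q r s : ℤ) (a : M2 p q) (x : Coh X r s),
      φ (p + r) (q + s) (act a x) = act a (φ r s x)

end MackeyMod

/-!
Every perfect complex is a direct sum of suspended strands (the fundamental complexes `A_k`, `H(n)`
and `B_r`), and the cohomology of such a sum, as a module over `𝕄₂`, determines the strands. Both
parts of the theorem follow, since isomorphic objects have isomorphic cohomology.

The decomposition is `IsPerfect.exists_strandSum`. A bounded complex of finite sums of copies of `H`
and `F` arises by attaching cells one at a time, from the top cohomological degree downwards, and in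
each degree first the cells `H` and then the cells `F` (`cell_induction`). Let a cell be attached
along a map `α` to a sum of strands. Nonzero maps from the cell to the strands which can occur are
totally ordered by divisibility (`StrandObjH.total`, `StrandObj.total`). So one component of `α`
divides all the others (`exists_pivot`), a change of basis removes these (`cone_pivot`), and the cone
of the remaining component is a strand or zero (`Word.IsR.cone_H`, `Word.IsR.cone_F`). All complexes
are described by words, the sequences of their cells. Maps from and to a cell are classes of cycles,
so that groups of maps are read off from three consecutive letters.

All groups `[S, H(q)]^p` with `S` a strand that matter here have order one
or two. They are computed from the triangle `F ⟶ H(s) ⟶ H(1 + s)[1] ⟶ F[1]` with middle map `rho s`,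
and from the cone of the nonzero map `tau s : H(s) ⟶ H(1 + s)`, which is invisible to `F`. This also
shows where `rho` and `tau` act injectively.

The maps `rho s`, and for `s ≥ 1` the maps `tau s`, are multiplication by
elements `ρ ∈ H^{1,1}(H)` and `τ ∈ H^{0,1}(H)` (`exists_rho`, `exists_tau`). Since the groups in
which these maps live have order two, this only requires that `H(1) □ H(s)` is equivalent to
`H(1 + s)` (`bx_H_one`), which comes from the acyclicity of `B_0 □ F`, and that `ρ □ H(s)` and
`τ □ H(s)` do not vanish.

On a sum of strands the image of a power of `ρ` or of `τ` in a given bidegree has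
`2 ^ N` elements, where `N` is the number of strands on which the map does not vanish. In suitable
ranges of bidegrees this counts the strands which satisfy `Strand.RhoStable`, `Strand.TauStable` and
`Strand.RhoPeriodic`. The multiplicity of each suspended strand is an alternating sum of four such
numbers (`indicator_A`, `indicator_B`, `indicator_H`), hence an invariant of the cohomology
(`CohomologyIso.exists_equiv`).
-/

set_option linter.unusedSectionVars false

namespace MackeyMod

open DerivedCategory Pretriangulated

/-! ### Maps between the cells `H` and `F` -/

lemma hom_neg_eq {M N : MackeyMod} (f : M ⟶ N) : -f = f :=
  neg_eq_of_add_eq_zero_left (two_nsmul_hom f)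

lemma hom_sub_eq {M N : MackeyMod} (f g : M ⟶ N) : f - g = f + g := by
  rw [sub_eq_add_neg, hom_neg_eq]

lemma zmod_two_cases (x : ZMod 2) : x = 0 ∨ x = 1 := by
  revert x; decide

lemma pFH_pHF : pFH ≫ pHF = 𝟙 F + tF := by
  have h : Hom.bot (𝟙 F + 𝟙 F) = 0 := congrArg Hom.bot (two_nsmul_hom (𝟙 F))
  exact hom_ext F.tr_res (zero_comp.trans h.symm)

/-- A map out of `F` is determined by the image of the generator `g = (1, 0)`. -/
lemma F_hom_ext {N : MackeyMod} {f g : F ⟶ N}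
    (h : f.top.hom ((1, 0) : ZMod 2 × ZMod 2) = g.top.hom ((1, 0) : ZMod 2 × ZMod 2)) :
    f = g := by
  have h' : f.top.hom ((0, 1) : ZMod 2 × ZMod 2) = g.top.hom ((0, 1) : ZMod 2 × ZMod 2) := by
    have e₁ := t_apply f ((1, 0) : ZMod 2 × ZMod 2)
    have e₂ := t_apply g ((1, 0) : ZMod 2 × ZMod 2)
    rw [h] at e₁
    exact e₁.symm.trans e₂
  have ht : f.top = g.top := ModuleCat.hom_ext (LinearMap.prod_ext
    (LinearMap.ext_ring h) (LinearMap.ext_ring h'))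
  refine hom_ext ht (ModuleCat.hom_ext (LinearMap.ext_ring ?_))
  have e₁ := tr_apply f ((1, 0) : ZMod 2 × ZMod 2)
  have e₂ := tr_apply g ((1, 0) : ZMod 2 × ZMod 2)
  rw [h, e₂] at e₁
  have e : F.tr.hom ((1, 0) : ZMod 2 × ZMod 2) = (1 : ZMod 2) := add_zero _
  rw [e] at e₁
  exact e₁.symm

lemma H_hom_ext {N : MackeyMod} {f g : H ⟶ N}
    (h : f.bot.hom (1 : ZMod 2) = g.bot.hom (1 : ZMod 2)) : f = g := by
  have hb : f.bot = g.bot := ModuleCat.hom_ext (LinearMap.ext_ring h)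
  refine hom_ext ?_ hb
  have e₁ : H.res ≫ f.top = H.res ≫ g.top := by rw [f.res_comm, g.res_comm, hb]
  exact e₁

lemma hom_H_H (f : H ⟶ H) : f = 0 ∨ f = 𝟙 H :=
  (zmod_two_cases (f.bot.hom (1 : ZMod 2))).imp (fun h => H_hom_ext h) (fun h => H_hom_ext h)

lemma hom_H_F (f : H ⟶ F) : f = 0 ∨ f = pHF :=
  (zmod_two_cases (f.bot.hom (1 : ZMod 2))).imp (fun h => H_hom_ext h) (fun h => H_hom_ext h)

lemma pFH_gen : pFH.top.hom ((1, 0) : ZMod 2 × ZMod 2) = (1 : ZMod 2) := add_zero _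

lemma hom_F_H (f : F ⟶ H) : f = 0 ∨ f = pFH :=
  (zmod_two_cases (f.top.hom ((1, 0) : ZMod 2 × ZMod 2))).imp (fun h => F_hom_ext h)
    (fun h => F_hom_ext (h.trans pFH_gen.symm))

/-- `End(F)` is the group ring `𝔽₂[C₂]`. -/
lemma hom_F_F (f : F ⟶ F) : f = 0 ∨ f = 𝟙 F ∨ f = tF ∨ f = 𝟙 F + tF := by
  have e : ∀ x : ZMod 2 × ZMod 2, x = 0 ∨ x = (1, 0) ∨ x = (0, 1) ∨ x = (1, 0) + (0, 1) := by
    decide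
  rcases e (f.top.hom ((1, 0) : ZMod 2 × ZMod 2)) with h | h | h | h
  · exact Or.inl (F_hom_ext h)
  · exact Or.inr (Or.inl (F_hom_ext h))
  · exact Or.inr (Or.inr (Or.inl (F_hom_ext h)))
  · exact Or.inr (Or.inr (Or.inr (F_hom_ext h)))

lemma id_H_ne_zero : (𝟙 H : H ⟶ H) ≠ 0 := fun h =>
  one_ne_zero (α := ZMod 2) congr(($h).bot.hom (1 : ZMod 2))

lemma pHF_ne_zero : pHF ≠ 0 := fun h =>
  one_ne_zero (α := ZMod 2) congr(($h).bot.hom (1 : ZMod 2))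

lemma pFH_ne_zero : pFH ≠ 0 := fun h =>
  one_ne_zero (α := ZMod 2)
    (pFH_gen.symm.trans congr(($h).top.hom ((1, 0) : ZMod 2 × ZMod 2)))

lemma one_add_tF_ne_zero : 𝟙 F + tF ≠ 0 := fun h => by
  have e : ((1, 0) + (0, 1) : ZMod 2 × ZMod 2) = 0 :=
    congr(($h).top.hom ((1, 0) : ZMod 2 × ZMod 2))
  exact absurd e (by decide)

lemma id_F_ne_zero : (𝟙 F : F ⟶ F) ≠ 0 := fun h => by
  have e : ((1, 0) : ZMod 2 × ZMod 2) = 0 :=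
    congr(($h).top.hom ((1, 0) : ZMod 2 × ZMod 2))
  exact absurd e (by decide)

instance : Projective F where
  factors {E N} f e he := by
    have : Epi e.top := inferInstanceAs (Epi (evTop.map e))
    obtain ⟨y, hy⟩ := (ModuleCat.epi_iff_surjective _).mp this
      (f.top.hom ((1, 0) : ZMod 2 × ZMod 2))
    let a : ZMod 2 →ₗ[ZMod 2] E.top := LinearMap.toSpanSingleton _ _ y
    let b : ZMod 2 →ₗ[ZMod 2] E.top := LinearMap.toSpanSingleton _ _ (E.t.hom y)
    let c : ZMod 2 →ₗ[ZMod 2] E.bot := LinearMap.toSpanSingleton _ _ (E.tr.hom y)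
    let g : F ⟶ E :=
      { top := ModuleCat.ofHom (a.coprod b)
        bot := ModuleCat.ofHom c
        t_comm := by
          refine ModuleCat.hom_ext (LinearMap.prod_ext (LinearMap.ext_ring ?_)
            (LinearMap.ext_ring ?_))
          · change a 0 + b 1 = E.t.hom (a 1 + b 0)
            simp [a, b]
          · change a 1 + b 0 = E.t.hom (a 0 + b 1)
            simp [a, b, t_t_apply]
        tr_comm := by
          refine ModuleCat.hom_ext (LinearMap.prod_ext (LinearMap.ext_ring ?_)
            (LinearMap.ext_ring ?_))
          · change c (1 + 0) = E.tr.hom (a 1 + b 0)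
            simp [a, b, c]
          · change c (0 + 1) = E.tr.hom (a 0 + b 1)
            simp [a, b, c, t_tr_apply]
        res_comm := by
          refine ModuleCat.hom_ext (LinearMap.ext_ring ?_)
          change a 1 + b 1 = E.res.hom (c 1)
          simp [a, b, c, tr_res_apply] }
    refine ⟨g, F_hom_ext ?_⟩
    change e.top.hom (a 1 + b 0) = _
    simpa [a, b] using hy

open ZeroObject in
instance (c : Cell) : Projective c.obj := by
  cases c
  · exact inferInstanceAs (Projective (0 : MackeyMod))
  · exact inferInstanceAs (Projective F)
  · exact inferInstanceAs (Projective H)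

lemma isZero_zero_obj : IsZero Cell.zero.obj := isZero_zero _

namespace Cell

/-- The basic map between two cells: the identity of a cell, `p` between distinct nonzero cells. -/
noncomputable def thr : (c c' : Cell) → (c.obj ⟶ c'.obj)
  | free, free => 𝟙 F
  | fixed, fixed => 𝟙 H
  | fixed, free => pHF
  | free, fixed => pFH
  | _, _ => 0

/-- Whether `thr c₁ c₁' ≫ d c₁' c₂'` is `d c₁ c₂'` (rather than zero). -/
def nzL : Cell → Cell → Cell → Bool
  | free, free, free => true
  | free, free, fixed => true
  | free, fixed, free => true
  | fixed, fixed, free => true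
  | _, _, _ => false

/-- Whether `d c₁ c₂ ≫ thr c₂ c₂'` is `d c₁ c₂'` (rather than zero). -/
def nzR : Cell → Cell → Cell → Bool
  | free, free, free => true
  | free, fixed, fixed => true
  | free, fixed, free => true
  | fixed, free, free => true
  | _, _, _ => false

lemma thr_comp_d (c₁ c₁' c₂' : Cell) :
    thr c₁ c₁' ≫ d c₁' c₂' = if nzL c₁ c₁' c₂' then d c₁ c₂' else 0 := by
  cases c₁ <;> cases c₁' <;> cases c₂' <;>
    first
    | exact zero_comp
    | exact comp_zero
    | exact Category.id_comp _
    | exact pFH_pHF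
    | exact pHF_pFH
    | exact d_comp_d fixed free free (by simp)

lemma d_comp_thr (c₁ c₂ c₂' : Cell) :
    d c₁ c₂ ≫ thr c₂ c₂' = if nzR c₁ c₂ c₂' then d c₁ c₂' else 0 := by
  cases c₁ <;> cases c₂ <;> cases c₂' <;>
    first
    | exact zero_comp
    | exact comp_zero
    | exact Category.comp_id _
    | exact pFH_pHF
    | exact pHF_pFH
    | exact d_comp_d free free fixed (by simp)

lemma thr_self (c : Cell) : thr c c = 𝟙 _ := by
  cases c
  · exact isZero_zero_obj.eq_of_src _ _
  · rfl
  · rfl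

lemma hom_from_zero {c : Cell} {N : MackeyMod} (f : c.obj ⟶ N) (h : c = zero) : f = 0 := by
  subst h; exact isZero_zero_obj.eq_of_src _ _

lemma hom_to_zero {c : Cell} {N : MackeyMod} (f : N ⟶ c.obj) (h : c = zero) : f = 0 := by
  subst h; exact isZero_zero_obj.eq_of_tgt _ _

lemma thr_comp_thr (c c' c'' : Cell) (h : c' ≠ zero) (h' : c = c' ∨ c' = c'') :
    thr c c' ≫ thr c' c'' = thr c c'' := by
  rcases h' with rfl | rfl
  · rw [thr_self, Category.id_comp]
  · rw [thr_self, Category.comp_id]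

end Cell

/-! ### Complexes given by words -/

/-- A word is a sequence of cells in which `F, H, F` never occur consecutively; it is the
combinatorial datum of a `cellComplex`. -/
@[ext]
structure Word where
  /-- the cell in each cohomological degree -/
  c : ℤ → Cell
  ok : ∀ i, ¬(c i = .free ∧ c (i + 1) = .fixed ∧ c (i + 1 + 1) = .free)

namespace Word

/-- The complex of a word. -/
noncomputable abbrev cx (w : Word) : CochainComplex MackeyMod ℤ := cellComplex w.c w.ok

/-- The word of `A_k`. -/
def A (k : ℕ) : Word := ⟨fun i => if -(k : ℤ) ≤ i ∧ i ≤ 0 then .free else .zero, by grind⟩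

/-- The word of `H(n)`. -/
def H (n : ℤ) : Word := ⟨fun i => if i = n then .fixed
    else if (0 ≤ i ∧ i < n) ∨ (n < i ∧ i ≤ 0) then .free else .zero, by grind⟩

/-- The word of `B_r`. -/
def B (r : ℕ) : Word := ⟨fun i => if i = 0 ∨ i = (r : ℤ) + 2 then .fixed
    else if 0 < i ∧ i < (r : ℤ) + 2 then .free else .zero, by grind⟩

/-- The word of a suspension. -/
@[simps]
def sh (w : Word) (a : ℤ) : Word := ⟨fun i => w.c (i + a), fun i => by
  have := w.ok (i + a)
  rwa [show i + a + 1 = i + 1 + a by ring, show i + 1 + a + 1 = i + 1 + 1 + a by ring] at this⟩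

lemma d_eq (w : Word) (i : ℤ) : w.cx.d i (i + 1) = Cell.d (w.c i) (w.c (i + 1)) :=
  CochainComplex.of_d (fun i => (w.c i).obj) (fun i => Cell.d (w.c i) (w.c (i + 1))) i

/-- The condition for the cellwise basic maps to commute with the differentials. It is stated with
`nzL` and `nzR`, so that it is decided by the cells alone. -/
def Compat (w w' : Word) : Prop :=
  ∀ i, Cell.nzL (w.c i) (w'.c i) (w'.c (i + 1)) = Cell.nzR (w.c i) (w.c (i + 1)) (w'.c (i + 1))

/-- The chain map which is the basic map in each degree. -/
noncomputable def thr {w w' : Word} (h : Compat w w') : w.cx ⟶ w'.cx where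
  f i := Cell.thr (w.c i) (w'.c i)
  comm' i j hij := by
    obtain rfl : i + 1 = j := hij
    rw [d_eq, d_eq]
    change Cell.thr (w.c i) (w'.c i) ≫ _ = _ ≫ Cell.thr (w.c (i + 1)) (w'.c (i + 1))
    rw [Cell.thr_comp_d, Cell.d_comp_thr, h i]

/-- Suspension of words is suspension of complexes (signs do not matter). -/
noncomputable def shIso (w : Word) (a : ℤ) : (w.sh a).cx ≅ w.cx⟦a⟧ :=
  HomologicalComplex.Hom.isoOfComponents (fun _ => Iso.refl _) (by
    intro i j hij
    obtain rfl : i + 1 = j := hij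
    change 𝟙 _ ≫ (w.cx⟦a⟧).d i (i + 1) = (w.sh a).cx.d i (i + 1) ≫ 𝟙 _
    rw [Category.id_comp, Category.comp_id, d_eq, CochainComplex.shiftFunctor_obj_d']
    have e : w.cx.d (i + a) (i + 1 + a) = Cell.d (w.c (i + a)) (w.c (i + 1 + a)) := by
      have : i + 1 + a = i + a + 1 := by ring
      rw [this]; exact d_eq w (i + a)
    rcases Int.even_or_odd a with ha | ha
    · rw [Int.negOnePow_even a ha, one_smul]; exact e
    · rw [Int.negOnePow_odd a ha, Units.neg_smul, one_smul, hom_neg_eq]; exact e)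

/-- The suspended word complex, in the derived category. -/
noncomputable def QshIso (w : Word) (a : ℤ) : Q.obj (w.sh a).cx ≅ (Q.obj w.cx)⟦a⟧ :=
  Q.mapIso (w.shIso a) ≪≫ (Q.commShiftIso a).app w.cx

/-- A word whose cells vanish above some degree; its complex is then K-projective. -/
def Bdd (w : Word) : Prop := ∃ N : ℤ, ∀ i, N < i → w.c i = .zero

lemma isKProjective {w : Word} (hw : w.Bdd) : w.cx.IsKProjective := by
  obtain ⟨N, hN⟩ := hw
  have : w.cx.IsStrictlyLE N := by
    rw [CochainComplex.isStrictlyLE_iff]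
    intro i hi
    change IsZero (w.c i).obj
    rw [hN i hi]; exact isZero_zero_obj
  have (i : ℤ) : Projective (w.cx.X i) := inferInstanceAs (Projective (w.c i).obj)
  exact CochainComplex.isKProjective_of_projective _ N

lemma bdd_A (k : ℕ) : (A k).Bdd := ⟨0, fun i hi => if_neg (by omega)⟩
lemma bdd_H (n : ℤ) : (H n).Bdd := ⟨max n 0, fun i hi => by
  simp only [H]; rw [if_neg (by grind), if_neg (by grind)]⟩
lemma bdd_B (r : ℕ) : (B r).Bdd := ⟨r + 2, fun i hi => by
  simp only [B]; rw [if_neg (by omega), if_neg (by omega)]⟩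
lemma Bdd.sh {w : Word} (h : w.Bdd) (a : ℤ) : (w.sh a).Bdd := by
  obtain ⟨N, hN⟩ := h
  exact ⟨N - a, fun i hi => hN _ (by omega)⟩

end Word

/-- Maps out of a K-projective complex vanish in the derived category only if they are
null-homotopic. -/
lemma Q_map_eq_zero_iff {K L : CochainComplex MackeyMod ℤ} (hK : K.IsKProjective) (f : K ⟶ L) :
    Q.map f = 0 ↔ Nonempty (Homotopy f 0) := by
  constructor
  · intro h
    have e : Qh.map ((HomotopyCategory.quotient _ _).map f) =
        Qh.map ((HomotopyCategory.quotient _ _).map (0 : K ⟶ L)) := by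
      have h' := quotientCompQhIso_hom_naturality (C := MackeyMod) f
      rw [h, comp_zero] at h'
      have : Qh.map ((HomotopyCategory.quotient _ _).map f) = 0 := by
        rw [← cancel_mono ((quotientCompQhIso MackeyMod).hom.app L)]
        simpa using h'
      rw [this]; simp
    exact ⟨HomotopyCategory.homotopyOfEq _ _
      ((CochainComplex.IsKProjective.Qh_map_bijective K _).injective e)⟩
  · rintro ⟨h⟩
    simpa using Q_map_eq_of_homotopy (C := MackeyMod) h

/-! ### Groups of order at most two -/

section GroupPredicates

variable {A B : Type*} [AddCommGroup A] [AddCommGroup B]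

/-- The group is trivial. -/
def GVan (A : Type*) [AddCommGroup A] : Prop := ∀ a : A, a = 0

/-- There is at most one nonzero element. In abelian groups of exponent two this says that the order
is at most two. -/
def GLe (A : Type*) [AddCommGroup A] : Prop := ∀ a b : A, a ≠ 0 → b ≠ 0 → a = b

/-- There is exactly one nonzero element; all one-dimensional groups of maps between strands are used
through this property. -/
def GOne (A : Type*) [AddCommGroup A] : Prop := GLe A ∧ ∃ a : A, a ≠ 0

lemma GVan.of_injective (f : A →+ B) (hf : ∀ a, f a = 0 → a = 0) (h : GVan B) : GVan A :=
  fun a => hf a (h _)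

lemma GVan.of_surjective (f : A →+ B) (hf : ∀ b, ∃ a, f a = b) (h : GVan A) : GVan B :=
  fun b => by obtain ⟨a, rfl⟩ := hf b; rw [h a, map_zero]

lemma GLe.of_injective (f : A →+ B) (hf : ∀ a, f a = 0 → a = 0) (h : GLe B) : GLe A :=
  fun a b ha hb => by
    have := h (f a) (f b) (fun e => ha (hf _ e)) (fun e => hb (hf _ e))
    rw [← sub_eq_zero]
    exact hf _ (by rw [map_sub, this, sub_self])

lemma GLe.of_surjective (f : A →+ B) (hf : ∀ b, ∃ a, f a = b) (h : GLe A) : GLe B :=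
  fun b b' hb hb' => by
    obtain ⟨a, rfl⟩ := hf b
    obtain ⟨a', rfl⟩ := hf b'
    rw [h a a' (by rintro rfl; exact hb (map_zero f)) (by rintro rfl; exact hb' (map_zero f))]

lemma GVan.congr (e : A ≃+ B) : GVan A ↔ GVan B :=
  ⟨GVan.of_surjective e.toAddMonoidHom e.surjective,
    GVan.of_injective e.toAddMonoidHom fun _ h => (map_eq_zero_iff e e.injective).mp h⟩

lemma GLe.congr (e : A ≃+ B) : GLe A ↔ GLe B :=
  ⟨GLe.of_surjective e.toAddMonoidHom e.surjective,
    GLe.of_injective e.toAddMonoidHom fun _ h => (map_eq_zero_iff e e.injective).mp h⟩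

lemma GOne.congr (e : A ≃+ B) : GOne A ↔ GOne B := by
  refine and_congr (GLe.congr e) ⟨?_, ?_⟩
  · rintro ⟨a, ha⟩
    exact ⟨e a, fun h => ha ((map_eq_zero_iff e e.injective).mp h)⟩
  · rintro ⟨b, hb⟩
    exact ⟨e.symm b, fun h => hb ((map_eq_zero_iff e.symm e.symm.injective).mp h)⟩

/-- An injective map from a group of order two to a group of order at most two is bijective. -/
lemma GOne.surj_of_injective (f : A →+ B) (hf : ∀ a, f a = 0 → a = 0) (h : GOne A) (h' : GLe B)
    (b : B) : ∃ a, f a = b := by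
  by_cases hb : b = 0
  · exact ⟨0, by rw [map_zero, hb]⟩
  · obtain ⟨a, ha⟩ := h.2
    exact ⟨a, h' _ _ (fun e => ha (hf _ e)) hb⟩

/-- A surjective map from a group of order at most two onto one of order two is injective. -/
lemma GOne.inj_of_surjective (f : A →+ B) (hf : ∀ b, ∃ a, f a = b) (h : GLe A) (h' : GOne B)
    (a : A) (ha : f a = 0) : a = 0 := by
  obtain ⟨b, hb⟩ := h'.2
  obtain ⟨a', rfl⟩ := hf b
  by_contra hne
  rw [h a' a (by rintro rfl; exact hb (map_zero f)) hne] at hb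
  exact hb ha

end GroupPredicates

/-! ### Long exact sequences and split cones -/

section Triangulated

universe v u
variable {C : Type u} [Category.{v} C] [Preadditive C] [HasZeroObject C] [HasShift C ℤ]
  [∀ n : ℤ, (shiftFunctor C n).Additive] [Pretriangulated C]

/-- `[X, Y]^p = 0`. -/
def Van (X Y : C) (p : ℤ) : Prop := GVan (X ⟶ Y⟦p⟧)

/-- `[X, Y]^p` has at most one nonzero element. -/
def Le (X Y : C) (p : ℤ) : Prop := GLe (X ⟶ Y⟦p⟧)

/-- `[X, Y]^p` has exactly one nonzero element. -/
def One (X Y : C) (p : ℤ) : Prop := GOne (X ⟶ Y⟦p⟧)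

lemma One.le {X Y : C} {p : ℤ} (h : One X Y p) : Le X Y p := h.1

/-- Suspending the target. -/
noncomputable def homShiftTgt (X Y : C) {p b q : ℤ} (h : p = b + q) :
    (X ⟶ Y⟦p⟧) ≃+ (X ⟶ Y⟦b⟧⟦q⟧) where
  toFun f := f ≫ (shiftFunctorAdd' C b q p h.symm).hom.app Y
  invFun f := f ≫ (shiftFunctorAdd' C b q p h.symm).inv.app Y
  left_inv f := by simp
  right_inv f := by simp
  map_add' f g := by simp

/-- The groups `[X, Y]^p` only depend on isomorphism classes. -/
noncomputable def homCongr {X X' Y Y' : C} (e : X ≅ X') (e' : Y ≅ Y') (p : ℤ) :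
    (X ⟶ Y⟦p⟧) ≃+ (X' ⟶ Y'⟦p⟧) where
  toFun f := e.inv ≫ f ≫ e'.hom⟦p⟧'
  invFun f := e.hom ≫ f ≫ e'.inv⟦p⟧'
  left_inv f := by simp [← Functor.map_comp]
  right_inv f := by simp [← Functor.map_comp]
  map_add' f g := by simp

lemma van_tgt_iff (X Y : C) {p b q : ℤ} (h : p = b + q) :
    Van X (Y⟦b⟧) q ↔ Van X Y p := (GVan.congr (homShiftTgt X Y h)).symm
lemma one_tgt_iff (X Y : C) {p b q : ℤ} (h : p = b + q) :
    One X (Y⟦b⟧) q ↔ One X Y p := (GOne.congr (homShiftTgt X Y h)).symm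

/-- Suspending the source. -/
noncomputable def homShiftSrc (X Y : C) {p a q : ℤ} (h : p + a = q) :
    (X ⟶ Y⟦p⟧) ≃+ (X⟦a⟧ ⟶ Y⟦q⟧) where
  toFun f := f⟦a⟧' ≫ (shiftFunctorAdd' C p a q h).inv.app Y
  invFun g := (shiftFunctor C a).preimage (g ≫ (shiftFunctorAdd' C p a q h).hom.app Y)
  left_inv f := (shiftFunctor C a).map_injective (by simp)
  right_inv g := by simp
  map_add' f g := by simp

lemma van_src_iff (X Y : C) {p a q : ℤ} (h : p + a = q) :
    Van (X⟦a⟧) Y q ↔ Van X Y p := (GVan.congr (homShiftSrc X Y h)).symm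
lemma one_src_iff (X Y : C) {p a q : ℤ} (h : p + a = q) :
    One (X⟦a⟧) Y q ↔ One X Y p := (GOne.congr (homShiftSrc X Y h)).symm

lemma van_congr {X X' Y Y' : C} (e : X ≅ X') (e' : Y ≅ Y') {p : ℤ} : Van X Y p ↔ Van X' Y' p :=
  GVan.congr (homCongr e e' p)
lemma one_congr {X X' Y Y' : C} (e : X ≅ X') (e' : Y ≅ Y') {p : ℤ} : One X Y p ↔ One X' Y' p :=
  GOne.congr (homCongr e e' p)

/-- Composition with `g : Y ⟶ Z` on `[W, -]^p`. -/
noncomputable def post (W : C) {Y Z : C} (g : Y ⟶ Z) (p : ℤ) : (W ⟶ Y⟦p⟧) →+ (W ⟶ Z⟦p⟧) where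
  toFun f := f ≫ g⟦p⟧'
  map_zero' := zero_comp
  map_add' _ _ := by simp

/-- Composition with `g : X ⟶ Y` on `[-, W]^p`. -/
noncomputable def pre {X Y : C} (g : X ⟶ Y) (W : C) (p : ℤ) : (Y ⟶ W⟦p⟧) →+ (X ⟶ W⟦p⟧) where
  toFun f := g ≫ f
  map_zero' := comp_zero
  map_add' _ _ := by simp

lemma post_apply (W : C) {Y Z : C} (g : Y ⟶ Z) (p : ℤ) (f : W ⟶ Y⟦p⟧) :
    post W g p f = f ≫ g⟦p⟧' := rfl

/-- Exactness of `[W, T₁]^p ⟶ [W, T₂]^p ⟶ [W, T₃]^p` for a distinguished triangle. The signs which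
the suspension puts on the maps of a triangle do not affect images and kernels. -/
lemma post_exact (T : Triangle C) (hT : T ∈ distTriang C) (W : C) (p : ℤ) (f : W ⟶ T.obj₂⟦p⟧)
    (hf : post W T.mor₂ p f = 0) : ∃ g, post W T.mor₁ p g = f := by
  obtain ⟨g, hg⟩ := Triangle.coyoneda_exact₂ _ (T.shift_distinguished hT p) f (by
    change f ≫ (p.negOnePow • T.mor₂⟦p⟧') = 0
    rw [Linear.comp_units_smul, ← post_apply, hf, smul_zero])
  let g' : W ⟶ T.obj₁⟦p⟧ := g
  refine ⟨p.negOnePow • g', ?_⟩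
  change (p.negOnePow • g') ≫ T.mor₁⟦p⟧' = f
  rw [hg, Linear.units_smul_comp]
  exact (Linear.comp_units_smul g' p.negOnePow (T.mor₁⟦p⟧')).symm

lemma pre_exact (T : Triangle C) (hT : T ∈ distTriang C) (W : C) (p : ℤ) (f : T.obj₂ ⟶ W⟦p⟧)
    (hf : pre T.mor₁ W p f = 0) : ∃ g, pre T.mor₂ W p g = f := by
  obtain ⟨g, hg⟩ := Triangle.yoneda_exact₂ _ hT f hf
  exact ⟨g, hg.symm⟩

section
variable {T : Triangle C} (hT : T ∈ distTriang C) {W : C} {p : ℤ}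
include hT

lemma post_inj₂ (h : Van W T.obj₁ p) (f : W ⟶ T.obj₂⟦p⟧) (hf : post W T.mor₂ p f = 0) :
    f = 0 := by
  obtain ⟨g, rfl⟩ := post_exact T hT W p f hf
  rw [h g, map_zero]

lemma post_surj₂ (h : Van W T.obj₁ (p + 1)) (f : W ⟶ T.obj₃⟦p⟧) : ∃ g, post W T.mor₂ p g = f :=
  post_exact T.rotate (rot_of_distTriang _ hT) W p f
    ((van_tgt_iff W T.obj₁ (add_comm p 1)).mpr h _)

lemma post_inj₁ (h : Van W T.obj₃ (p - 1)) (f : W ⟶ T.obj₁⟦p⟧) (hf : post W T.mor₁ p f = 0) :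
    f = 0 :=
  post_inj₂ (inv_rot_of_distTriang _ hT)
    ((van_tgt_iff W T.obj₃ (show p - 1 = -1 + p by ring)).mpr h) f hf

lemma post_surj₁ (h : Van W T.obj₃ p) (f : W ⟶ T.obj₂⟦p⟧) : ∃ g, post W T.mor₁ p g = f :=
  post_exact T hT W p f (h _)

lemma pre_inj₁ (h : Van T.obj₃ W p) (f : T.obj₂ ⟶ W⟦p⟧) (hf : pre T.mor₁ W p f = 0) : f = 0 := by
  obtain ⟨g, rfl⟩ := pre_exact T hT W p f hf
  rw [h g, map_zero]

lemma pre_surj₁ (h : Van T.obj₃ W (p + 1)) (f : T.obj₁ ⟶ W⟦p⟧) : ∃ g, pre T.mor₁ W p g = f :=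
  pre_exact T.invRotate (inv_rot_of_distTriang _ hT) W p f
    ((van_src_iff T.obj₃ W (show p + 1 + -1 = p by ring)).mpr h _)

lemma pre_inj₂ (h : Van T.obj₁ W (p - 1)) (f : T.obj₃ ⟶ W⟦p⟧) (hf : pre T.mor₂ W p f = 0) :
    f = 0 :=
  pre_inj₁ (rot_of_distTriang _ hT) ((van_src_iff T.obj₁ W (show p - 1 + 1 = p by ring)).mpr h)
    f hf

lemma pre_surj₂ (h : Van T.obj₁ W p) (f : T.obj₂ ⟶ W⟦p⟧) : ∃ g, pre T.mor₂ W p g = f :=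
  pre_exact T hT W p f (h _)

lemma van_post₂ (h₁ : Van W T.obj₁ p) (h₃ : Van W T.obj₃ p) : Van W T.obj₂ p :=
  GVan.of_injective _ (post_inj₂ hT h₁) h₃

lemma van_pre₂ (h₁ : Van T.obj₁ W p) (h₃ : Van T.obj₃ W p) : Van T.obj₂ W p :=
  GVan.of_injective _ (pre_inj₁ hT h₃) h₁

/-- `[W, T₁]^p ≃ [W, T₂]^p` when the neighbouring groups vanish. -/
noncomputable def postEquiv₁ (h : Van W T.obj₃ (p - 1)) (h' : Van W T.obj₃ p) :
    (W ⟶ T.obj₁⟦p⟧) ≃+ (W ⟶ T.obj₂⟦p⟧) :=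
  AddEquiv.ofBijective (post W T.mor₁ p)
    ⟨(injective_iff_map_eq_zero _).mpr (post_inj₁ hT h), post_surj₁ hT h'⟩

/-- `[W, T₂]^p ≃ [W, T₃]^p` when the neighbouring groups vanish. -/
noncomputable def postEquiv₂ (h : Van W T.obj₁ p) (h' : Van W T.obj₁ (p + 1)) :
    (W ⟶ T.obj₂⟦p⟧) ≃+ (W ⟶ T.obj₃⟦p⟧) :=
  AddEquiv.ofBijective (post W T.mor₂ p)
    ⟨(injective_iff_map_eq_zero _).mpr (post_inj₂ hT h), post_surj₂ hT h'⟩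

/-- `[T₃, W]^p ≃ [T₂, W]^p` when the neighbouring groups vanish. -/
noncomputable def preEquiv₂ (h : Van T.obj₁ W (p - 1)) (h' : Van T.obj₁ W p) :
    (T.obj₃ ⟶ W⟦p⟧) ≃+ (T.obj₂ ⟶ W⟦p⟧) :=
  AddEquiv.ofBijective (pre T.mor₂ W p)
    ⟨(injective_iff_map_eq_zero _).mpr (pre_inj₂ hT h), pre_surj₂ hT h'⟩

end

/-- If `T` is a distinguished triangle on `(α, α ≫ g) : c ⟶ X ⊞ R` and `T₀` one on
`α : c ⟶ X` then the cone of `T` is the sum of the cone of `T₀` and `R`. -/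
lemma cone_pivot [IsTriangulated C] {c X R Z Y : C} {α : c ⟶ X} {g : X ⟶ R}
    {β : X ⟶ Z} {γ : Z ⟶ c⟦(1 : ℤ)⟧} (h₀ : Triangle.mk α β γ ∈ distTriang C)
    {α' : c ⟶ X ⊞ R} (hα' : α' = biprod.lift α (α ≫ g))
    {β' : X ⊞ R ⟶ Y} {γ' : Y ⟶ c⟦(1 : ℤ)⟧} (h : Triangle.mk α' β' γ' ∈ distTriang C) :
    Nonempty (Y ≅ Z ⊞ R) := by
  let θ : X ⊞ R ≅ X ⊞ R :=
    { hom := biprod.desc (biprod.lift (𝟙 X) (-g)) biprod.inr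
      inv := biprod.desc (biprod.lift (𝟙 X) g) biprod.inr
      hom_inv_id := by ext <;> simp
      inv_hom_id := by ext <;> simp }
  have e : α' ≫ θ.hom = α ≫ biprod.inl := by
    subst hα'
    ext <;> simp [θ]
  have h' : Triangle.mk (α ≫ biprod.inl) (θ.inv ≫ β') γ' ∈ distTriang C := by
    refine isomorphic_distinguished _ h _ (Iso.symm ?_)
    exact Triangle.isoMk _ _ (Iso.refl _) θ (Iso.refl _)
      (by change α' ≫ θ.hom = 𝟙 _ ≫ α ≫ biprod.inl; rw [Category.id_comp, e])
      (by change β' ≫ 𝟙 _ = θ.hom ≫ θ.inv ≫ β'; rw [Iso.hom_inv_id_assoc, Category.comp_id])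
      (by change γ' ≫ (𝟙 c)⟦(1 : ℤ)⟧' = 𝟙 _ ≫ γ'
          rw [CategoryTheory.Functor.map_id, Category.comp_id, Category.id_comp])
  have oct := Triangulated.someOctahedron rfl h₀ (binaryBiproductTriangle_distinguished X R) h'
  obtain ⟨e', -⟩ := exists_iso_binaryBiproduct_of_distTriang _ oct.mem (zero_comp)
  exact ⟨e'⟩

end Triangulated

/-! ### Classes of cycles -/

namespace Word

/-- The word with a single cell, in degree `0`. -/
def pt (c : Cell) : Word := ⟨fun i => if i = 0 then c else .zero, by grind⟩

lemma pt_free : A 0 = pt .free := by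
  ext i
  simp only [A, pt]
  congr 1
  simp only [eq_iff_iff]
  omega

lemma pt_fixed : H 0 = pt .fixed := by
  ext i
  simp only [H, pt]
  split_ifs <;> first | rfl | omega

lemma pt_ne {c : Cell} {i : ℤ} (h : i ≠ 0) : (pt c).c i = .zero := if_neg h

lemma bdd_pt (c : Cell) : (pt c).Bdd := ⟨0, fun i hi => if_neg (by omega)⟩

lemma pt_hom_ext {c : Cell} {K : CochainComplex MackeyMod ℤ} {f g : (pt c).cx ⟶ K}
    (h : f.f 0 = g.f 0) : f = g := by
  ext1 i
  by_cases hi : i = 0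
  · subst hi; exact h
  · exact (Cell.hom_from_zero _ (pt_ne hi)).trans (Cell.hom_from_zero _ (pt_ne hi)).symm

lemma isZero_pt_X (c : Cell) {i : ℤ} (h : i ≠ 0) : IsZero ((pt c).cx.X i) := by
  change IsZero ((pt c).c i).obj
  rw [pt_ne h]; exact isZero_zero_obj

lemma pt_d (c : Cell) (i j : ℤ) : (pt c).cx.d i j = 0 := by
  by_cases hi : i = 0
  · by_cases hij : i + 1 = j
    · exact (isZero_pt_X c (by omega)).eq_of_tgt _ _
    · exact (pt c).cx.shape _ _ hij
  · exact (isZero_pt_X c hi).eq_of_src _ _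

lemma pt_cycle {c : Cell} {K : CochainComplex MackeyMod ℤ} (f : (pt c).cx ⟶ K) :
    f.f 0 ≫ K.d 0 1 = 0 := by
  rw [f.comm, pt_d, zero_comp]

/-- The chain map given by a cycle. -/
noncomputable def ptMap {c : Cell} {K : CochainComplex MackeyMod ℤ} (z : c.obj ⟶ K.X 0)
    (hz : z ≫ K.d 0 1 = 0) : (pt c).cx ⟶ K where
  f i := if h : i = 0 then by subst h; exact z else 0
  comm' i j hij := by
    obtain rfl : i + 1 = j := hij
    rw [pt_d, zero_comp]
    by_cases hi : i = 0
    · subst hi; exact hz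
    · rw [dif_neg hi, zero_comp]

instance (c : Cell) : (pt c).cx.IsKProjective := isKProjective (bdd_pt c)

/-- A map from a cell to a complex vanishes in the derived category if and only if its cycle is a
boundary. -/
lemma Q_pt_eq_zero_iff {c : Cell} {K : CochainComplex MackeyMod ℤ} (f : (pt c).cx ⟶ K) :
    Q.map f = 0 ↔ ∃ y : c.obj ⟶ K.X (-1), f.f 0 = y ≫ K.d (-1) 0 := by
  rw [Q_map_eq_zero_iff (isKProjective (bdd_pt c))]
  constructor
  · rintro ⟨h⟩
    refine ⟨h.hom 0 (-1), ?_⟩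
    have e := h.comm 0
    rw [dNext_eq _ (show (ComplexShape.up ℤ).Rel 0 1 from rfl),
      prevD_eq _ (show (ComplexShape.up ℤ).Rel (-1) 0 from rfl),
      pt_d, zero_comp, zero_add] at e
    exact e.trans (add_zero _)
  · rintro ⟨y, hy⟩
    let s : ∀ i j, (ComplexShape.up ℤ).Rel j i → ((pt c).cx.X i ⟶ K.X j) := fun i j hij =>
      if h : i = 0 then by
        obtain rfl : j = -1 := by
          have : j + 1 = i := hij
          omega
        subst h; exact y
      else 0
    have e : f = Homotopy.nullHomotopicMap' s := by
      apply pt_hom_ext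
      rw [Homotopy.nullHomotopicMap'_f (k₂ := (-1 : ℤ)) (k₁ := (0 : ℤ)) (k₀ := (1 : ℤ)) rfl rfl,
        pt_d, zero_comp, zero_add, hy]
      rfl
    rw [e]
    exact ⟨Homotopy.nullHomotopy' s⟩

/-- Elements of `𝒟(H, K)` and `𝒟(F, K)` are classes of cycles. -/
lemma exists_cycle {c : Cell} {K : CochainComplex MackeyMod ℤ}
    (a : Q.obj (pt c).cx ⟶ Q.obj K) :
    ∃ (z : c.obj ⟶ K.X 0) (hz : z ≫ K.d 0 1 = 0), Q.map (ptMap z hz) = a := by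
  obtain ⟨f, rfl⟩ := exists_rep a
  exact ⟨f.f 0, pt_cycle f, congrArg _ (pt_hom_ext rfl)⟩

lemma ptMap_eq_zero {c : Cell} {K : CochainComplex MackeyMod ℤ} {z : c.obj ⟶ K.X 0}
    {hz : z ≫ K.d 0 1 = 0} (h : z = 0) : Q.map (ptMap z hz) = 0 :=
  (Q_pt_eq_zero_iff _).mpr ⟨0, by rw [zero_comp]; exact h⟩

lemma ptMap_eq {c : Cell} {K : CochainComplex MackeyMod ℤ} {z z' : c.obj ⟶ K.X 0}
    {hz : z ≫ K.d 0 1 = 0} {hz' : z' ≫ K.d 0 1 = 0} (y : c.obj ⟶ K.X (-1))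
    (h : z - z' = y ≫ K.d (-1) 0) : Q.map (ptMap z hz) = Q.map (ptMap z' hz') := by
  rw [← sub_eq_zero, ← Functor.map_sub]
  exact (Q_pt_eq_zero_iff _).mpr ⟨y, h⟩

lemma d_zero_one (w : Word) : w.cx.d 0 1 = Cell.d (w.c 0) (w.c 1) := d_eq w 0
lemma d_neg_one_zero (w : Word) : w.cx.d (-1) 0 = Cell.d (w.c (-1)) (w.c 0) := d_eq w (-1)

end Word

/-! ### Maps from a cell to a word -/

namespace Cell

/-- For consecutive cells `x ⟶ y ⟶ z` of a complex: there is a nonzero class of cycles `H ⟶ y`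
modulo boundaries. -/
def HNonzero (x y z : Cell) : Prop := (y = fixed ∧ z ≠ free) ∨ (y = free ∧ x ≠ fixed)

/-- The analogue of `HNonzero` for `F` as the source. -/
def FNonzero (x y z : Cell) : Prop :=
  (y = fixed ∧ x ≠ free ∧ z ≠ free) ∨ (y = free ∧ (x = zero ∨ z = zero))

lemma eps_eps : (𝟙 F + tF) ≫ (𝟙 F + tF) = 0 := d_comp_d free free free (by simp)
lemma eps_pFH : (𝟙 F + tF) ≫ pFH = 0 := d_comp_d free free fixed (by simp)
lemma pHF_eps : pHF ≫ (𝟙 F + tF) = 0 := d_comp_d fixed free free (by simp)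
lemma tF_eps : tF ≫ (𝟙 F + tF) = 𝟙 F + tF := by
  rw [Preadditive.comp_add, tF_tF, Category.comp_id, add_comm]

lemma eps_comp_d (c : Cell) : (𝟙 F + tF) ≫ d free c = 0 := by
  cases c
  · exact comp_zero
  · exact eps_eps
  · exact eps_pFH

lemma d_free_ne_zero {c : Cell} (h : c ≠ zero) : d free c ≠ 0 := by
  cases c
  · exact absurd rfl h
  · exact one_add_tF_ne_zero
  · exact pFH_ne_zero

lemma tF_comp_d (c : Cell) : tF ≫ d free c = d free c := by
  cases c
  · exact comp_zero.trans rfl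
  · exact tF_eps
  · exact tF_pFH

/-- `1 + t : F ⟶ F` is a boundary as soon as the preceding cell is nonzero. -/
lemma eps_boundary {x : Cell} (h : x ≠ zero) : ∃ y : F ⟶ x.obj, 𝟙 F + tF = y ≫ d x free := by
  cases x
  · exact absurd rfl h
  · exact ⟨𝟙 F, (Category.id_comp _).symm⟩
  · exact ⟨pFH, pFH_pHF.symm⟩

/-- Boundaries in `Hom(F, F)` are multiples of `1 + t`. -/
lemma boundary_free (x : Cell) (y : F ⟶ x.obj) : y ≫ d x free = 0 ∨ y ≫ d x free = 𝟙 F + tF := by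
  cases x
  · exact Or.inl comp_zero
  · rcases hom_F_F y with rfl | rfl | rfl | rfl
    · exact Or.inl zero_comp
    · exact Or.inr (Category.id_comp _)
    · exact Or.inr tF_eps
    · exact Or.inl eps_eps
  · rcases hom_F_H y with rfl | rfl
    · exact Or.inl zero_comp
    · exact Or.inr pFH_pHF

lemma id_ne_eps : 𝟙 F ≠ 𝟙 F + tF := fun h => by
  have : tF = 0 := by simpa using h
  apply id_F_ne_zero
  rw [← tF_tF, this, zero_comp]

lemma d_fixed_comp {x : Cell} (hx : x ≠ free) : d x fixed = 0 := by
  cases x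
  · rfl
  · exact absurd rfl hx
  · rfl

lemma pHF_d (x : Cell) : pHF ≫ d free x = 0 := by
  cases x
  · exact comp_zero
  · exact pHF_eps
  · exact pHF_pFH

end Cell

section Classes

variable {w : Word}

open Word Cell

lemma van_H_of (h : ¬ HNonzero (w.c (-1)) (w.c 0) (w.c 1)) :
    GVan (Q.obj (pt .fixed).cx ⟶ Q.obj w.cx) := by
  intro a
  obtain ⟨z, hz, rfl⟩ := exists_cycle a
  rw [Q_pt_eq_zero_iff, d_neg_one_zero]
  rw [d_zero_one] at hz
  suffices aux : ∀ (x y u : Cell) (z : Cell.fixed.obj ⟶ y.obj), ¬ HNonzero x y u →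
      z ≫ Cell.d y u = 0 → ∃ y', z = y' ≫ Cell.d x y from aux _ _ _ _ h hz
  clear * -
  intro x y u z h hz
  cases y
  · exact ⟨0, isZero_zero_obj.eq_of_tgt _ _⟩
  · have hx : x = fixed := by
      by_contra hx; exact h (Or.inr ⟨rfl, hx⟩)
    subst hx
    rcases hom_H_F z with rfl | rfl
    · exact ⟨0, zero_comp.symm⟩
    · exact ⟨𝟙 H, (Category.id_comp _).symm⟩
  · have hu : u = free := by
      by_contra hu; exact h (Or.inl ⟨rfl, hu⟩)
    subst hu
    rcases hom_H_H z with rfl | rfl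
    · exact ⟨0, zero_comp.symm⟩
    · exact absurd ((Category.id_comp _).symm.trans hz) pHF_ne_zero

lemma le_H (w : Word) : GLe (Q.obj (pt .fixed).cx ⟶ Q.obj w.cx) := by
  intro a b ha hb
  obtain ⟨z, hz, rfl⟩ := exists_cycle a
  obtain ⟨z', hz', rfl⟩ := exists_cycle b
  have hz0 : z ≠ 0 := fun h => ha (ptMap_eq_zero h)
  have hz0' : z' ≠ 0 := fun h => hb (ptMap_eq_zero h)
  suffices aux : ∀ (y : Cell) (z z' : Cell.fixed.obj ⟶ y.obj), z ≠ 0 → z' ≠ 0 → z = z' by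
    obtain rfl := aux _ z z' hz0 hz0'
    rfl
  intro y z z' h h'
  cases y
  · exact isZero_zero_obj.eq_of_tgt _ _
  · rw [(hom_H_F z).resolve_left h, (hom_H_F z').resolve_left h']
  · rw [(hom_H_H z).resolve_left h, (hom_H_H z').resolve_left h']

lemma one_H_of (h : HNonzero (w.c (-1)) (w.c 0) (w.c 1)) :
    GOne (Q.obj (pt .fixed).cx ⟶ Q.obj w.cx) := by
  refine ⟨le_H w, ?_⟩
  suffices ∃ z : Cell.fixed.obj ⟶ (w.c 0).obj, z ≫ Cell.d (w.c 0) (w.c 1) = 0 ∧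
      ∀ y, z ≠ y ≫ Cell.d (w.c (-1)) (w.c 0) by
    obtain ⟨z, hz, hz'⟩ := this
    refine ⟨Q.map (ptMap z (by rw [d_zero_one]; exact hz)), fun e => ?_⟩
    rw [Q_pt_eq_zero_iff, d_neg_one_zero] at e
    obtain ⟨y, hy⟩ := e
    exact hz' y hy
  generalize w.c (-1) = x at *
  generalize w.c 0 = y at *
  generalize w.c 1 = u at *
  rcases h with ⟨rfl, hu⟩ | ⟨rfl, hx⟩
  · refine ⟨𝟙 H, ?_, fun y e => ?_⟩
    · cases u
      · exact comp_zero
      · exact absurd rfl hu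
      · exact comp_zero
    · cases x
      · exact id_H_ne_zero (e.trans comp_zero)
      · rcases hom_H_F y with rfl | rfl
        · exact id_H_ne_zero (e.trans zero_comp)
        · exact id_H_ne_zero (e.trans pHF_pFH)
      · exact id_H_ne_zero (e.trans comp_zero)
  · refine ⟨pHF, pHF_d u, fun y e => ?_⟩
    cases x
    · exact pHF_ne_zero (e.trans comp_zero)
    · rcases hom_H_F y with rfl | rfl
      · exact pHF_ne_zero (e.trans zero_comp)
      · exact pHF_ne_zero (e.trans pHF_eps)
    · exact hx rfl

lemma van_F_of (h : ¬ FNonzero (w.c (-1)) (w.c 0) (w.c 1)) :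
    GVan (Q.obj (pt .free).cx ⟶ Q.obj w.cx) := by
  intro a
  obtain ⟨z, hz, rfl⟩ := exists_cycle a
  rw [Q_pt_eq_zero_iff, d_neg_one_zero]
  rw [d_zero_one] at hz
  suffices aux : ∀ (x y u : Cell) (z : Cell.free.obj ⟶ y.obj), ¬ FNonzero x y u →
      z ≫ Cell.d y u = 0 → ∃ y', z = y' ≫ Cell.d x y from aux _ _ _ _ h hz
  clear * -
  intro x y u z h hz
  cases y
  · exact ⟨0, isZero_zero_obj.eq_of_tgt _ _⟩
  · have hx : x ≠ zero := fun hx => h (Or.inr ⟨rfl, Or.inl hx⟩)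
    have hu : u ≠ zero := fun hu => h (Or.inr ⟨rfl, Or.inr hu⟩)
    rcases hom_F_F z with rfl | rfl | rfl | rfl
    · exact ⟨0, zero_comp.symm⟩
    · exact absurd ((Category.id_comp _).symm.trans hz) (d_free_ne_zero hu)
    · exact absurd ((tF_comp_d u).symm.trans hz) (d_free_ne_zero hu)
    · exact eps_boundary hx
  · rcases hom_F_H z with rfl | rfl
    · exact ⟨0, zero_comp.symm⟩
    · by_cases hx : x = free
      · subst hx
        exact ⟨𝟙 F, (Category.id_comp _).symm⟩
      · have hu : u = free := by
          by_contra hu; exact h (Or.inl ⟨rfl, hx, hu⟩)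
        subst hu
        exact absurd (pFH_pHF.symm.trans hz) one_add_tF_ne_zero

/-- There is at most one nonzero class of maps from `F` to a word, except when the cell in degree `0`
is an isolated `F`, where `End(F)` has order four. -/
lemma le_F_of (h : w.c 0 = .free → w.c (-1) = .zero → w.c 1 ≠ .zero) :
    GLe (Q.obj (pt .free).cx ⟶ Q.obj w.cx) := by
  intro a b ha hb
  obtain ⟨z, hz, rfl⟩ := exists_cycle a
  obtain ⟨z', hz', rfl⟩ := exists_cycle b
  rw [Ne, Q_pt_eq_zero_iff, d_neg_one_zero] at ha hb
  suffices ∃ y, z - z' = y ≫ Cell.d (w.c (-1)) (w.c 0) by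
    obtain ⟨y, hy⟩ := this
    exact ptMap_eq y (by rw [d_neg_one_zero]; exact hy)
  rw [d_zero_one] at hz hz'
  suffices aux : ∀ (x y u : Cell) (z z' : Cell.free.obj ⟶ y.obj), (y = free → x = zero → u ≠ zero) →
      z ≫ Cell.d y u = 0 → z' ≫ Cell.d y u = 0 → (¬ ∃ y', z = y' ≫ Cell.d x y) →
      (¬ ∃ y', z' = y' ≫ Cell.d x y) → ∃ y', z - z' = y' ≫ Cell.d x y from
    aux _ _ _ z z' h hz hz' ha hb
  clear * -
  intro x y u z z' h hz hz' ha hb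
  cases y
  · exact ⟨0, isZero_zero_obj.eq_of_tgt _ _⟩
  · by_cases hx : x = zero
    · subst hx
      have hu := h rfl rfl
      have aux : ∀ z : F ⟶ F, z ≫ d free u = 0 → (¬ ∃ y : F ⟶ zero.obj, z = y ≫ d zero free) →
          z = 𝟙 F + tF := by
        intro z hz ha
        rcases hom_F_F z with rfl | rfl | rfl | rfl
        · exact absurd ⟨0, zero_comp.symm⟩ ha
        · exact absurd ((Category.id_comp _).symm.trans hz) (d_free_ne_zero hu)
        · exact absurd ((tF_comp_d u).symm.trans hz) (d_free_ne_zero hu)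
        · rfl
      refine ⟨0, ?_⟩
      rw [aux z hz ha, aux z' hz' hb]
      exact (sub_self (𝟙 F + tF)).trans zero_comp.symm
    · obtain ⟨y, hy⟩ := eps_boundary hx
      have aux : ∀ z : F ⟶ F, (¬ ∃ y : F ⟶ x.obj, z = y ≫ d x free) → z = 𝟙 F ∨ z = tF := by
        intro z ha
        rcases hom_F_F z with rfl | rfl | rfl | rfl
        · exact absurd ⟨0, zero_comp.symm⟩ ha
        · exact Or.inl rfl
        · exact Or.inr rfl
        · exact absurd ⟨y, hy⟩ ha
      rcases aux z ha with rfl | rfl <;> rcases aux z' hb with rfl | rfl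
      · exact ⟨0, (sub_self (𝟙 F)).trans zero_comp.symm⟩
      · exact ⟨y, (hom_sub_eq (𝟙 F) tF).trans hy⟩
      · exact ⟨y, ((hom_sub_eq tF (𝟙 F)).trans (add_comm _ _)).trans hy⟩
      · exact ⟨0, (sub_self tF).trans zero_comp.symm⟩
  · have aux : ∀ z : F ⟶ H, (¬ ∃ y : F ⟶ x.obj, z = y ≫ d x fixed) → z = pFH := by
      intro z ha
      exact (hom_F_H z).resolve_left fun e => ha ⟨0, e.trans zero_comp.symm⟩
    refine ⟨0, ?_⟩
    rw [aux z ha, aux z' hb]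
    exact (sub_self pFH).trans zero_comp.symm

lemma exists_F_of (h : FNonzero (w.c (-1)) (w.c 0) (w.c 1)) :
    ∃ a : Q.obj (pt .free).cx ⟶ Q.obj w.cx, a ≠ 0 := by
  suffices ∃ z : Cell.free.obj ⟶ (w.c 0).obj, z ≫ Cell.d (w.c 0) (w.c 1) = 0 ∧
      ∀ y, z ≠ y ≫ Cell.d (w.c (-1)) (w.c 0) by
    obtain ⟨z, hz, hz'⟩ := this
    refine ⟨Q.map (ptMap z (by rw [d_zero_one]; exact hz)), fun e => ?_⟩
    rw [Q_pt_eq_zero_iff, d_neg_one_zero] at e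
    obtain ⟨y, hy⟩ := e
    exact hz' y hy
  generalize w.c (-1) = x at *
  generalize w.c 0 = y at *
  generalize w.c 1 = u at *
  rcases h with ⟨rfl, hx, hu⟩ | ⟨rfl, rfl | rfl⟩
  · refine ⟨pFH, ?_, fun y e => ?_⟩
    · cases u
      · exact comp_zero
      · exact absurd rfl hu
      · exact comp_zero
    · rw [d_fixed_comp hx, comp_zero] at e
      exact pFH_ne_zero e
  · exact ⟨𝟙 F + tF, eps_comp_d u, fun y e => one_add_tF_ne_zero (e.trans comp_zero)⟩
  · refine ⟨𝟙 F, comp_zero, fun y e => ?_⟩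
    rcases boundary_free x y with h | h
    · exact id_F_ne_zero (e.trans h)
    · exact id_ne_eps (e.trans h)

end Classes

/-! ### Extensions of words -/

namespace Word

lemma sh_sh (w : Word) (a b : ℤ) : (w.sh a).sh b = w.sh (a + b) := by
  ext i
  simp only [sh_c]
  congr 1; ring

lemma sh_zero (w : Word) : w.sh 0 = w := by
  ext i
  simp

lemma sh_of_eq (w : Word) {a b c : ℤ} (h : a + b = c) : (w.sh a).sh b = w.sh c := by
  rw [sh_sh, h]

/-- `W` is made of a tail `T` (the cells in high degrees) and a head `Hd`: each cell of `W` belongs to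
exactly one of them, and no differential of `W` leads from `T` to `Hd`. -/
def Ext (T W Hd : Word) : Prop :=
  ∀ i, ((T.c i = W.c i ∧ Hd.c i = .zero) ∨ (T.c i = .zero ∧ Hd.c i = W.c i)) ∧
    (T.c i = .zero ∨ Hd.c (i + 1) = .zero)

namespace Ext

variable {T W Hd : Word} (h : Ext T W Hd)
include h

lemma sh (a : ℤ) : Ext (T.sh a) (W.sh a) (Hd.sh a) := fun i => by
  have := h (i + a)
  simpa only [sh_c, show i + 1 + a = i + a + 1 by ring] using this

lemma compat₁ : Compat T W := fun i => by
  obtain ⟨h₁, h₂⟩ := h i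
  obtain ⟨h₃, -⟩ := h (i + 1)
  generalize T.c i = t at *
  generalize W.c i = w at *
  generalize Hd.c i = x at *
  generalize T.c (i + 1) = t' at *
  generalize W.c (i + 1) = w' at *
  generalize Hd.c (i + 1) = x' at *
  rcases h₁ with ⟨rfl, rfl⟩ | ⟨rfl, rfl⟩ <;> rcases h₃ with ⟨rfl, rfl⟩ | ⟨rfl, rfl⟩ <;>
    rcases h₂ with h₂ | h₂ <;> (try cases h₂) <;> (try cases t) <;> (try cases t') <;> (try cases x) <;>
    (try cases x') <;> rfl

lemma compat₂ : Compat W Hd := fun i => by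
  obtain ⟨h₁, h₂⟩ := h i
  obtain ⟨h₃, -⟩ := h (i + 1)
  generalize T.c i = t at *
  generalize W.c i = w at *
  generalize Hd.c i = x at *
  generalize T.c (i + 1) = t' at *
  generalize W.c (i + 1) = w' at *
  generalize Hd.c (i + 1) = x' at *
  rcases h₁ with ⟨rfl, rfl⟩ | ⟨rfl, rfl⟩ <;> rcases h₃ with ⟨rfl, rfl⟩ | ⟨rfl, rfl⟩ <;>
    rcases h₂ with h₂ | h₂ <;> (try cases h₂) <;> (try cases t) <;> (try cases t') <;> (try cases x) <;>
    (try cases x') <;> rfl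

lemma thr_thr : Word.thr h.compat₁ ≫ Word.thr h.compat₂ = 0 := by
  ext1 i
  change Cell.thr (T.c i) (W.c i) ≫ Cell.thr (W.c i) (Hd.c i) = 0
  rcases (h i).1 with ⟨_, e⟩ | ⟨e, _⟩
  · exact (congrArg _ (Cell.hom_to_zero _ e)).trans comp_zero
  · exact (congrArg (· ≫ _) (Cell.hom_from_zero _ e)).trans zero_comp

/-- The sequence `tail ⟶ word ⟶ head` is degreewise split. -/
noncomputable def splitting (i : ℤ) :
    ((ShortComplex.mk _ _ h.thr_thr).map
      (HomologicalComplex.eval MackeyMod (ComplexShape.up ℤ) i)).Splitting where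
  r := Cell.thr (W.c i) (T.c i)
  s := Cell.thr (Hd.c i) (W.c i)
  f_r := by
    change Cell.thr (T.c i) (W.c i) ≫ Cell.thr (W.c i) (T.c i) = 𝟙 (T.c i).obj
    rcases (h i).1 with ⟨e, _⟩ | ⟨e, _⟩
    · rw [e, Cell.thr_self, Category.comp_id]
    · rw [e]; exact isZero_zero_obj.eq_of_src _ _
  s_g := by
    change Cell.thr (Hd.c i) (W.c i) ≫ Cell.thr (W.c i) (Hd.c i) = 𝟙 (Hd.c i).obj
    rcases (h i).1 with ⟨_, e⟩ | ⟨_, e⟩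
    · rw [e]; exact isZero_zero_obj.eq_of_src _ _
    · rw [e, Cell.thr_self, Category.comp_id]
  id := by
    change Cell.thr (W.c i) (T.c i) ≫ Cell.thr (T.c i) (W.c i) +
      Cell.thr (W.c i) (Hd.c i) ≫ Cell.thr (Hd.c i) (W.c i) = 𝟙 (W.c i).obj
    rcases (h i).1 with ⟨e, e'⟩ | ⟨e, e'⟩
    · rw [e, e', Cell.thr_self, Category.comp_id,
        Cell.hom_to_zero (Cell.thr (W.c i) .zero) rfl, zero_comp, add_zero]
    · rw [e, e', Cell.thr_self, Category.comp_id,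
        Cell.hom_to_zero (Cell.thr (W.c i) .zero) rfl, zero_comp, zero_add]

lemma shortExact : (ShortComplex.mk _ _ h.thr_thr).ShortExact :=
  HomologicalComplex.shortExact_of_degreewise_shortExact _ fun i => (h.splitting i).shortExact

/-- The triangle `tail ⟶ word ⟶ head`. -/
lemma exists_triangle : ∃ δ : Q.obj Hd.cx ⟶ (Q.obj T.cx)⟦(1 : ℤ)⟧,
    Triangle.mk (Q.map (Word.thr h.compat₁)) (Q.map (Word.thr h.compat₂)) δ ∈
      distTriang (DerivedCategory MackeyMod) :=
  ⟨_, triangleOfSES_distinguished h.shortExact⟩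

end Ext

/-! ### Extensions among the fundamental complexes -/

lemma ext_A (k l : ℕ) : Ext (A k) (A (k + l + 1)) ((A l).sh (k + 1)) := fun i => by
  simp only [A, sh]; push_cast; split_ifs <;> simp <;> omega

lemma ext_H_neg (k : ℕ) : Ext (A k) (H (-(k + 1))) ((H 0).sh (k + 1)) := fun i => by
  simp only [A, H, sh]; split_ifs <;> simp <;> omega

lemma ext_H (s : ℤ) (hs : 0 ≤ s) (a : ℕ) :
    Ext ((H s).sh (-(a + 1))) (H (s + (a + 1))) ((A a).sh (-a)) := fun i => by
  simp only [A, H, sh]; split_ifs <;> simp <;> omega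

lemma ext_B (r : ℕ) : Ext ((H (r + 1)).sh (-1)) (B r) (H 0) := fun i => by
  simp only [B, H, sh]; split_ifs <;> simp <;> omega

lemma compat_H (n n' : ℤ) (h : n ≤ n') (h' : 0 ≤ n ∨ n' ≤ 0) : Compat (H n) (H n') := fun i => by
  simp only [H]; split_ifs <;> first | rfl | omega

lemma compat_H_A (n : ℤ) (hn : 0 ≤ n) (k : ℕ) : Compat (H n) ((A k).sh (-k)) := fun i => by
  simp only [H, A, sh]; split_ifs <;> first | rfl | omega

lemma compat_A_A (k l : ℕ) (h : k ≤ l) : Compat ((A l).sh (-l)) ((A k).sh (-k)) := fun i => by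
  simp only [A, sh]; split_ifs <;> first | rfl | omega

lemma compat_A_H : Compat (A 1) (H (-1)) := fun i => by
  simp only [A, H]; push_cast; split_ifs <;> first | rfl | omega

end Word

/-! ### Attaching a cell to a direct sum -/

section Cone
universe v u
variable {C : Type u} [Category.{v} C] [Preadditive C] [HasZeroObject C] [HasShift C ℤ]
  [∀ n : ℤ, (shiftFunctor C n).Additive] [Pretriangulated C]

/-- Isomorphic maps have isomorphic cones. -/
lemma cone_unique {c X X' Z Z' : C} {α : c ⟶ X} {β : X ⟶ Z} {γ : Z ⟶ c⟦(1 : ℤ)⟧}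
    {α' : c ⟶ X'} {β' : X' ⟶ Z'} {γ' : Z' ⟶ c⟦(1 : ℤ)⟧}
    (h : Triangle.mk α β γ ∈ distTriang C) (h' : Triangle.mk α' β' γ' ∈ distTriang C)
    (e : X ≅ X') (he : α ≫ e.hom = α') : Nonempty (Z ≅ Z') :=
  ⟨Triangle.π₃.mapIso (isoTriangleOfIso₁₂ _ _ h h' (Iso.refl c) e
    (by change α ≫ e.hom = 𝟙 c ≫ α'; rw [Category.id_comp, he]))⟩

lemma cone_isZero {c X Z : C} {α : c ⟶ X} {β : X ⟶ Z} {γ : Z ⟶ c⟦(1 : ℤ)⟧}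
    (h : Triangle.mk α β γ ∈ distTriang C) (hα : IsIso α) : IsZero Z :=
  (Triangle.isZero₃_iff_isIso₁ _ h).mpr hα

/-- `β` is a multiple of `α`. -/
def Fac {c X Y : C} (α : c ⟶ X) (β : c ⟶ Y) : Prop := ∃ g, α ≫ g = β

lemma Fac.trans {c X Y Z : C} {α : c ⟶ X} {β : c ⟶ Y} {γ : c ⟶ Z} (h : Fac α β) (h' : Fac β γ) :
    Fac α γ := by
  obtain ⟨g, rfl⟩ := h
  obtain ⟨g', rfl⟩ := h'
  exact ⟨g ≫ g', (Category.assoc _ _ _).symm⟩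

lemma fac_of_isIso {c X Y : C} (α : c ⟶ X) [IsIso α] (β : c ⟶ Y) : Fac α β :=
  ⟨inv α ≫ β, by simp⟩

lemma fac_of_iso {c X Y : C} {α : c ⟶ X} {β : c ⟶ Y} (e : X ≅ Y) (h : α ≫ e.hom = β) :
    Fac α β ∧ Fac β α := ⟨⟨e.hom, h⟩, ⟨e.inv, by rw [← h]; simp⟩⟩

/-- Finite direct sums of objects with the property `P`. -/
inductive Sums (P : C → Prop) : C → Prop
  | zero {X : C} (h : IsZero X) : Sums P X
  | add {X S R : C} (hS : P S) (hR : Sums P R) (e : X ≅ S ⊞ R) : Sums P X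

lemma Sums.of_iso {P : C → Prop} {X Y : C} (h : Sums P X) (e : Y ≅ X) : Sums P Y := by
  cases h with
  | zero h => exact .zero (h.of_iso e)
  | add hS hR e' => exact .add hS hR (e ≪≫ e')

lemma Sums.mono {P P' : C → Prop} (hP : ∀ X, P X → P' X) {X : C} (h : Sums P X) : Sums P' X := by
  induction h with
  | zero h => exact .zero h
  | add hS _ e ih => exact .add (hP _ hS) ih e

lemma Sums.shift {P P' : C → Prop} (a : ℤ) (hP : ∀ X, P X → P' (X⟦a⟧)) {X : C} (h : Sums P X) :
    Sums P' (X⟦a⟧) := by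
  have := preservesBinaryBiproducts_of_preservesBiproducts (shiftFunctor C a)
  induction h with
  | zero h => exact .zero ((shiftFunctor C a).map_isZero h)
  | add hS _ e ih =>
    exact .add (hP _ hS) ih ((shiftFunctor C a).mapIso e ≪≫ (shiftFunctor C a).mapBiprod _ _)

variable {c : C} {P : C → Prop}

/-- If the nonzero maps from `c` to the objects with property `P` are totally ordered by
divisibility, then each nonzero map to a finite sum of such objects has a pivot: a component all
the others are multiples of. -/
lemma exists_pivot
    (htot : ∀ X Y, P X → P Y → ∀ (α : c ⟶ X) (β : c ⟶ Y), α ≠ 0 → β ≠ 0 → Fac α β ∨ Fac β α)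
    {X : C} (h : Sums P X) (α : c ⟶ X) (hα : α ≠ 0) :
    ∃ (S R : C) (e : X ≅ S ⊞ R) (α₀ : c ⟶ S) (g : S ⟶ R), P S ∧ Sums P R ∧ α₀ ≠ 0 ∧
      α ≫ e.hom = biprod.lift α₀ (α₀ ≫ g) := by
  induction h with
  | zero h => exact absurd (h.eq_of_tgt _ _) hα
  | @add X S R hS hR e ih =>
    set a := α ≫ e.hom ≫ biprod.fst with ha
    set b := α ≫ e.hom ≫ biprod.snd with hb
    have hab : α ≫ e.hom = biprod.lift a b := by ext <;> simp [ha, hb]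
    by_cases hb0 : b = 0
    · refine ⟨S, R, e, a, 0, hS, hR, fun h0 => hα ?_, by rw [hab, hb0, comp_zero]⟩
      rw [← cancel_mono e.hom, hab, h0, hb0, zero_comp]
      ext <;> simp
    · obtain ⟨S', R', e', α₀, g, hS', hR', h₀, hg⟩ := ih b hb0
      -- the flipped decomposition `X ≅ S' ⊞ (S ⊞ R')`
      have key : ∀ k : S' ⟶ S, α₀ ≫ k = a → ∃ (S R : C) (e : X ≅ S ⊞ R) (α₀ : c ⟶ S) (g : S ⟶ R),
          P S ∧ Sums P R ∧ α₀ ≠ 0 ∧ α ≫ e.hom = biprod.lift α₀ (α₀ ≫ g) := by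
        intro k hk
        let f : S ⊞ R ≅ S' ⊞ (S ⊞ R') := biprod.mapIso (Iso.refl S) e' ≪≫
          { hom := biprod.lift (biprod.snd ≫ biprod.fst)
              (biprod.lift biprod.fst (biprod.snd ≫ biprod.snd))
            inv := biprod.lift (biprod.snd ≫ biprod.fst)
              (biprod.lift biprod.fst (biprod.snd ≫ biprod.snd))
            hom_inv_id := by ext <;> simp
            inv_hom_id := by ext <;> simp }
        refine ⟨S', S ⊞ R', e ≪≫ f, α₀, biprod.lift k g, hS', .add hS hR' (Iso.refl _), h₀, ?_⟩
        have hg' := hg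
        rw [Iso.trans_hom, ← Category.assoc, hab]
        have h1 : b ≫ e'.hom ≫ biprod.fst = α₀ := by
          rw [← Category.assoc, hg, biprod.lift_fst]
        have h2 : b ≫ e'.hom ≫ biprod.snd = α₀ ≫ g := by
          rw [← Category.assoc, hg, biprod.lift_snd]
        ext <;> simp [f, h1, h2, hk]
      by_cases ha0 : a = 0
      · exact key 0 (by rw [comp_zero, ha0])
      · rcases htot _ _ hS hS' a α₀ ha0 h₀ with ⟨k, hk⟩ | ⟨k, hk⟩
        · refine ⟨S, R, e, a, k ≫ biprod.lift (𝟙 _) g ≫ e'.inv, hS, hR, ha0, ?_⟩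
          rw [hab]
          congr 1
          rw [← Category.assoc, hk, ← cancel_mono e'.hom, hg]
          ext <;> simp
        · exact key k hk

/-- The cone of a map from `c` to a finite sum of objects with the property `P` is again such a sum,
provided that the nonzero maps are totally ordered by divisibility and that the cones of nonzero
maps to a single object have the property `P` or vanish: only the pivot is affected. -/
lemma Sums.attach [IsTriangulated C]
    (htot : ∀ X Y, P X → P Y → ∀ (α : c ⟶ X) (β : c ⟶ Y), α ≠ 0 → β ≠ 0 → Fac α β ∨ Fac β α)
    (hcone : ∀ X, P X → ∀ (α : c ⟶ X), α ≠ 0 → ∀ Z (β : X ⟶ Z) (γ : Z ⟶ c⟦(1 : ℤ)⟧),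
      Triangle.mk α β γ ∈ distTriang C → IsZero Z ∨ P Z)
    (hc : P (c⟦(1 : ℤ)⟧)) {X : C} (h : Sums P X) (α : c ⟶ X) {Z : C} (β : X ⟶ Z)
    (γ : Z ⟶ c⟦(1 : ℤ)⟧) (hT : Triangle.mk α β γ ∈ distTriang C) : Sums P Z := by
  by_cases hα : α = 0
  · have h' := rot_of_distTriang _ hT
    obtain ⟨e, -⟩ := exists_iso_binaryBiproduct_of_distTriang _ h' (by
      change -α⟦(1 : ℤ)⟧' = 0
      rw [hα, Functor.map_zero, neg_zero])
    exact .add hc h (e ≪≫ biprod.braiding _ _)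
  · obtain ⟨S, R, e, α₀, g, hS, hR, h₀, hg⟩ := exists_pivot htot h α hα
    obtain ⟨Z₀, β₀, γ₀, hT₀⟩ := distinguished_cocone_triangle α₀
    have h' : Triangle.mk (α ≫ e.hom) (e.inv ≫ β) γ ∈ distTriang C :=
      isomorphic_distinguished _ hT _ (Iso.symm (Triangle.isoMk _ _ (Iso.refl _) e (Iso.refl _)
        (by change α ≫ e.hom = 𝟙 _ ≫ α ≫ e.hom; rw [Category.id_comp])
        (by change β ≫ 𝟙 _ = e.hom ≫ e.inv ≫ β; rw [Iso.hom_inv_id_assoc, Category.comp_id])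
        (by change γ ≫ (𝟙 c)⟦(1 : ℤ)⟧' = 𝟙 _ ≫ γ
            rw [CategoryTheory.Functor.map_id, Category.comp_id, Category.id_comp])))
    obtain ⟨e'⟩ := cone_pivot hT₀ hg h'
    rcases hcone S hS α₀ h₀ Z₀ β₀ γ₀ hT₀ with hZ | hZ
    · refine hR.of_iso (e' ≪≫ ?_)
      exact { hom := biprod.snd, inv := biprod.inr,
              hom_inv_id := by
                ext
                · exact hZ.eq_of_src _ _
                · exact hZ.eq_of_src _ _
                · simp
                · simp }
    · exact .add hZ hR e'

end Cone

/-! ### Strands and the basic classes in them -/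

/-- The word of a strand. -/
def Strand.word : Strand → Word
  | .A k => Word.A k
  | .H n => Word.H n
  | .B r => Word.B r

/-- The free module on a generator over `Θ`, in the derived category. -/
noncomputable abbrev Fq : DerivedCategory MackeyMod := Q.obj (Word.pt .free).cx

/-- The unit `H`, in the derived category. -/
noncomputable abbrev Hq : DerivedCategory MackeyMod := Q.obj (Word.pt .fixed).cx

namespace Word

/-- The words of strands which begin in degree `0` with a cell that receives a nonzero class from
`H`: `H(n)` for `n ≥ 0`, and `A_k` suspended so as to begin in degree `0`. -/
def IsR (T : Word) : Prop := (∃ n : ℕ, T = H n) ∨ ∃ k : ℕ, T = (A k).sh (-k)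

lemma IsR.zero_below {T : Word} (h : IsR T) {i : ℤ} (hi : i < 0) : T.c i = .zero := by
  rcases h with ⟨n, rfl⟩ | ⟨k, rfl⟩
  · simp only [H]; split_ifs <;> first | rfl | omega
  · simp only [A, sh]; split_ifs <;> first | rfl | omega

lemma IsR.compat {T : Word} (h : IsR T) : Compat (pt .fixed) T := by
  rw [← pt_fixed]
  rcases h with ⟨n, rfl⟩ | ⟨k, rfl⟩
  · exact compat_H _ _ (by omega) (by omega)
  · exact compat_H_A _ le_rfl _

lemma isR_pt_free : IsR (pt .free) := Or.inr ⟨0, by rw [← pt_free]; simp [sh_zero]⟩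

/-- The order on the words `IsR`: the basic maps between their cells form a chain map `T ⟶ T'` that
carries the basic class of `T` to that of `T'`. It is the total order
`H(0) < H(1) < ⋯ < A_2 < A_1 < A_0`. -/
def RLe (T T' : Word) : Prop := Compat T T' ∧ T.c 0 ≠ .zero ∧ (T.c 0 = .fixed ∨ T.c 0 = T'.c 0)

lemma rle_H_H {n n' : ℕ} (h : n ≤ n') : RLe (H n) (H n') := by
  refine ⟨compat_H _ _ (by omega) (by omega), ?_, ?_⟩ <;> simp only [H] <;> split_ifs <;>
    simp <;> omega

lemma rle_H_A (n k : ℕ) : RLe (H n) ((A k).sh (-k)) := by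
  refine ⟨compat_H_A _ (by omega) k, ?_, ?_⟩ <;> simp only [H, A, sh] <;> split_ifs <;>
    simp <;> omega

lemma rle_A_A {k l : ℕ} (h : k ≤ l) : RLe ((A l).sh (-l)) ((A k).sh (-k)) := by
  refine ⟨compat_A_A k l h, ?_, ?_⟩ <;> simp only [A, sh] <;> split_ifs <;>
    simp <;> omega

lemma IsR.total {T T' : Word} (h : IsR T) (h' : IsR T') : RLe T T' ∨ RLe T' T := by
  rcases h with ⟨n, rfl⟩ | ⟨k, rfl⟩ <;> rcases h' with ⟨n', rfl⟩ | ⟨k', rfl⟩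
  · exact (le_total n n').imp rle_H_H rle_H_H
  · exact Or.inl (rle_H_A _ _)
  · exact Or.inr (rle_H_A _ _)
  · exact (le_total k' k).imp rle_A_A rle_A_A

lemma IsR.rle_last {T : Word} (h : IsR T) : RLe T (pt .free) := by
  have : pt .free = (A 0).sh (-(0 : ℕ)) := by rw [← pt_free]; simp [sh_zero]
  rw [this]
  rcases h with ⟨n, rfl⟩ | ⟨k, rfl⟩
  · exact rle_H_A _ _
  · exact rle_A_A (Nat.zero_le k)

end Word

open Word

/-- The map of one-cell complexes given by a map of cells. -/
noncomputable def cellMap {c c' : Cell} (z : c.obj ⟶ c'.obj) : (pt c).cx ⟶ (pt c').cx :=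
  ptMap (K := (pt c').cx) (by exact z) (by rw [pt_d]; exact comp_zero)

lemma Q_cellMap_eq_zero_iff {c c' : Cell} (f : (pt c).cx ⟶ (pt c').cx) :
    Q.map f = 0 ↔ f.f 0 = 0 := by
  rw [Q_pt_eq_zero_iff]
  constructor
  · rintro ⟨y, hy⟩
    rw [pt_d, comp_zero] at hy
    exact hy
  · intro h
    exact ⟨0, h.trans zero_comp.symm⟩

/-- The basic class `H ⟶ T`. -/
noncomputable def κH {T : Word} (h : IsR T) : Hq ⟶ Q.obj T.cx := Q.map (thr h.compat)

/-- The basic class `F ⟶ H ⟶ T`. -/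
noncomputable def κF {T : Word} (h : IsR T) : Fq ⟶ Q.obj T.cx :=
  Q.map (cellMap (c := .free) (c' := .fixed) pFH) ≫ κH h

lemma κH_thr {T T' : Word} (h : IsR T) (h' : IsR T') (hle : RLe T T') :
    κH h ≫ Q.map (thr hle.1) = κH h' := by
  rw [κH, κH, ← Functor.map_comp]
  congr 1
  exact pt_hom_ext (Cell.thr_comp_thr _ _ _ hle.2.1 (hle.2.2.imp Eq.symm id))

lemma κF_thr {T T' : Word} (h : IsR T) (h' : IsR T') (hle : RLe T T') :
    κF h ≫ Q.map (thr hle.1) = κF h' := by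
  rw [κF, κF, Category.assoc, κH_thr h h' hle]

lemma κH_pt_free : κH isR_pt_free =
    Q.map (cellMap (c := .fixed) (c' := .free) pHF) := by
  rw [κH]
  congr 1
  exact pt_hom_ext rfl

lemma κF_pt_free : κF isR_pt_free =
    Q.map (cellMap (c := .free) (c' := .free) (𝟙 F + tF)) := by
  rw [κF, κH, ← Functor.map_comp]
  congr 1
  exact pt_hom_ext pFH_pHF

lemma κH_ne_zero {T : Word} (h : IsR T) : κH h ≠ 0 := fun e => by
  have := κH_thr h isR_pt_free h.rle_last
  rw [e, zero_comp, κH_pt_free] at this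
  exact pHF_ne_zero ((Q_cellMap_eq_zero_iff _).mp this.symm)

lemma κF_ne_zero {T : Word} (h : IsR T) : κF h ≠ 0 := fun e => by
  have := κF_thr h isR_pt_free h.rle_last
  rw [e, zero_comp, κF_pt_free] at this
  exact one_add_tF_ne_zero ((Q_cellMap_eq_zero_iff _).mp this.symm)

lemma fac_κH {T T' : Word} (h : IsR T) (h' : IsR T') : Fac (κH h) (κH h') ∨ Fac (κH h') (κH h) :=
  (h.total h').imp (fun hle => ⟨_, κH_thr h h' hle⟩) (fun hle => ⟨_, κH_thr h' h hle⟩)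

lemma fac_κF {T T' : Word} (h : IsR T) (h' : IsR T') : Fac (κF h) (κF h') ∨ Fac (κF h') (κF h) :=
  (h.total h').imp (fun hle => ⟨_, κF_thr h h' hle⟩) (fun hle => ⟨_, κF_thr h' h hle⟩)

/-- Maps `F ⟶ F` in the derived category are zero, invertible or the norm `1 + t`. -/
lemma F_F_cases (α : Fq ⟶ Fq) : α = 0 ∨ IsIso α ∨ α = κF isR_pt_free := by
  obtain ⟨f, rfl⟩ := exists_rep α
  rcases hom_F_F (f.f 0) with h | h | h | h
  · exact Or.inl ((Q_cellMap_eq_zero_iff _).mpr h)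
  · right; left
    have : f = 𝟙 _ := pt_hom_ext h
    rw [this]; infer_instance
  · right; left
    have e : f ≫ f = 𝟙 _ := pt_hom_ext (by
      change f.f 0 ≫ f.f 0 = 𝟙 F
      rw [h]; exact tF_tF)
    have e' : Q.map f ≫ Q.map f = 𝟙 _ := by
      rw [← Functor.map_comp, e, CategoryTheory.Functor.map_id]
    exact ⟨_, e', e'⟩
  · right; right
    rw [κF_pt_free]
    congr 1
    exact pt_hom_ext h

lemma Word.IsR.le_F {T : Word} (h : IsR T) (hT : T ≠ pt .free) : GLe (Fq ⟶ Q.obj T.cx) := by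
  refine le_F_of fun h₀ h₁ h₂ => hT ?_
  rcases h with ⟨n, rfl⟩ | ⟨k, rfl⟩
  · exfalso
    simp only [H] at h₀ h₂
    split_ifs at h₀ h₂
    all_goals omega
  · obtain rfl : k = 0 := by
      simp only [A, sh] at h₂
      split_ifs at h₂ <;> omega
    rw [← pt_free]; simp [sh_zero]

/-- Every nonzero map from `F` to a word `IsR` is `κF` unless it is an isomorphism. -/
lemma Word.IsR.eq_κF {T : Word} (h : IsR T) (α : Fq ⟶ Q.obj T.cx) (hα : α ≠ 0) (hα' : ¬ IsIso α) :
    α = κF h := by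
  by_cases hT : T = pt .free
  · subst hT
    exact ((F_F_cases α).resolve_left hα).resolve_left hα'
  · exact h.le_F hT _ _ hα (κF_ne_zero h)

lemma Word.IsR.eq_κH {T : Word} (h : IsR T) (α : Hq ⟶ Q.obj T.cx) (hα : α ≠ 0) : α = κH h :=
  le_H T _ _ hα (κH_ne_zero h)

/-! ### Cones of the basic classes -/

/-- A section of the projection onto a cell that consists of cycles forces the differential on that
cell to vanish. -/
lemma cell_section {x u c : Cell} (hx : x = c) (z : c.obj ⟶ x.obj)
    (h : z ≫ Cell.thr x c = 𝟙 _) (h' : z ≫ Cell.d x u = 0) : Cell.d x u = 0 := by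
  subst hx
  rw [Cell.thr_self, Category.comp_id] at h
  rwa [h, Category.id_comp] at h'

/-- The connecting map of a word with a single cell as its head does not vanish if the head is
connected to the tail. -/
lemma connecting_ne_zero {T W : Word} {c : Cell} (h : Ext T W (pt c)) (hW : W.c 0 = c)
    (hd : Cell.d (W.c 0) (W.c 1) ≠ 0) {δ : Q.obj (pt c).cx ⟶ (Q.obj T.cx)⟦(1 : ℤ)⟧}
    (hδ : Triangle.mk (Q.map (thr h.compat₁)) (Q.map (thr h.compat₂)) δ ∈
      distTriang (DerivedCategory MackeyMod)) : δ ≠ 0 := by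
  rintro rfl
  obtain ⟨s, hs⟩ := Triangle.coyoneda_exact₃ _ hδ (𝟙 _) comp_zero
  obtain ⟨z, hz, rfl⟩ := exists_cycle s
  have hs' : Q.map (ptMap z hz) ≫ Q.map (thr h.compat₂) = 𝟙 (Q.obj (pt c).cx) := hs.symm
  rw [← Functor.map_comp, ← CategoryTheory.Functor.map_id, ← sub_eq_zero, ← Functor.map_sub,
    Q_pt_eq_zero_iff] at hs'
  obtain ⟨y, hy⟩ := hs'
  rw [pt_d, comp_zero] at hy
  rw [d_zero_one] at hz
  exact hd (cell_section hW z (sub_eq_zero.mp hy) hz)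

/-- The cone of a basic class of `T` is the word obtained by putting a cell in front of `T`. The
hypothesis `hα` says that `α` is the only possible connecting map of that word. -/
lemma cone_word {T W : Word} {c : Cell} (h : Ext (T.sh (-1)) W (pt c)) (hW : W.c 0 = c)
    (hd : Cell.d (W.c 0) (W.c 1) ≠ 0) (α : Q.obj (pt c).cx ⟶ Q.obj T.cx)
    (hα : ∀ δ : Q.obj (pt c).cx ⟶ Q.obj T.cx, δ ≠ 0 → (IsIso δ → IsZero (Q.obj W.cx)) → δ = α)
    {Z : DerivedCategory MackeyMod} {β : Q.obj T.cx ⟶ Z} {γ : Z ⟶ (Q.obj (pt c).cx)⟦(1 : ℤ)⟧}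
    (hT : Triangle.mk α β γ ∈ distTriang (DerivedCategory MackeyMod)) :
    Nonempty (Z ≅ Q.obj (W.sh 1).cx) := by
  obtain ⟨δ, hδ⟩ := h.exists_triangle
  have e₀ : (T.sh (-1)).sh 1 = T := by rw [sh_sh]; exact sh_zero T
  let e : (Q.obj (T.sh (-1)).cx)⟦(1 : ℤ)⟧ ≅ Q.obj T.cx :=
    ((T.sh (-1)).QshIso 1).symm ≪≫ eqToIso (by rw [e₀])
  have hne := connecting_ne_zero h hW hd hδ
  have h' : δ ≫ e.hom = α := by
    refine hα _ (fun h0 => hne ?_) fun hi => ?_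
    · rw [← cancel_mono e.hom, h0, zero_comp]
    · have : IsIso δ := IsIso.of_isIso_comp_right δ e.hom
      exact (Triangle.isZero₂_iff_isIso₃ _ hδ).mpr this
  obtain ⟨e'⟩ := cone_unique (rot_of_distTriang _ (rot_of_distTriang _ hδ)) hT e h'
  exact ⟨e'.symm ≪≫ (W.QshIso 1).symm⟩

/-- Suspended fundamental complexes all of whose cells are in degrees at least `d`. -/
def StrandObj (d : ℤ) (X : DerivedCategory MackeyMod) : Prop :=
  ∃ (S : Strand) (m : ℤ), (∀ j, j < d → (S.word.sh m).c j = .zero) ∧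
    Nonempty (X ≅ Q.obj (S.word.sh m).cx)

/-- Suspended fundamental complexes all of whose cells are in degrees at least `d`, with no `F`
in degree `d`: the strands that exist while the cells `H` are attached in degree `d`, before the
cells `F`. -/
def StrandObjH (d : ℤ) (X : DerivedCategory MackeyMod) : Prop :=
  ∃ (S : Strand) (m : ℤ), ((∀ j, j < d → (S.word.sh m).c j = .zero) ∧
    (S.word.sh m).c d ≠ .free) ∧ Nonempty (X ≅ Q.obj (S.word.sh m).cx)

lemma Word.IsR.zero_below_of_ext {T W : Word} {c : Cell} (hR : IsR T)
    (h : Ext (T.sh (-1)) W (pt c)) {j : ℤ} (hj : j < 0) : W.c j = .zero := by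
  have h₁ : (T.sh (-1)).c j = .zero := hR.zero_below (by omega)
  have h₂ : (pt c).c j = .zero := pt_ne hj.ne
  rcases (h j).1 with ⟨e, _⟩ | ⟨_, e⟩
  · rw [← e, h₁]
  · rw [← e, h₂]

lemma pt_fixed_eq_sh (a : ℤ) : ((Word.H 0).sh a).sh (-a) = pt .fixed := by
  rw [sh_sh, add_neg_cancel, sh_zero, pt_fixed]

lemma pt_free_eq_sh (a : ℤ) : ((A 0).sh a).sh (-a) = pt .free := by
  rw [sh_sh, add_neg_cancel, sh_zero, pt_free]

/-- Attaching `H` in front of a word `IsR` kills `H(0)`, turns `H(r + 1)` into `B_r` and `A_k` into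
`H(-(k + 1))`. -/
lemma Word.IsR.cone_H {T : Word} (h : IsR T) {Z : DerivedCategory MackeyMod}
    {α : Hq ⟶ Q.obj T.cx} (hα : α ≠ 0) {β : Q.obj T.cx ⟶ Z} {γ : Z ⟶ Hq⟦(1 : ℤ)⟧}
    (hT : Triangle.mk α β γ ∈ distTriang (DerivedCategory MackeyMod)) :
    IsZero Z ∨ StrandObjH (-1) Z := by
  have key : ∀ (S : Strand) (m : ℤ), Ext (T.sh (-1)) (S.word.sh m) (pt .fixed) →
      (S.word.sh m).c 0 = .fixed → (S.word.sh m).c 1 = .free →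
      StrandObjH (-1) Z := by
    intro S m hext h₀ h₁
    obtain ⟨e⟩ := cone_word hext h₀ (by rw [h₀, h₁]; exact pHF_ne_zero) α
      (fun δ hδ _ => le_H T _ _ hδ hα) hT
    rw [sh_sh] at e
    refine ⟨S, m + 1, ⟨fun j hj => ?_, ?_⟩, ⟨e⟩⟩
    · rw [← sh_sh]; exact h.zero_below_of_ext hext (show j + 1 < 0 by omega)
    · rw [← sh_sh]
      change (S.word.sh m).c 0 ≠ .free
      rw [h₀]; simp
  have h0 := h
  rcases h with ⟨n, rfl⟩ | ⟨k, rfl⟩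
  · rcases n with _ | r
    · left
      have e : Word.H ((0 : ℕ) : ℤ) = pt .fixed := by rw [← pt_fixed]; rfl
      have : IsIso α := by
        generalize Word.H ((0 : ℕ) : ℤ) = w at *
        subst e
        have : α = 𝟙 _ := le_H _ _ _ hα (fun h => hα (by rw [← Category.id_comp α, h, zero_comp]))
        rw [this]; infer_instance
      exact cone_isZero hT this
    · right
      have := ext_B r
      rw [pt_fixed] at this
      refine key (.B r) 0 (by rw [sh_zero]; exact_mod_cast this) ?_ ?_
      · rw [sh_zero]; simp [Strand.word, B]
      · rw [sh_zero]; simp only [Strand.word, B]; split_ifs <;> first | rfl | omega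
  · right
    have := (ext_H_neg k).sh (-(k + 1))
    rw [pt_fixed_eq_sh] at this
    refine key (.H (-(k + 1))) (-(k + 1)) ?_ ?_ ?_
    · rw [sh_of_eq _ (show -(k : ℤ) + -1 = -(k + 1) by ring)]
      exact this
    · simp [Strand.word, Word.H]
    · simp only [Strand.word, Word.H, sh]; split_ifs <;> first | rfl | omega

/-- Attaching `F` in front of a word `IsR` turns `H(n)` into `H(n + 1)` and `A_k` into `A_{k+1}`. -/
lemma Word.IsR.cone_F {T : Word} (h : IsR T) {Z : DerivedCategory MackeyMod}
    {β : Q.obj T.cx ⟶ Z} {γ : Z ⟶ Fq⟦(1 : ℤ)⟧}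
    (hT : Triangle.mk (κF h) β γ ∈ distTriang (DerivedCategory MackeyMod)) :
    StrandObj (-1) Z := by
  have key : ∀ (S : Strand) (m : ℤ), Ext (T.sh (-1)) (S.word.sh m) (pt .free) →
      (S.word.sh m).c 0 = .free → (S.word.sh m).c 1 ≠ .zero →
      StrandObj (-1) Z := by
    intro S m hext h₀ h₁
    obtain ⟨e⟩ := cone_word hext h₀ (by rw [h₀]; exact Cell.d_free_ne_zero h₁) (κF h)
      (fun δ hδ hi => h.eq_κF δ hδ fun hiso => by
        obtain ⟨a, ha⟩ := exists_F_of (w := S.word.sh m)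
          (Or.inr ⟨h₀, Or.inl (h.zero_below_of_ext hext (by omega))⟩)
        exact ha ((hi hiso).eq_of_tgt _ _)) hT
    rw [sh_sh] at e
    refine ⟨S, m + 1, fun j hj => ?_, ⟨e⟩⟩
    rw [← sh_sh]; exact h.zero_below_of_ext hext (show j + 1 < 0 by omega)
  rcases h with ⟨n, rfl⟩ | ⟨k, rfl⟩
  · have := ext_H n (by omega) 0
    refine key (.H (n + 1)) 0 ?_ ?_ ?_
    · rw [sh_zero, ← pt_free]
      simpa [sh_zero, Strand.word] using this
    · rw [sh_zero]; simp only [Strand.word, Word.H]; split_ifs <;> first | rfl | omega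
    · rw [sh_zero]; simp only [Strand.word, Word.H]; split_ifs <;> simp <;> omega
  · have := (ext_A k 0).sh (-(k + 1))
    have e : ((A 0).sh ((k : ℤ) + 1)).sh (-(k + 1)) = pt .free := pt_free_eq_sh _
    rw [e] at this
    refine key (.A (k + 1)) (-(k + 1)) ?_ ?_ ?_
    · rw [sh_of_eq _ (show -(k : ℤ) + -1 = -(k + 1) by ring)]
      simpa [Strand.word] using this
    · simp only [Strand.word, A, sh]; push_cast; split_ifs <;> first | rfl | omega
    · simp only [Strand.word, A, sh]; push_cast; split_ifs <;> first | omega | simp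

/-! ### Attaching cells -/

/-- The only strands beginning in degree at least `-1`, without `F` in degree `-1`, which receive a
nonzero map from `H` are those `IsR`. -/
lemma isR_of_HNonzero {S : Strand} {m : ℤ} (h₁ : ∀ j, j < -1 → (S.word.sh m).c j = .zero)
    (h₂ : (S.word.sh m).c (-1) ≠ .free)
    (h : Cell.HNonzero ((S.word.sh m).c (-1)) ((S.word.sh m).c 0) ((S.word.sh m).c 1)) :
    IsR (S.word.sh m) := by
  cases S with
  | A k =>
    right
    have h₁' := h₁ (-k - m)
    refine ⟨k, ?_⟩
    obtain rfl : m = -k := by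
      simp only [Strand.word, A, sh, Cell.HNonzero] at h₁' h₂ h
      split_ifs at h₁' h₂ h <;> simp at h₁' h₂ h <;> omega
    rfl
  | H n =>
    have h₁' := h₁ (-m)
    have h₂' := h₁ (n - m)
    left
    obtain ⟨rfl, hn⟩ : m = 0 ∧ 0 ≤ n := by
      simp only [Strand.word, Word.H, sh, Cell.HNonzero] at h₁' h₂' h₂ h
      split_ifs at h₁' h₂' h₂ h <;> simp at h₁' h₂' h₂ h <;> omega
    exact ⟨n.toNat, by rw [sh_zero, Int.toNat_of_nonneg hn]; rfl⟩
  | B r =>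
    exfalso
    have h₁' := h₁ (-m)
    simp only [Strand.word, B, sh, Cell.HNonzero] at h₁' h₂ h
    split_ifs at h₁' h₂ h <;> simp at h₁' h₂ h <;> omega

/-- A strand beginning in degree at least `-1` which receives a nonzero map from `F` is one of those
`IsR`, or `A_1` or `H(-1)`, which begin in degree `-1` and end with an `F` in degree `0`. -/
lemma cases_of_FNonzero {S : Strand} {m : ℤ} (h₁ : ∀ j, j < -1 → (S.word.sh m).c j = .zero)
    (h : Cell.FNonzero ((S.word.sh m).c (-1)) ((S.word.sh m).c 0) ((S.word.sh m).c 1)) :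
    IsR (S.word.sh m) ∨ S.word.sh m = A 1 ∨ S.word.sh m = Word.H (-1) := by
  cases S with
  | A k =>
    have h₁' := h₁ (-k - m)
    obtain h' | ⟨h', h''⟩ : m = -k ∨ (m = 0 ∧ k = 1) := by
      simp only [Strand.word, A, sh, Cell.FNonzero] at h₁' h
      split_ifs at h₁' h <;> simp at h₁' h <;> omega
    · exact Or.inl (Or.inr ⟨k, by rw [h']; rfl⟩)
    · exact Or.inr (Or.inl (by rw [h', h'', sh_zero]; rfl))
  | H n =>
    have h₁' := h₁ (-m)
    have h₂' := h₁ (n - m)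
    obtain ⟨rfl, hn⟩ : m = 0 ∧ (0 ≤ n ∨ n = -1) := by
      simp only [Strand.word, Word.H, sh, Cell.FNonzero] at h₁' h₂' h
      split_ifs at h₁' h₂' h <;> simp at h₁' h₂' h <;> omega
    rcases hn with hn | rfl
    · exact Or.inl (Or.inl ⟨n.toNat, by rw [sh_zero, Int.toNat_of_nonneg hn]; rfl⟩)
    · exact Or.inr (Or.inr (sh_zero _))
  | B r =>
    exfalso
    have h₁' := h₁ (-m)
    simp only [Strand.word, B, sh, Cell.FNonzero] at h₁' h
    split_ifs at h₁' h <;> simp at h₁' h <;> omega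

lemma StrandObjH.exists_isR {X : DerivedCategory MackeyMod} (h : StrandObjH (-1) X)
    {α : Hq ⟶ X} (hα : α ≠ 0) : ∃ (T : Word) (hT : IsR T) (e : X ≅ Q.obj T.cx),
      α ≫ e.hom = κH hT := by
  obtain ⟨S, m, ⟨h₁, h₂⟩, ⟨e⟩⟩ := h
  have hne : α ≫ e.hom ≠ 0 := fun h0 => hα (by rw [← cancel_mono e.hom, h0, zero_comp])
  have hT : IsR (S.word.sh m) := isR_of_HNonzero h₁ h₂ (by
    by_contra hn
    exact hne (van_H_of hn _))
  exact ⟨_, hT, e, hT.eq_κH _ hne⟩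

/-- Nonzero maps from `H` to strands are totally ordered by divisibility. -/
lemma StrandObjH.total {X Y : DerivedCategory MackeyMod} (hX : StrandObjH (-1) X)
    (hY : StrandObjH (-1) Y) (α : Hq ⟶ X) (β : Hq ⟶ Y) (hα : α ≠ 0) (hβ : β ≠ 0) :
    Fac α β ∨ Fac β α := by
  obtain ⟨T, hT, e, h⟩ := hX.exists_isR hα
  obtain ⟨T', hT', e', h'⟩ := hY.exists_isR hβ
  exact (fac_κH hT hT').imp
    (fun hf => ((fac_of_iso e h).1.trans hf).trans (fac_of_iso e' h').2)
    (fun hf => ((fac_of_iso e' h').1.trans hf).trans (fac_of_iso e h).2)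

lemma strandObj_cell (c : Cell) (hc : c ≠ .zero) : StrandObj (-1) ((Q.obj (pt c).cx)⟦(1 : ℤ)⟧) := by
  cases c
  · exact absurd rfl hc
  · refine ⟨.A 0, 1, fun j hj => ?_, ⟨((pt .free).QshIso 1).symm ≪≫ eqToIso (by rw [← pt_free]; rfl)⟩⟩
    simp only [Strand.word, A, sh]; split_ifs <;> first | rfl | omega
  · refine ⟨.H 0, 1, fun j hj => ?_, ⟨((pt .fixed).QshIso 1).symm ≪≫ eqToIso (by rw [← pt_fixed]; rfl)⟩⟩
    simp only [Strand.word, Word.H, sh]; split_ifs <;> first | rfl | omega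

lemma strandObjH_cell : StrandObjH (-1) (Hq⟦(1 : ℤ)⟧) := by
  refine ⟨.H 0, 1, ⟨fun j hj => ?_, ?_⟩,
    ⟨((pt .fixed).QshIso 1).symm ≪≫ eqToIso (by rw [← pt_fixed]; rfl)⟩⟩
  · simp only [Strand.word, Word.H, sh]; split_ifs <;> first | rfl | omega
  · simp [Strand.word, Word.H]

/-- Attaching a cell `H` in the lowest degree. -/
lemma Sums.attach_H {X Z : DerivedCategory MackeyMod} (h : Sums (StrandObjH (-1)) X)
    (α : Hq ⟶ X) (β : X ⟶ Z) (γ : Z ⟶ Hq⟦(1 : ℤ)⟧)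
    (hT : Triangle.mk α β γ ∈ distTriang (DerivedCategory MackeyMod)) :
    Sums (StrandObjH (-1)) Z := by
  refine Sums.attach (fun X Y hX hY α β => StrandObjH.total hX hY α β) ?_ strandObjH_cell h α β γ hT
  intro X hX α hα Z β γ hT
  obtain ⟨T, hR, e, he⟩ := hX.exists_isR hα
  obtain ⟨Z', β', γ', hT'⟩ := distinguished_cocone_triangle (κH hR)
  obtain ⟨e'⟩ := cone_unique hT hT' e he
  rcases hR.cone_H (κH_ne_zero hR) hT' with h | ⟨S, m, h, ⟨e''⟩⟩
  · exact Or.inl (h.of_iso e')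
  · exact Or.inr ⟨S, m, h, ⟨e' ≪≫ e''⟩⟩

lemma compat_free_A : Compat (pt .free) (A 1) := fun i => by
  rw [← pt_free]
  simp only [A]; push_cast; split_ifs <;> first | rfl | omega

lemma compat_free_H : Compat (pt .free) (Word.H (-1)) := fun i => by
  rw [← pt_free]
  simp only [A, Word.H]; push_cast; split_ifs <;> first | rfl | omega

lemma compat_H_fixed : Compat (Word.H (-1)) (pt .fixed) := by
  rw [← pt_fixed]
  exact compat_H _ _ (by omega) (by omega)

/-- The normal forms of nonzero maps from `F` to strands beginning at most one degree lower. -/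
lemma StrandObj.cases {X : DerivedCategory MackeyMod} (h : StrandObj (-1) X)
    {α : Fq ⟶ X} (hα : α ≠ 0) :
    IsIso α ∨ (∃ e : X ≅ Q.obj (A 1).cx, α ≫ e.hom = Q.map (thr compat_free_A)) ∨
    (∃ e : X ≅ Q.obj (Word.H (-1)).cx, α ≫ e.hom = Q.map (thr compat_free_H)) ∨
    ∃ (T : Word) (hT : IsR T) (e : X ≅ Q.obj T.cx), α ≫ e.hom = κF hT := by
  by_cases hi : IsIso α
  · exact Or.inl hi
  right
  obtain ⟨S, m, h₁, ⟨e⟩⟩ := h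
  have hne : α ≫ e.hom ≠ 0 := fun h0 => hα (by rw [← cancel_mono e.hom, h0, zero_comp])
  have hni : ¬ IsIso (α ≫ e.hom) := fun h => hi (IsIso.of_isIso_comp_right α e.hom)
  have hc := cases_of_FNonzero h₁ (by
    by_contra hn
    exact hne (van_F_of hn _))
  generalize S.word.sh m = w at *
  rcases hc with hT | rfl | rfl
  · exact Or.inr (Or.inr ⟨w, hT, e, hT.eq_κF _ hne hni⟩)
  · refine Or.inl ⟨e, ?_⟩
    refine le_F_of (fun _ h₂ => ?_) _ _ hne fun h0 => ?_
    · simp [A] at h₂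
    · rw [Q_pt_eq_zero_iff] at h0
      obtain ⟨y, hy⟩ := h0
      rw [d_neg_one_zero] at hy
      rcases Cell.boundary_free .free y with h | h
      · exact id_F_ne_zero (hy.trans h)
      · exact Cell.id_ne_eps (hy.trans h)
  · refine Or.inr (Or.inl ⟨e, ?_⟩)
    refine le_F_of (fun _ h₂ => ?_) _ _ hne fun h0 => ?_
    · simp [Word.H] at h₂
    · rw [Q_pt_eq_zero_iff] at h0
      obtain ⟨y, hy⟩ := h0
      rw [d_neg_one_zero] at hy
      rcases Cell.boundary_free .fixed y with h | h
      · exact id_F_ne_zero (hy.trans h)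
      · exact Cell.id_ne_eps (hy.trans h)

lemma fac_A_H : Fac (Q.map (thr compat_free_A)) (Q.map (thr compat_free_H)) := by
  refine ⟨Q.map (thr compat_A_H), ?_⟩
  rw [← Functor.map_comp]
  congr 1
  exact pt_hom_ext (Category.id_comp _)

lemma fac_H_fixed : Fac (Q.map (thr compat_free_H))
    (Q.map (cellMap (c := .free) (c' := .fixed) pFH)) := by
  refine ⟨Q.map (thr compat_H_fixed), ?_⟩
  rw [← Functor.map_comp]
  congr 1
  exact pt_hom_ext (Category.id_comp _)

lemma fac_H_κF {T : Word} (h : IsR T) : Fac (Q.map (thr compat_free_H)) (κF h) :=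
  fac_H_fixed.trans ⟨_, rfl⟩

/-- Nonzero maps from `F` to strands are totally ordered by divisibility: isomorphisms come first,
then the maps to `A_1` and to `H(-1)`, then the maps `κF`. -/
lemma StrandObj.total {X Y : DerivedCategory MackeyMod} (hX : StrandObj (-1) X)
    (hY : StrandObj (-1) Y) (α : Fq ⟶ X) (β : Fq ⟶ Y) (hα : α ≠ 0) (hβ : β ≠ 0) :
    Fac α β ∨ Fac β α := by
  have tr {X Y X' Y' : DerivedCategory MackeyMod} {α : Fq ⟶ X} {β : Fq ⟶ Y} {α' : Fq ⟶ X'}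
      {β' : Fq ⟶ Y'} (e : X ≅ X') (h : α ≫ e.hom = α') (e' : Y ≅ Y') (h' : β ≫ e'.hom = β')
      (hf : Fac α' β') : Fac α β := ((fac_of_iso e h).1.trans hf).trans (fac_of_iso e' h').2
  rcases hX.cases hα with h | ⟨e, h⟩ | ⟨e, h⟩ | ⟨T, hT, e, h⟩
  · exact Or.inl (fac_of_isIso α β)
  all_goals rcases hY.cases hβ with h' | ⟨e', h'⟩ | ⟨e', h'⟩ | ⟨T', hT', e', h'⟩
  · exact Or.inr (fac_of_isIso β α)
  · exact Or.inl (tr e h e' h' ⟨𝟙 _, Category.comp_id _⟩)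
  · exact Or.inl (tr e h e' h' fac_A_H)
  · exact Or.inl (tr e h e' h' (fac_A_H.trans (fac_H_κF _)))
  · exact Or.inr (fac_of_isIso β α)
  · exact Or.inr (tr e' h' e h fac_A_H)
  · exact Or.inl (tr e h e' h' ⟨𝟙 _, Category.comp_id _⟩)
  · exact Or.inl (tr e h e' h' (fac_H_κF _))
  · exact Or.inr (fac_of_isIso β α)
  · exact Or.inr (tr e' h' e h (fac_A_H.trans (fac_H_κF _)))
  · exact Or.inr (tr e' h' e h (fac_H_κF _))
  · exact (fac_κF hT hT').imp (tr e h e' h') (tr e' h' e h)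

/-- The cone of the inclusion of a tail `F` is the head. -/
lemma cone_tail {W : Word} {S : Strand} {m : ℤ} (h : Ext (pt .free) W (S.word.sh m))
    (hS : ∀ j, j < -1 → (S.word.sh m).c j = .zero)
    {α : Fq ⟶ Q.obj W.cx} (hα : α = Q.map (thr h.compat₁)) {Z : DerivedCategory MackeyMod}
    {β : Q.obj W.cx ⟶ Z} {γ : Z ⟶ Fq⟦(1 : ℤ)⟧}
    (hT : Triangle.mk α β γ ∈ distTriang (DerivedCategory MackeyMod)) : StrandObj (-1) Z := by
  obtain ⟨δ, hδ⟩ := h.exists_triangle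
  obtain ⟨e⟩ := cone_unique hT hδ (Iso.refl _) (by rw [hα]; exact Category.comp_id _)
  exact ⟨S, m, hS, ⟨e⟩⟩

/-- Attaching a cell `F` in the lowest degree. -/
lemma Sums.attach_F {X Z : DerivedCategory MackeyMod} (h : Sums (StrandObj (-1)) X)
    (α : Fq ⟶ X) (β : X ⟶ Z) (γ : Z ⟶ Fq⟦(1 : ℤ)⟧)
    (hT : Triangle.mk α β γ ∈ distTriang (DerivedCategory MackeyMod)) :
    Sums (StrandObj (-1)) Z := by
  refine Sums.attach (fun X Y hX hY α β => StrandObj.total hX hY α β) ?_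
    (strandObj_cell .free (by simp)) h α β γ hT
  intro X hX α hα Z β γ hT
  have tr {X' : DerivedCategory MackeyMod} {α' : Fq ⟶ X'} (e : X ≅ X') (h : α ≫ e.hom = α')
      (hc : ∀ (Z' : DerivedCategory MackeyMod) (β' : X' ⟶ Z') (γ' : Z' ⟶ Fq⟦(1 : ℤ)⟧),
        Triangle.mk α' β' γ' ∈ distTriang (DerivedCategory MackeyMod) → StrandObj (-1) Z') :
      StrandObj (-1) Z := by
    obtain ⟨Z', β', γ', hT'⟩ := distinguished_cocone_triangle α'
    obtain ⟨e'⟩ := cone_unique hT hT' e h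
    obtain ⟨S, m, h, ⟨e''⟩⟩ := hc Z' β' γ' hT'
    exact ⟨S, m, h, ⟨e' ≪≫ e''⟩⟩
  rcases hX.cases hα with h | ⟨e, h⟩ | ⟨e, h⟩ | ⟨T, hR, e, h⟩
  · exact Or.inl (cone_isZero hT h)
  · right
    refine tr e h fun Z' β' γ' hT' => ?_
    have hE : Ext (pt .free) (A 1) (((Strand.A 0).word).sh 1) := by
      have := ext_A 0 0
      rw [pt_free] at this
      simpa [Strand.word, pt_free] using this
    exact cone_tail hE (fun j hj => by
      simp only [Strand.word, A, sh]; split_ifs <;> first | rfl | omega) rfl hT'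
  · right
    refine tr e h fun Z' β' γ' hT' => ?_
    have hE : Ext (pt .free) (Word.H (-1)) (((Strand.H 0).word).sh 1) := by
      have := ext_H_neg 0
      rw [pt_free] at this
      simpa [Strand.word, pt_free] using this
    exact cone_tail hE (fun j hj => by
      simp only [Strand.word, Word.H, sh]; split_ifs <;> first | rfl | omega) rfl hT'
  · right
    exact tr e h fun Z' β' γ' hT' => hR.cone_F hT'

/-! ### Complexes of finite sums of cells -/

/-- Finite direct sums of copies of `H`. -/
inductive HSum : MackeyMod → Prop
  | zero {M : MackeyMod} (h : IsZero M) : HSum M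
  | add {M R : MackeyMod} (hR : HSum R) (e : M ≅ H ⊞ R) : HSum M

/-- Finite direct sums of copies of `H` and `F`. -/
inductive FinFree : MackeyMod → Prop
  | base {M : MackeyMod} (h : HSum M) : FinFree M
  | add {M R : MackeyMod} (hR : FinFree R) (e : M ≅ F ⊞ R) : FinFree M

lemma HSum.of_iso {M N : MackeyMod} (h : HSum M) (e : N ≅ M) : HSum N := by
  cases h with
  | zero h => exact .zero (h.of_iso e)
  | add hR e' => exact .add hR (e ≪≫ e')

lemma FinFree.of_iso {M N : MackeyMod} (h : FinFree M) (e : N ≅ M) : FinFree N := by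
  cases h with
  | base h => exact .base (h.of_iso e)
  | add hR e' => exact .add hR (e ≪≫ e')

lemma FinFree.of_isZero {M : MackeyMod} (h : IsZero M) : FinFree M := .base (.zero h)

/-- Adding a zero object. -/
noncomputable def biprodZeroIso {C : Type*} [Category* C] [Preadditive C] [HasBinaryBiproducts C]
    (M N : C) (h : IsZero M) : M ⊞ N ≅ N where
  hom := biprod.snd
  inv := biprod.inr
  hom_inv_id := by
    ext
    · exact h.eq_of_src _ _
    · exact h.eq_of_src _ _
    · simp
    · simp

lemma HSum.biprod {M N : MackeyMod} (h : HSum M) (h' : HSum N) : HSum (M ⊞ N) := by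
  induction h with
  | zero h => exact h'.of_iso (biprodZeroIso _ _ h)
  | add _ e ih => exact .add ih (biprod.mapIso e (Iso.refl _) ≪≫ biprod.associator _ _ _)

lemma FinFree.biprod {M N : MackeyMod} (h : FinFree M) (h' : FinFree N) : FinFree (M ⊞ N) := by
  induction h with
  | base h =>
    induction h' with
    | base h' => exact .base (h.biprod h')
    | add _ e ih =>
      exact .add ih (biprod.braiding _ _ ≪≫ biprod.mapIso e (Iso.refl _) ≪≫
        biprod.associator _ _ _ ≪≫ biprod.mapIso (Iso.refl _) (biprod.braiding _ _))
  | add _ e ih => exact .add ih (biprod.mapIso e (Iso.refl _) ≪≫ biprod.associator _ _ _)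

lemma finFree_F : FinFree F :=
  .add (.of_isZero isZero_zero_obj) ((biprodZeroIso _ _ isZero_zero_obj).symm ≪≫ biprod.braiding _ _)

lemma finFree_H : FinFree H :=
  .base (.add (.zero isZero_zero_obj)
    ((biprodZeroIso _ _ isZero_zero_obj).symm ≪≫ biprod.braiding _ _))

/-- A biproduct over `Option ι` splits off the term of `none`. -/
noncomputable def biproductOptionIso {C : Type*} [Category* C] [Preadditive C]
    [HasFiniteBiproducts C] [HasBinaryBiproducts C] {ι : Type} [Finite ι] (f : Option ι → C) :
    ⨁ f ≅ f none ⊞ ⨁ fun i => f (some i) where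
  hom := biprod.lift (biproduct.π f none) (biproduct.lift fun i => biproduct.π f (some i))
  inv := biprod.desc (biproduct.ι f none) (biproduct.desc fun i => biproduct.ι f (some i))
  hom_inv_id := by
    classical
    refine biproduct.hom_ext' _ _ fun i => biproduct.hom_ext _ _ fun j => ?_
    have := Fintype.ofFinite ι
    have key : biprod.lift (biproduct.π f none) (biproduct.lift fun i => biproduct.π f (some i)) ≫
        biprod.desc (biproduct.ι f none) (biproduct.desc fun i => biproduct.ι f (some i)) =
        ∑ i, biproduct.π f i ≫ biproduct.ι f i := by
      rw [Fintype.sum_option, biprod.lift_desc, biproduct.lift_desc]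
    rw [key, biproduct.total]
  inv_hom_id := by
    classical
    ext i j
    · simp
    · simp
    · simp
    · simp [biproduct.ι_π]

lemma finFree_biproduct (n : ℕ) (f : Fin n → MackeyMod) (hf : ∀ i, FinFree (f i)) :
    FinFree (⨁ f) := by
  induction n with
  | zero =>
    refine .of_isZero ?_
    rw [IsZero.iff_id_eq_zero]
    exact biproduct.hom_ext _ _ fun i => i.elim0
  | succ n ih =>
    have e := biproduct.whiskerEquiv (f := f) (g := fun i => f ((finSuccEquiv n).symm i))
      (finSuccEquiv n) (fun j => eqToIso (by simp))
    exact ((hf _).biprod (ih _ fun i => hf _)).of_iso (e ≪≫ biproductOptionIso _)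

section Peel

variable (K : CochainComplex MackeyMod ℤ) (d : ℤ) (c : Cell)

/-- The projection of a complex onto a summand of its lowest term. -/
noncomputable def toCell (hK : ∀ i, i < d → IsZero (K.X i)) (π : K.X d ⟶ c.obj) :
    K ⟶ ((pt c).sh (-d)).cx where
  f i := if h : i = d then eqToHom (by rw [h]) ≫ π ≫ eqToHom (by
    change c.obj = Cell.obj (if i + -d = 0 then c else .zero)
    rw [if_pos (by omega)]) else 0
  comm' i j hij := by
    obtain rfl : i + 1 = j := hij
    by_cases h : i + 1 = d
    · exact (hK i (by omega)).eq_of_src _ _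
    · refine IsZero.eq_of_tgt ?_ _ _
      change IsZero (Cell.obj (if i + 1 + -d = 0 then c else .zero))
      rw [if_neg (by omega)]
      exact isZero_zero_obj

lemma isZero_cell_X {i : ℤ} (h : i ≠ d) : IsZero (((pt c).sh (-d)).cx.X i) := by
  change IsZero (Cell.obj (if i + -d = 0 then c else .zero))
  rw [if_neg (by omega)]
  exact isZero_zero_obj

/-- A summand of the lowest term of a complex splits off as a quotient cell; the kernel of the
projection has all its other terms unchanged. -/
lemma exists_peel (hK : ∀ i, i < d → IsZero (K.X i)) {R : MackeyMod} (e : K.X d ≅ c.obj ⊞ R) :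
    ∃ (K' : CochainComplex MackeyMod ℤ) (f : Q.obj K' ⟶ Q.obj K)
      (g : Q.obj K ⟶ (Q.obj (pt c).cx)⟦-d⟧) (δ : (Q.obj (pt c).cx)⟦-d⟧ ⟶ (Q.obj K')⟦(1 : ℤ)⟧),
      Triangle.mk f g δ ∈ distTriang (DerivedCategory MackeyMod) ∧ Nonempty (K'.X d ≅ R) ∧
        ∀ i, i ≠ d → Nonempty (K'.X i ≅ K.X i) := by
  let φ := toCell K d c hK (e.hom ≫ biprod.fst)
  have hφ : φ.f d = (e.hom ≫ biprod.fst) ≫ eqToHom (by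
      change c.obj = Cell.obj (if d + -d = 0 then c else .zero)
      rw [if_pos (by omega)]) := by
    change (if h : d = d then _ else _) = _
    rw [dif_pos rfl, eqToHom_refl, Category.id_comp]
  have hepi : Epi φ := by
    refine HomologicalComplex.epi_of_epi_f _ fun i => ?_
    by_cases hi : i = d
    · subst hi; rw [hφ]; infer_instance
    · exact ⟨fun _ _ _ => (isZero_cell_X d c hi).eq_of_src _ _⟩
  let S : ShortComplex (CochainComplex MackeyMod ℤ) :=
    ShortComplex.mk (kernel.ι φ) φ (kernel.condition φ)
  have hS : S.ShortExact :=
    { exact := S.exact_of_f_is_kernel (kernelIsKernel φ)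
      mono_f := inferInstanceAs (Mono (kernel.ι φ))
      epi_g := hepi }
  have hT := triangleOfSES_distinguished hS
  let e' := (pt c).QshIso (-d)
  have hX (i : ℤ) : (kernel φ).X i ≅ kernel (φ.f i) :=
    PreservesKernel.iso (HomologicalComplex.eval MackeyMod (ComplexShape.up ℤ) i) φ
  refine ⟨kernel φ, Q.map (kernel.ι φ), Q.map φ ≫ e'.hom, e'.inv ≫ triangleOfSESδ hS, ?_,
    ⟨?_⟩, fun i hi => ⟨?_⟩⟩
  · refine isomorphic_distinguished _ hT _ (Triangle.isoMk _ _ (Iso.refl _) (Iso.refl _) e'.symm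
      ?_ ?_ ?_)
    · exact (Category.comp_id _).trans (Category.id_comp _).symm
    · change (Q.map φ ≫ e'.hom) ≫ e'.inv = 𝟙 _ ≫ Q.map φ
      rw [Category.assoc, Iso.hom_inv_id, Category.comp_id, Category.id_comp]
    · change (e'.inv ≫ triangleOfSESδ hS) ≫ (𝟙 _)⟦(1 : ℤ)⟧' = e'.inv ≫ triangleOfSESδ hS
      rw [CategoryTheory.Functor.map_id, Category.comp_id]
  · exact hX d ≪≫ kernelIsoOfEq hφ ≪≫ kernelCompMono _ _ ≪≫ kernelIsIsoComp _ _ ≪≫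
      kernelBiprodFstIso
  · exact hX i ≪≫ kernelIsoOfEq ((isZero_cell_X d c hi).eq_of_tgt (φ.f i) 0) ≪≫ kernelZeroIsoSource

end Peel

/-- Induction over the cells of a bounded complex of finite sums of cells: from the top degree
downwards, and in each degree first over the cells `H`, then over the cells `F`. `Φ d` is to hold for the complexes
with cells in degrees at least `d`, and `ΦH d` for those among them without `F` in degree `d`. -/
theorem cell_induction {Φ ΦH : ℤ → DerivedCategory MackeyMod → Prop}
    (h₀ : ∀ d X, IsZero X → Φ d X) (h₁ : ∀ d X, Φ (d + 1) X → ΦH d X)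
    (h₂ : ∀ d X, ΦH d X → Φ d X)
    (hH : ∀ d X Y (f : X ⟶ Y) (g : Y ⟶ Hq⟦-d⟧) (δ : Hq⟦-d⟧ ⟶ X⟦(1 : ℤ)⟧),
      Triangle.mk f g δ ∈ distTriang (DerivedCategory MackeyMod) → ΦH d X → ΦH d Y)
    (hF : ∀ d X Y (f : X ⟶ Y) (g : Y ⟶ Fq⟦-d⟧) (δ : Fq⟦-d⟧ ⟶ X⟦(1 : ℤ)⟧),
      Triangle.mk f g δ ∈ distTriang (DerivedCategory MackeyMod) → Φ d X → Φ d Y)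
    (K : CochainComplex MackeyMod ℤ) {a b : ℤ} (hK : ∀ i, i < a ∨ b < i → IsZero (K.X i))
    (hK' : ∀ i, FinFree (K.X i)) : Φ a (Q.obj K) := by
  obtain ⟨n, hn⟩ : ∃ n : ℕ, b < a + n := ⟨(b + 1 - a).toNat, by omega⟩
  induction n generalizing a K with
  | zero =>
    refine h₀ _ _ (Functor.map_isZero Q ?_)
    rw [IsZero.iff_id_eq_zero]
    ext1 i
    exact (hK i (by omega)).eq_of_src _ _
  | succ n ih =>
    have zH : ∀ M : MackeyMod, HSum M → ∀ K : CochainComplex MackeyMod ℤ, Nonempty (K.X a ≅ M) →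
        (∀ i, i < a ∨ b < i → IsZero (K.X i)) → (∀ i, i ≠ a → FinFree (K.X i)) →
        ΦH a (Q.obj K) := by
      intro M hM
      induction hM with
      | zero hM =>
        rintro K ⟨e⟩ hK hK'
        have hKa := hM.of_iso e
        refine h₁ _ _ (ih K (fun i hi => ?_) (fun i => ?_) (by push_cast at hn; omega))
        · by_cases hia : i = a
          · rw [hia]; exact hKa
          · exact hK i (by omega)
        · by_cases hia : i = a
          · rw [hia]; exact .of_isZero hKa
          · exact hK' i hia
      | add hR e ihR =>
        rintro K ⟨e₀⟩ hK hK'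
        obtain ⟨K', f, g, δ, hT, he, hne⟩ := exists_peel K a .fixed (fun i hi => hK i (Or.inl hi))
          (e₀ ≪≫ e)
        refine hH a _ _ f g δ hT (ihR K' he (fun i hi => ?_) fun i hi => ?_)
        · by_cases hia : i = a
          · -- only possible if `a` exceeds `b`, where the complex vanishes
            subst hia
            have hz := hK i hi
            have e₁ := e₀ ≪≫ e
            have : IsZero (H ⊞ _) := hz.of_iso e₁.symm
            exact absurd ((IsZero.iff_id_eq_zero _).mp this) (fun h0 => id_H_ne_zero (by
              have := congr(biprod.inl ≫ $h0 ≫ biprod.fst)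
              simpa using this))
          · obtain ⟨e₁⟩ := hne i hia
            exact (hK i hi).of_iso e₁
        · obtain ⟨e₁⟩ := hne i hi
          exact (hK' i hi).of_iso e₁
    have zF : ∀ M : MackeyMod, FinFree M → ∀ K : CochainComplex MackeyMod ℤ, Nonempty (K.X a ≅ M) →
        (∀ i, i < a ∨ b < i → IsZero (K.X i)) → (∀ i, i ≠ a → FinFree (K.X i)) →
        Φ a (Q.obj K) := by
      intro M hM
      induction hM with
      | base hM => exact fun K e hK hK' => h₂ _ _ (zH _ hM K e hK hK')
      | add hR e ihR =>
        rintro K ⟨e₀⟩ hK hK'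
        obtain ⟨K', f, g, δ, hT, he, hne⟩ := exists_peel K a .free (fun i hi => hK i (Or.inl hi))
          (e₀ ≪≫ e)
        refine hF a _ _ f g δ hT (ihR K' he (fun i hi => ?_) fun i hi => ?_)
        · by_cases hia : i = a
          · subst hia
            have hz := hK i hi
            have e₁ := e₀ ≪≫ e
            have : IsZero (F ⊞ _) := hz.of_iso e₁.symm
            exact absurd ((IsZero.iff_id_eq_zero _).mp this) (fun h0 => id_F_ne_zero (by
              have := congr(biprod.inl ≫ $h0 ≫ biprod.fst)
              simpa using this))
          · obtain ⟨e₁⟩ := hne i hia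
            exact (hK i hi).of_iso e₁
        · obtain ⟨e₁⟩ := hne i hi
          exact (hK' i hi).of_iso e₁
    exact zF _ (hK' a) K ⟨Iso.refl _⟩ hK fun i _ => hK' i

/-! ### Perfect complexes are sums of strands -/

section
universe v u
variable {C : Type u} [Category.{v} C] [Preadditive C] [HasZeroObject C] [HasShift C ℤ]
  [∀ n : ℤ, (shiftFunctor C n).Additive] [Pretriangulated C]

/-- A triangle which attaches a cell `c[-d]` to `X`, suspended so that the attaching map has source
`c`. -/
lemma exists_attaching {c X Y : C} {d : ℤ} {f : X ⟶ Y} {g : Y ⟶ c⟦-d⟧} {δ : c⟦-d⟧ ⟶ X⟦(1 : ℤ)⟧}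
    (h : Triangle.mk f g δ ∈ distTriang C) :
    ∃ (α : c ⟶ X⟦d⟧⟦(1 : ℤ)⟧) (β : X⟦d⟧⟦(1 : ℤ)⟧ ⟶ Y⟦d⟧⟦(1 : ℤ)⟧)
      (γ : Y⟦d⟧⟦(1 : ℤ)⟧ ⟶ c⟦(1 : ℤ)⟧), Triangle.mk α β γ ∈ distTriang C := by
  have h' := rot_of_distTriang _ (rot_of_distTriang _ (Triangle.shift_distinguished _ h d))
  let e : c⟦-d⟧⟦d⟧ ≅ c := (shiftFunctorCompIsoId C (-d) d (by simp)).app c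
  let T := ((Triangle.shiftFunctor C d).obj (Triangle.mk f g δ)).rotate.rotate
  refine ⟨e.inv ≫ T.mor₁, T.mor₂, T.mor₃ ≫ e.hom⟦(1 : ℤ)⟧', isomorphic_distinguished _ h' _
    (Triangle.isoMk _ _ e.symm (Iso.refl _) (Iso.refl _) ?_ ?_ ?_)⟩
  · exact Category.comp_id _
  · exact (Category.comp_id _).trans (Category.id_comp _).symm
  · change (T.mor₃ ≫ e.hom⟦(1 : ℤ)⟧') ≫ e.inv⟦(1 : ℤ)⟧' = 𝟙 _ ≫ T.mor₃
    have he : e.hom⟦(1 : ℤ)⟧' ≫ e.inv⟦(1 : ℤ)⟧' = 𝟙 _ := by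
      rw [← Functor.map_comp, Iso.hom_inv_id, CategoryTheory.Functor.map_id]
    exact (Category.assoc _ _ _).trans
      ((congrArg (T.mor₃ ≫ ·) he).trans ((Category.comp_id _).trans (Category.id_comp _).symm))

end

lemma StrandObj.shift {d : ℤ} {X : DerivedCategory MackeyMod} (h : StrandObj d X) (a : ℤ) :
    StrandObj (d - a) (X⟦a⟧) := by
  obtain ⟨S, m, h, ⟨e⟩⟩ := h
  refine ⟨S, m + a, fun j hj => ?_, ⟨(shiftFunctor _ a).mapIso e ≪≫ (QshIso _ a).symm ≪≫
    eqToIso (by rw [sh_sh])⟩⟩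
  rw [← sh_sh]
  exact h _ (by omega)

lemma StrandObjH.shift {d : ℤ} {X : DerivedCategory MackeyMod} (h : StrandObjH d X) (a : ℤ) :
    StrandObjH (d - a) (X⟦a⟧) := by
  obtain ⟨S, m, ⟨h, h'⟩, ⟨e⟩⟩ := h
  refine ⟨S, m + a, ⟨fun j hj => ?_, ?_⟩, ⟨(shiftFunctor _ a).mapIso e ≪≫ (QshIso _ a).symm ≪≫
    eqToIso (by rw [sh_sh])⟩⟩
  · rw [← sh_sh]
    exact h _ (by omega)
  · rw [← sh_sh]
    change (S.word.sh m).c (d - a + a) ≠ _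
    rwa [sub_add_cancel]

/-- Undoing two suspensions. -/
noncomputable def unshiftIso (X : DerivedCategory MackeyMod) (d : ℤ) :
    X ≅ X⟦d⟧⟦(1 : ℤ)⟧⟦(-1 : ℤ)⟧⟦-d⟧ :=
  ((shiftFunctorCompIsoId _ d (-d) (by simp)).app X).symm ≪≫
    (shiftFunctor _ (-d)).mapIso ((shiftFunctorCompIsoId _ (1 : ℤ) (-1) (by simp)).app (X⟦d⟧)).symm

/-- A bounded complex of finite sums of copies of `H` and `F` is a sum of strands. -/
lemma sums_of_finFree (K : CochainComplex MackeyMod ℤ) {a b : ℤ}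
    (hK : ∀ i, i < a ∨ b < i → IsZero (K.X i)) (hK' : ∀ i, FinFree (K.X i)) :
    Sums (StrandObj a) (Q.obj K) := by
  refine cell_induction (Φ := fun d X => Sums (StrandObj d) X)
    (ΦH := fun d X => Sums (StrandObjH d) X) (fun d X h => .zero h) (fun d X h => h.mono ?_)
    (fun d X h => h.mono ?_) ?_ ?_ K hK hK'
  · rintro X ⟨S, m, h, e⟩
    exact ⟨S, m, ⟨fun j hj => h j (by omega), by rw [h d (by omega)]; simp⟩, e⟩
  · rintro X ⟨S, m, ⟨h, -⟩, e⟩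
    exact ⟨S, m, h, e⟩
  · intro d X Y f g δ hT hX
    obtain ⟨α, β, γ, hT'⟩ := exists_attaching hT
    have h₁ : Sums (StrandObjH (-1)) (X⟦d⟧⟦(1 : ℤ)⟧) :=
      (hX.shift d fun X h => h.shift d).shift 1 fun X h => by
        have := h.shift 1
        rwa [sub_self, zero_sub] at this
    have h₂ := h₁.attach_H α β γ hT'
    exact ((h₂.shift (P' := StrandObjH 0) (-1) fun X h => by simpa using h.shift (-1)).shift (-d) fun X h => by
      have := h.shift (-d)
      rwa [zero_sub, neg_neg] at this).of_iso (unshiftIso Y d)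
  · intro d X Y f g δ hT hX
    obtain ⟨α, β, γ, hT'⟩ := exists_attaching hT
    have h₁ : Sums (StrandObj (-1)) (X⟦d⟧⟦(1 : ℤ)⟧) :=
      (hX.shift d fun X h => h.shift d).shift 1 fun X h => by
        have := h.shift 1
        rwa [sub_self, zero_sub] at this
    have h₂ := h₁.attach_F α β γ hT'
    exact ((h₂.shift (P' := StrandObj 0) (-1) fun X h => by simpa using h.shift (-1)).shift (-d) fun X h => by
      have := h.shift (-d)
      rwa [zero_sub, neg_neg] at this).of_iso (unshiftIso Y d)

lemma Strand.complex_eq (S : Strand) : S.complex = S.word.cx := by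
  cases S <;> rfl

lemma Sums.exists_strandSum {d : ℤ} {X : DerivedCategory MackeyMod}
    (h : Sums (StrandObj d) X) :
    ∃ (ι : Type) (_ : Finite ι) (S : ι → Strand) (m : ι → ℤ),
      Nonempty (X ≅ Q.obj (strandSum S m)) := by
  have := preservesBinaryBiproducts_of_preservesBiproducts (Q (C := MackeyMod))
  induction h with
  | zero h =>
    refine ⟨Empty, inferInstance, Empty.elim, Empty.elim, ⟨h.iso (Functor.map_isZero Q ?_)⟩⟩
    rw [IsZero.iff_id_eq_zero]
    exact biproduct.hom_ext _ _ fun i => i.elim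
  | add hS hR e ih =>
    obtain ⟨ι, _, S, m, ⟨e₁⟩⟩ := ih
    obtain ⟨S₀, m₀, -, ⟨e₀⟩⟩ := hS
    refine ⟨Option ι, inferInstance, fun i => i.elim S₀ S, fun i => i.elim m₀ m, ⟨?_⟩⟩
    have e₂ : Q.obj (S₀.word.sh m₀).cx ≅ Q.obj (S₀.complex⟦m₀⟧) :=
      Q.mapIso (S₀.word.shIso m₀ ≪≫ eqToIso (by rw [S₀.complex_eq]))
    exact e ≪≫ biprod.mapIso (e₀ ≪≫ e₂) e₁ ≪≫ (Q.mapBiprod _ _).symm ≪≫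
      Q.mapIso (biproductOptionIso (fun i : Option ι =>
        (Option.elim i S₀ S).complex⟦Option.elim i m₀ m⟧)).symm

lemma finFree_of_iso_biprod {M : MackeyMod} {m n : ℕ}
    (e : M ≅ (⨁ fun _ : Fin m => H) ⊞ (⨁ fun _ : Fin n => F)) : FinFree M :=
  ((finFree_biproduct m _ fun _ => finFree_H).biprod
    (finFree_biproduct n _ fun _ => finFree_F)).of_iso e

/-- Perfect complexes are sums of strands. -/
theorem IsPerfect.exists_strandSum {X : CochainComplex MackeyMod ℤ} (h : IsPerfect X) :
    ∃ (ι : Type) (_ : Finite ι) (S : ι → Strand) (m : ι → ℤ), QIso X (strandSum S m) := by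
  obtain ⟨K, ⟨e⟩, ⟨a, b, hab⟩, hK⟩ := h
  have hs := sums_of_finFree K hab fun i => by
    obtain ⟨m, n, ⟨e⟩⟩ := hK i
    exact finFree_of_iso_biprod e
  obtain ⟨ι, hι, S, m, ⟨e'⟩⟩ := hs.exists_strandSum
  exact ⟨ι, hι, S, m, ⟨e ≪≫ e'⟩⟩

/-! ### Maps from a word to a cell -/

namespace Word

lemma hom_pt_ext {c : Cell} {K : CochainComplex MackeyMod ℤ} {f g : K ⟶ (pt c).cx}
    (h : f.f 0 = g.f 0) : f = g := by
  ext1 i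
  by_cases hi : i = 0
  · subst hi; exact h
  · exact (isZero_pt_X c hi).eq_of_tgt _ _

lemma pt_cocycle {c : Cell} {K : CochainComplex MackeyMod ℤ} (f : K ⟶ (pt c).cx) :
    K.d (-1) 0 ≫ f.f 0 = 0 := by
  rw [← f.comm, pt_d, comp_zero]

/-- The chain map given by a cocycle. -/
noncomputable def mapPt {c : Cell} {K : CochainComplex MackeyMod ℤ} (z : K.X 0 ⟶ c.obj)
    (hz : K.d (-1) 0 ≫ z = 0) : K ⟶ (pt c).cx where
  f i := if h : i = 0 then by subst h; exact z else 0
  comm' i j hij := by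
    obtain rfl : i + 1 = j := hij
    rw [pt_d, comp_zero]
    by_cases hi : i + 1 = 0
    · obtain rfl : i = -1 := by omega
      exact hz.symm
    · rw [dif_neg hi, comp_zero]

lemma Q_to_pt_eq_zero_iff {c : Cell} {K : CochainComplex MackeyMod ℤ} (hK : K.IsKProjective)
    (f : K ⟶ (pt c).cx) :
    Q.map f = 0 ↔ ∃ y : K.X 1 ⟶ c.obj, f.f 0 = K.d 0 1 ≫ y := by
  rw [Q_map_eq_zero_iff hK]
  constructor
  · rintro ⟨h⟩
    refine ⟨h.hom 1 0, ?_⟩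
    have e := h.comm 0
    rw [dNext_eq _ (show (ComplexShape.up ℤ).Rel 0 1 from rfl),
      prevD_eq _ (show (ComplexShape.up ℤ).Rel (-1) 0 from rfl), pt_d, comp_zero, add_zero] at e
    exact e.trans (add_zero _)
  · rintro ⟨y, hy⟩
    let s : ∀ i j, (ComplexShape.up ℤ).Rel j i → (K.X i ⟶ (pt c).cx.X j) := fun i j hij =>
      if h : i = 1 then by
        obtain rfl : j = 0 := by
          have : j + 1 = i := hij
          omega
        subst h; exact y
      else 0
    have e : f = Homotopy.nullHomotopicMap' s := by
      apply hom_pt_ext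
      rw [Homotopy.nullHomotopicMap'_f (k₂ := (-1 : ℤ)) (k₁ := (0 : ℤ)) (k₀ := (1 : ℤ)) rfl rfl,
        pt_d, comp_zero, add_zero, hy]
      rfl
    rw [e]
    exact ⟨Homotopy.nullHomotopy' s⟩

lemma exists_cocycle {c : Cell} {K : CochainComplex MackeyMod ℤ} (hK : K.IsKProjective)
    (a : Q.obj K ⟶ Q.obj (pt c).cx) :
    ∃ (z : K.X 0 ⟶ c.obj) (hz : K.d (-1) 0 ≫ z = 0), Q.map (mapPt z hz) = a := by
  obtain ⟨f, rfl⟩ := exists_rep a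
  exact ⟨f.f 0, pt_cocycle f, congrArg _ (hom_pt_ext rfl)⟩

lemma mapPt_eq_zero {c : Cell} {K : CochainComplex MackeyMod ℤ} (hK : K.IsKProjective)
    {z : K.X 0 ⟶ c.obj} {hz : K.d (-1) 0 ≫ z = 0} (h : z = 0) : Q.map (mapPt z hz) = 0 :=
  (Q_to_pt_eq_zero_iff hK _).mpr ⟨0, by rw [comp_zero]; exact h⟩

end Word

section Classes

variable {w : Word} (hw : w.Bdd)
include hw

open Cell

lemma covan_H_of (h : ¬ HNonzero (w.c 1) (w.c 0) (w.c (-1))) :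
    GVan (Q.obj w.cx ⟶ Q.obj (pt .fixed).cx) := by
  intro a
  obtain ⟨z, hz, rfl⟩ := exists_cocycle (isKProjective hw) a
  rw [Q_to_pt_eq_zero_iff (isKProjective hw), d_zero_one]
  rw [d_neg_one_zero] at hz
  suffices aux : ∀ (x y u : Cell) (z : y.obj ⟶ Cell.fixed.obj), ¬ HNonzero u y x →
      Cell.d x y ≫ z = 0 → ∃ y', z = Cell.d y u ≫ y' from aux _ _ _ _ h hz
  clear * -
  intro x y u z h hz
  cases y
  · exact ⟨0, isZero_zero_obj.eq_of_src _ _⟩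
  · have hu : u = fixed := by
      by_contra hu; exact h (Or.inr ⟨rfl, hu⟩)
    subst hu
    rcases hom_F_H z with rfl | rfl
    · exact ⟨0, comp_zero.symm⟩
    · exact ⟨𝟙 H, (Category.comp_id _).symm⟩
  · have hx : x = free := by
      by_contra hx; exact h (Or.inl ⟨rfl, hx⟩)
    subst hx
    rcases hom_H_H z with rfl | rfl
    · exact ⟨0, comp_zero.symm⟩
    · exact absurd ((Category.comp_id _).symm.trans hz) pFH_ne_zero

lemma cole_H : GLe (Q.obj w.cx ⟶ Q.obj (pt .fixed).cx) := by
  intro a b ha hb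
  obtain ⟨z, hz, rfl⟩ := exists_cocycle (isKProjective hw) a
  obtain ⟨z', hz', rfl⟩ := exists_cocycle (isKProjective hw) b
  have hz0 : z ≠ 0 := fun h => ha (mapPt_eq_zero (isKProjective hw) h)
  have hz0' : z' ≠ 0 := fun h => hb (mapPt_eq_zero (isKProjective hw) h)
  suffices aux : ∀ (y : Cell) (z z' : y.obj ⟶ Cell.fixed.obj), z ≠ 0 → z' ≠ 0 → z = z' by
    obtain rfl := aux _ z z' hz0 hz0'
    rfl
  intro y z z' h h'
  cases y
  · exact isZero_zero_obj.eq_of_src _ _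
  · rw [(hom_F_H z).resolve_left h, (hom_F_H z').resolve_left h']
  · rw [(hom_H_H z).resolve_left h, (hom_H_H z').resolve_left h']

lemma coone_H_of (h : HNonzero (w.c 1) (w.c 0) (w.c (-1))) :
    GOne (Q.obj w.cx ⟶ Q.obj (pt .fixed).cx) := by
  refine ⟨cole_H hw, ?_⟩
  suffices ∃ z : (w.c 0).obj ⟶ Cell.fixed.obj, Cell.d (w.c (-1)) (w.c 0) ≫ z = 0 ∧
      ∀ y, z ≠ Cell.d (w.c 0) (w.c 1) ≫ y by
    obtain ⟨z, hz, hz'⟩ := this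
    refine ⟨Q.map (mapPt z (by rw [d_neg_one_zero]; exact hz)), fun e => ?_⟩
    rw [Q_to_pt_eq_zero_iff (isKProjective hw), d_zero_one] at e
    obtain ⟨y, hy⟩ := e
    exact hz' y hy
  generalize w.c (-1) = x at *
  generalize w.c 0 = y at *
  generalize w.c 1 = u at *
  rcases h with ⟨rfl, hx⟩ | ⟨rfl, hu⟩
  · refine ⟨𝟙 H, ?_, fun y e => ?_⟩
    · cases x
      · exact zero_comp
      · exact absurd rfl hx
      · exact zero_comp
    · cases u
      · exact id_H_ne_zero (e.trans zero_comp)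
      · rcases hom_F_H y with rfl | rfl
        · exact id_H_ne_zero (e.trans comp_zero)
        · exact id_H_ne_zero (e.trans pHF_pFH)
      · exact id_H_ne_zero (e.trans zero_comp)
  · refine ⟨pFH, ?_, fun y e => ?_⟩
    · cases x
      · exact zero_comp
      · exact eps_pFH
      · exact pHF_pFH
    · cases u
      · exact pFH_ne_zero (e.trans zero_comp)
      · rcases hom_F_H y with rfl | rfl
        · exact pFH_ne_zero (e.trans comp_zero)
        · exact pFH_ne_zero (e.trans eps_pFH)
      · exact hu rfl

lemma covan_F_of (h : ¬ FNonzero (w.c 1) (w.c 0) (w.c (-1))) :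
    GVan (Q.obj w.cx ⟶ Q.obj (pt .free).cx) := by
  intro a
  obtain ⟨z, hz, rfl⟩ := exists_cocycle (isKProjective hw) a
  rw [Q_to_pt_eq_zero_iff (isKProjective hw), d_zero_one]
  rw [d_neg_one_zero] at hz
  suffices aux : ∀ (x y u : Cell) (z : y.obj ⟶ Cell.free.obj), ¬ FNonzero u y x →
      Cell.d x y ≫ z = 0 → ∃ y', z = Cell.d y u ≫ y' from aux _ _ _ _ h hz
  clear * -
  intro x y u z h hz
  cases y
  · exact ⟨0, isZero_zero_obj.eq_of_src _ _⟩
  · have hu : u ≠ zero := fun hu => h (Or.inr ⟨rfl, Or.inl hu⟩)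
    have hx : x ≠ zero := fun hx => h (Or.inr ⟨rfl, Or.inr hx⟩)
    have hd : ∀ z : F ⟶ F, (z = 𝟙 F ∨ z = tF) → Cell.d x free ≫ z ≠ 0 := by
      cases x
      · exact absurd rfl hx
      · rintro z (rfl | rfl) h0
        · exact one_add_tF_ne_zero ((Category.comp_id _).symm.trans h0)
        · refine one_add_tF_ne_zero (Eq.trans ?_ h0)
          change 𝟙 F + tF = (𝟙 F + tF) ≫ tF
          rw [Preadditive.add_comp, tF_tF, Category.id_comp, add_comm]
      · rintro z (rfl | rfl) h0
        · exact pHF_ne_zero ((Category.comp_id _).symm.trans h0)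
        · exact pHF_ne_zero (pHF_tF.symm.trans h0)
    rcases hom_F_F z with rfl | rfl | rfl | rfl
    · exact ⟨0, comp_zero.symm⟩
    · exact absurd hz (hd _ (Or.inl rfl))
    · exact absurd hz (hd _ (Or.inr rfl))
    · cases u
      · exact absurd rfl hu
      · exact ⟨𝟙 F, (Category.comp_id _).symm⟩
      · exact ⟨pHF, pFH_pHF.symm⟩
  · rcases hom_H_F z with rfl | rfl
    · exact ⟨0, comp_zero.symm⟩
    · by_cases hu : u = free
      · subst hu
        exact ⟨𝟙 F, (Category.comp_id _).symm⟩
      · have hx : x = free := by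
          by_contra hx; exact h (Or.inl ⟨rfl, hu, hx⟩)
        subst hx
        exact absurd (pFH_pHF.symm.trans hz) one_add_tF_ne_zero

end Classes

/-! ### Regrading -/

section Regrade

variable {X : DerivedCategory MackeyMod} {w : Word} {p : ℤ}

/-- `[X, w]^p` in terms of the suspended word. -/
noncomputable def shTgtEquiv (X : DerivedCategory MackeyMod) (w : Word) (p : ℤ) :
    (X ⟶ Q.obj (w.sh p).cx) ≃+ (X ⟶ (Q.obj w.cx)⟦p⟧) where
  toFun f := f ≫ (w.QshIso p).hom
  invFun f := f ≫ (w.QshIso p).inv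
  left_inv f := by simp
  right_inv f := by simp
  map_add' f g := by simp

/-- `[w, X]^p` in terms of the suspended word. -/
noncomputable def shSrcEquiv (X : DerivedCategory MackeyMod) (w : Word) (p : ℤ) :
    (Q.obj w.cx ⟶ X⟦p⟧) ≃+ (Q.obj (w.sh (-p)).cx ⟶ X) :=
  (homShiftSrc (Q.obj w.cx) X (show p + -p = 0 by ring)).trans
    { toFun := fun f => (w.QshIso (-p)).hom ≫ f ≫ (shiftFunctorZero _ ℤ).hom.app X
      invFun := fun f => (w.QshIso (-p)).inv ≫ f ≫ (shiftFunctorZero _ ℤ).inv.app X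
      left_inv := fun f => by
        simp only [Category.assoc, Iso.hom_inv_id_app, Iso.inv_hom_id_assoc]
        exact Category.comp_id f
      right_inv := fun f => by
        simp only [Category.assoc, Iso.inv_hom_id_app, Iso.hom_inv_id_assoc]
        exact Category.comp_id f
      map_add' := fun f g => by
        rw [Preadditive.add_comp, Preadditive.comp_add] }

lemma van_H (h : ¬ Cell.HNonzero (w.c (p - 1)) (w.c p) (w.c (p + 1))) :
    Van Hq (Q.obj w.cx) p :=
  (GVan.congr (shTgtEquiv Hq w p)).mp (van_H_of (w := w.sh p) (by
    rwa [sh_c, sh_c, sh_c, neg_add_eq_sub, zero_add, add_comm 1 p]))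

lemma one_H (h : Cell.HNonzero (w.c (p - 1)) (w.c p) (w.c (p + 1))) :
    One Hq (Q.obj w.cx) p :=
  (GOne.congr (shTgtEquiv Hq w p)).mp (one_H_of (w := w.sh p) (by
    rwa [sh_c, sh_c, sh_c, neg_add_eq_sub, zero_add, add_comm 1 p]))

lemma van_F (h : ¬ Cell.FNonzero (w.c (p - 1)) (w.c p) (w.c (p + 1))) :
    Van Fq (Q.obj w.cx) p :=
  (GVan.congr (shTgtEquiv Fq w p)).mp (van_F_of (w := w.sh p) (by
    rwa [sh_c, sh_c, sh_c, neg_add_eq_sub, zero_add, add_comm 1 p]))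

lemma one_F (h : Cell.FNonzero (w.c (p - 1)) (w.c p) (w.c (p + 1)))
    (h' : w.c p = .free → w.c (p - 1) = .zero → w.c (p + 1) ≠ .zero) :
    One Fq (Q.obj w.cx) p :=
  (GOne.congr (shTgtEquiv Fq w p)).mp ⟨le_F_of (w := w.sh p) (by
    rwa [sh_c, sh_c, sh_c, neg_add_eq_sub, zero_add, add_comm 1 p]), exists_F_of (w := w.sh p) (by
    rwa [sh_c, sh_c, sh_c, neg_add_eq_sub, zero_add, add_comm 1 p])⟩

lemma covan_H (hw : w.Bdd) (h : ¬ Cell.HNonzero (w.c (1 - p)) (w.c (-p)) (w.c (-1 - p))) :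
    Van (Q.obj w.cx) Hq p :=
  (GVan.congr (shSrcEquiv Hq w p)).mpr (covan_H_of (w := w.sh (-p)) (hw.sh _) (by
    rwa [sh_c, sh_c, sh_c, zero_add]))

lemma coone_H (hw : w.Bdd) (h : Cell.HNonzero (w.c (1 - p)) (w.c (-p)) (w.c (-1 - p))) :
    One (Q.obj w.cx) Hq p :=
  (GOne.congr (shSrcEquiv Hq w p)).mpr (coone_H_of (w := w.sh (-p)) (hw.sh _) (by
    rwa [sh_c, sh_c, sh_c, zero_add]))

lemma covan_F (hw : w.Bdd) (h : ¬ Cell.FNonzero (w.c (1 - p)) (w.c (-p)) (w.c (-1 - p))) :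
    Van (Q.obj w.cx) Fq p :=
  (GVan.congr (shSrcEquiv Fq w p)).mpr (covan_F_of (w := w.sh (-p)) (hw.sh _) (by
    rwa [sh_c, sh_c, sh_c, zero_add]))

variable {Y : DerivedCategory MackeyMod} {a q : ℤ}

lemma van_sh_tgt (h : a + p = q) : Van X (Q.obj (w.sh a).cx) p ↔ Van X (Q.obj w.cx) q :=
  (van_congr (Iso.refl X) (w.QshIso a)).trans (van_tgt_iff X _ h.symm)

lemma van_sh_src (h : q + a = p) : Van (Q.obj (w.sh a).cx) Y p ↔ Van (Q.obj w.cx) Y q :=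
  (van_congr (w.QshIso a) (Iso.refl Y)).trans (van_src_iff _ Y h)

end Regrade

/-! ### Groups of maps between cells and strands -/

/-- The complex `A_k`, in the derived category. -/
noncomputable abbrev qA (k : ℕ) : DerivedCategory MackeyMod := Q.obj (A k).cx
/-- The complex `H(n)`, in the derived category. -/
noncomputable abbrev qH (n : ℤ) : DerivedCategory MackeyMod := Q.obj (Word.H n).cx
/-- The complex `B_r`, in the derived category. -/
noncomputable abbrev qB (r : ℕ) : DerivedCategory MackeyMod := Q.obj (B r).cx

lemma qH_zero : qH 0 = Hq := by rw [qH, pt_fixed]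
lemma qA_zero : qA 0 = Fq := by rw [qA, pt_free]

lemma van_F_H {q p : ℤ} (h : p ≠ 0) : Van Fq (qH q) p := van_F (by
  simp only [Word.H, Cell.FNonzero]; split_ifs <;> simp <;> omega)

lemma one_F_H (q : ℤ) : One Fq (qH q) 0 := one_F
  (by simp only [Word.H, Cell.FNonzero]; split_ifs <;> simp <;> omega)
  (by simp only [Word.H]; split_ifs <;> simp <;> omega)

lemma van_F_B (r : ℕ) (p : ℤ) : Van Fq (qB r) p := van_F (by
  simp only [B, Cell.FNonzero]; split_ifs <;> simp <;> omega)

lemma van_H_H {q p : ℤ} (h : ¬ (0 ≤ p ∧ p ≤ q)) (h' : ¬ (q + 2 ≤ p ∧ p ≤ 0)) :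
    Van Hq (qH q) p := van_H (by
  simp only [Word.H, Cell.HNonzero]; split_ifs <;> simp <;> omega)

lemma one_H_H {q p : ℤ} (h : (0 ≤ p ∧ p ≤ q) ∨ (q + 2 ≤ p ∧ p ≤ 0)) :
    One Hq (qH q) p := one_H (by
  simp only [Word.H, Cell.HNonzero]; split_ifs <;> simp <;> omega)

lemma van_H_B {p : ℤ} (h : p ≠ 2) : Van Hq (qB 0) p := van_H (by
  simp only [B, Cell.HNonzero]; push_cast; split_ifs <;> simp <;> omega)

lemma van_A_F {k : ℕ} {p : ℤ} (h : p ≠ 0 ∧ p ≠ k) : Van (qA k) Fq p := covan_F (bdd_A k) (by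
  simp only [A, Cell.FNonzero]; split_ifs <;> simp <;> omega)

lemma van_B_F (r : ℕ) (p : ℤ) : Van (qB r) Fq p := covan_F (bdd_B r) (by
  simp only [B, Cell.FNonzero]; split_ifs <;> simp <;> omega)

lemma van_B_Hq {r : ℕ} {p : ℤ} (h : ¬ (-r ≤ p ∧ p ≤ 0)) : Van (qB r) Hq p := covan_H (bdd_B r) (by
  simp only [B, Cell.HNonzero]; split_ifs <;> simp <;> omega)

lemma one_B_Hq {r : ℕ} {p : ℤ} (h : -r ≤ p ∧ p ≤ 0) : One (qB r) Hq p := coone_H (bdd_B r) (by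
  simp only [B, Cell.HNonzero]; split_ifs <;> simp <;> omega)

lemma van_A_Hq {k : ℕ} {p : ℤ} (h : ¬ (0 ≤ p ∧ p ≤ k)) : Van (qA k) Hq p := covan_H (bdd_A k) (by
  simp only [A, Cell.HNonzero]; split_ifs <;> simp <;> omega)

lemma one_A_Hq {k : ℕ} {p : ℤ} (h : 0 ≤ p ∧ p ≤ k) : One (qA k) Hq p := coone_H (bdd_A k) (by
  simp only [A, Cell.HNonzero]; split_ifs <;> simp <;> omega)

/-! ### The triangle of `ρ` -/

section TriEx

universe v u
variable {C : Type u} [Category.{v} C] [Preadditive C] [HasZeroObject C] [HasShift C ℤ]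
  [∀ n : ℤ, (shiftFunctor C n).Additive] [Pretriangulated C]

/-- There is a distinguished triangle with the given objects. -/
def TriEx (X Y Z : C) : Prop :=
  ∃ (f : X ⟶ Y) (g : Y ⟶ Z) (h : Z ⟶ X⟦(1 : ℤ)⟧), Triangle.mk f g h ∈ distTriang C

lemma TriEx.rotate {X Y Z : C} (h : TriEx X Y Z) : TriEx Y Z (X⟦(1 : ℤ)⟧) := by
  obtain ⟨f, g, δ, hT⟩ := h
  exact ⟨_, _, _, rot_of_distTriang _ hT⟩

lemma TriEx.congr {X Y Z X' Y' Z' : C} (h : TriEx X Y Z) (e : Nonempty (X ≅ X'))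
    (e' : Nonempty (Y ≅ Y')) (e'' : Nonempty (Z ≅ Z')) : TriEx X' Y' Z' := by
  obtain ⟨f, g, δ, hT⟩ := h
  obtain ⟨e⟩ := e
  obtain ⟨e'⟩ := e'
  obtain ⟨e''⟩ := e''
  refine ⟨e.inv ≫ f ≫ e'.hom, e'.inv ≫ g ≫ e''.hom, e''.inv ≫ δ ≫ e.hom⟦(1 : ℤ)⟧', ?_⟩
  refine isomorphic_distinguished _ hT _ ?_
  exact (Triangle.isoMk _ _ e e' e'' (e.hom_inv_id_assoc _).symm (e'.hom_inv_id_assoc _).symm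
    (e''.hom_inv_id_assoc _).symm).symm

end TriEx

namespace Word

lemma ext_rho_nonneg {s : ℤ} (hs : 0 ≤ s) : Ext ((H s).sh (-1)) (H (1 + s)) (A 0) := fun i => by
  simp only [A, H, sh]; push_cast; split_ifs <;> simp <;> omega

lemma ext_rho_neg {s : ℤ} (hs : s < 0) : Ext (A 0) (H s) ((H (1 + s)).sh 1) := fun i => by
  simp only [A, H, sh]; push_cast; split_ifs <;> simp <;> omega

lemma QshIso_shift (w : Word) {a b : ℤ} (h : a + b = 0) :
    Nonempty ((Q.obj (w.sh a).cx)⟦b⟧ ≅ Q.obj w.cx) :=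
  ⟨(shiftFunctor _ b).mapIso (w.QshIso a) ≪≫ (shiftFunctorAdd' _ a b 0 h).symm.app _ ≪≫
    (shiftFunctorZero _ ℤ).app _⟩

end Word

/-- The triangle `F ⟶ H(s) ⟶ H(1 + s)[1] ⟶ F[1]`. For `s ≥ 0` the module `F` is the
lowest cell of `H(1 + s)`, and for `s < 0` it is the highest cell of `H(s)`. -/
lemma triEx_rho (s : ℤ) : TriEx Fq (qH s) ((qH (1 + s))⟦(1 : ℤ)⟧) := by
  rw [← qA_zero]
  rcases lt_or_ge s 0 with hs | hs
  · obtain ⟨δ, h⟩ := (ext_rho_neg hs).exists_triangle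
    exact TriEx.congr ⟨_, _, _, h⟩ ⟨Iso.refl _⟩ ⟨Iso.refl _⟩ ⟨Word.QshIso _ _⟩
  · obtain ⟨δ, h⟩ := (ext_rho_nonneg hs).exists_triangle
    exact (TriEx.rotate ⟨_, _, _, h⟩).rotate.congr ⟨Iso.refl _⟩
      (QshIso_shift _ (by norm_num)) ⟨Iso.refl _⟩

/-- The map `F ⟶ H(s)`. -/
noncomputable def kap (s : ℤ) : Fq ⟶ qH s := (triEx_rho s).choose
/-- The map `H(s) ⟶ H(1 + s)[1]`; it is multiplication by `ρ`, see `exists_rho`. -/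
noncomputable def rho (s : ℤ) : qH s ⟶ (qH (1 + s))⟦(1 : ℤ)⟧ := (triEx_rho s).choose_spec.choose
/-- The map `H(1 + s)[1] ⟶ F[1]`. -/
noncomputable def rhoCo (s : ℤ) : (qH (1 + s))⟦(1 : ℤ)⟧ ⟶ Fq⟦(1 : ℤ)⟧ :=
  (triEx_rho s).choose_spec.choose_spec.choose

lemma rho_triangle (s : ℤ) : Triangle.mk (kap s) (rho s) (rhoCo s) ∈
    distTriang (DerivedCategory MackeyMod) :=
  (triEx_rho s).choose_spec.choose_spec.choose_spec

/-! ### Groups of maps between the complexes `H(n)` -/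

lemma van_H_F {n p : ℤ} (h : p ≠ 0) : Van (qH n) Fq p := covan_F (bdd_H n) (by
  simp only [Word.H, Cell.FNonzero]; split_ifs <;> simp <;> omega)

/-- `[H(n), H(q)]^p` for `p ≠ 0` depends on `q - n` only. -/
lemma congr_H_H_succ (n q : ℤ) {p : ℤ} (hp : p ≠ 0) :
    Nonempty ((qH n ⟶ (qH q)⟦p⟧) ≃+ (qH (1 + n) ⟶ (qH (1 + q))⟦p⟧)) := by
  have src (q p : ℤ) (h₀ : p ≠ 0) (h₁ : p ≠ 1) :
      Nonempty ((qH n ⟶ (qH q)⟦p⟧) ≃+ (qH (1 + n) ⟶ (qH q)⟦p - 1⟧)) :=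
    ⟨(preEquiv₂ (rho_triangle n) (van_F_H (by omega)) (van_F_H h₀)).symm.trans
      (homShiftSrc _ _ (show p - 1 + 1 = p by ring)).symm⟩
  have tgt (n p : ℤ) (h₀ : p ≠ 0) (h₁ : p ≠ -1) :
      Nonempty ((qH n ⟶ (qH q)⟦p⟧) ≃+ (qH n ⟶ (qH (1 + q))⟦p + 1⟧)) :=
    ⟨(postEquiv₂ (rho_triangle q) (van_H_F h₀) (van_H_F (by omega))).trans
      (homShiftTgt _ _ (show p + 1 = 1 + p by ring)).symm⟩
  by_cases h : p = -1
  · subst h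
    obtain ⟨e⟩ := src q (-1) (by norm_num) (by norm_num)
    obtain ⟨e'⟩ := tgt (1 + n) (-1 - 1) (by norm_num) (by norm_num)
    exact ⟨e.trans e'⟩
  · obtain ⟨e⟩ := tgt n p hp h
    obtain ⟨e'⟩ := src (1 + q) (p + 1) (by omega) (by omega)
    rw [add_sub_cancel_right] at e'
    exact ⟨e.trans e'⟩

lemma congr_H_H (n q : ℤ) {p : ℤ} (hp : p ≠ 0) :
    Nonempty ((qH n ⟶ (qH q)⟦p⟧) ≃+ (Hq ⟶ (qH (q - n))⟦p⟧)) := by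
  rw [← qH_zero]
  have key (m : ℤ) : Nonempty ((qH m ⟶ (qH (q - n + m))⟦p⟧) ≃+ (qH 0 ⟶ (qH (q - n))⟦p⟧)) := by
    induction m with
    | zero => rw [add_zero]; exact ⟨AddEquiv.refl _⟩
    | succ m ih =>
      obtain ⟨e⟩ := ih
      obtain ⟨e'⟩ := congr_H_H_succ m (q - n + m) hp
      rw [add_comm (m : ℤ) 1, show q - n + (1 + (m : ℤ)) = 1 + (q - n + m) by ring]
      exact ⟨e'.symm.trans e⟩
    | pred m ih =>
      obtain ⟨e⟩ := ih
      obtain ⟨e'⟩ := congr_H_H_succ (-m - 1) (q - n + (-m - 1)) hp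
      rw [show 1 + (-(m : ℤ) - 1) = -m by ring,
        show 1 + (q - n + (-(m : ℤ) - 1)) = q - n + -m by ring] at e'
      exact ⟨e'.trans e⟩
  obtain ⟨e⟩ := key n
  rw [sub_add_cancel] at e
  exact ⟨e⟩

lemma van_HH {n q p : ℤ} (hp : p ≠ 0) (h : ¬ (0 ≤ p ∧ p ≤ q - n))
    (h' : ¬ (q - n + 2 ≤ p ∧ p ≤ 0)) : Van (qH n) (qH q) p := by
  obtain ⟨e⟩ := congr_H_H n q hp
  exact (GVan.congr e).mpr (van_H_H h h')

/-- For `n ≤ q` maps `H(n) ⟶ H(q)` are detected by `F ⟶ H(n)`. -/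
lemma kap_detect {n q : ℤ} (h : n ≤ q) (f : qH n ⟶ (qH q)⟦(0 : ℤ)⟧) (hf : kap n ≫ f = 0) :
    f = 0 :=
  pre_inj₁ (rho_triangle n)
    ((van_src_iff (qH (1 + n)) (qH q) (show -1 + 1 = (0 : ℤ) by norm_num)).mpr
      (van_HH (by norm_num) (by omega) (by omega))) f hf

/-- The positive cone: `[H(n), H(q)]^p` has order two for `0 ≤ p ≤ q - n`. -/
lemma one_HH {n q p : ℤ} (h : 0 ≤ p) (h' : p ≤ q - n) : One (qH n) (qH q) p := by
  have pos {n p : ℤ} (hp : p ≠ 0) (h : 0 ≤ p) (h' : p ≤ q - n) : One (qH n) (qH q) p := by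
    obtain ⟨e⟩ := congr_H_H n q hp
    exact (GOne.congr e).mpr (one_H_H (Or.inl ⟨h, h'⟩))
  by_cases hp : p = 0
  · subst hp
    refine ⟨GLe.of_injective (pre (kap n) (qH q) 0) (kap_detect (by omega)) (one_F_H q).le, ?_⟩
    obtain ⟨m, rfl⟩ : ∃ m, n = 1 + m := ⟨n - 1, by ring⟩
    obtain ⟨a, ha⟩ := (pos (n := m) one_ne_zero (by norm_num) (by omega)).2
    obtain ⟨b, rfl⟩ := pre_surj₂ (rho_triangle m) (van_F_H one_ne_zero) a
    by_contra! H0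
    have : Van (qH (1 + m)) (qH q) 0 := H0
    obtain rfl : b = 0 := (van_src_iff _ _ (show (0 : ℤ) + 1 = 1 by norm_num)).mpr this b
    exact ha (map_zero _)
  · exact pos hp h h'

/-! ### Maps of degree `a` -/

/-- The map `[W, Y]^p ⟶ [W, Z]^{a + p}` induced by `g : Y ⟶ Z[a]`. -/
noncomputable def step (W : DerivedCategory MackeyMod) {Y Z : DerivedCategory MackeyMod} {a : ℤ}
    (g : Y ⟶ Z⟦a⟧) (p : ℤ) : (W ⟶ Y⟦p⟧) →+ (W ⟶ Z⟦a + p⟧) where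
  toFun x := x ≫ g⟦p⟧' ≫ (shiftFunctorAdd _ a p).inv.app Z
  map_zero' := zero_comp
  map_add' _ _ := Preadditive.add_comp _ _ _ _ _ _

section step

variable {W Y Z Y' Z' : DerivedCategory MackeyMod} {a p : ℤ} (g : Y ⟶ Z⟦a⟧)

lemma step_apply (x : W ⟶ Y⟦p⟧) :
    step W g p x = x ≫ g⟦p⟧' ≫ (shiftFunctorAdd _ a p).inv.app Z := rfl

lemma step_eq_zero_iff (x : W ⟶ Y⟦p⟧) : step W g p x = 0 ↔ post W g p x = 0 := by
  rw [step_apply, post_apply, ← Category.assoc]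
  exact Preadditive.IsIso.comp_right_eq_zero _ _

lemma step_surj_iff (y : W ⟶ Z⟦a + p⟧) :
    (∃ x, step W g p x = y) ↔ ∃ x, post W g p x = y ≫ (shiftFunctorAdd _ a p).hom.app Z := by
  refine exists_congr fun x => ?_
  rw [step_apply, post_apply, ← Category.assoc]
  constructor
  · rintro rfl
    simp
  · intro h
    rw [h]
    simp

lemma pre_step {W' : DerivedCategory MackeyMod} (f : W' ⟶ W) (x : W ⟶ Y⟦p⟧) :
    f ≫ step W g p x = step W' g p (f ≫ x) := by
  simp [step_apply]

lemma step_post {g' : Y' ⟶ Z'⟦a⟧} {u : Y ⟶ Y'} {v : Z ⟶ Z'} (h : g ≫ v⟦a⟧' = u ≫ g')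
    (x : W ⟶ Y⟦p⟧) : step W g' p (post W u p x) = post W v (a + p) (step W g p x) := by
  simp only [step_apply, post_apply, Category.assoc]
  rw [← Functor.map_comp_assoc, ← h, Functor.map_comp_assoc]
  congr 2
  exact (shiftFunctorAdd _ a p).inv.naturality v

end step

lemma step_rho_inj {W : DerivedCategory MackeyMod} {s p : ℤ} (h : Van W Fq p)
    (x : W ⟶ (qH s)⟦p⟧) (hx : step W (rho s) p x = 0) : x = 0 :=
  post_inj₂ (rho_triangle s) h x ((step_eq_zero_iff _ _).mp hx)

lemma step_rho_surj {W : DerivedCategory MackeyMod} {s p : ℤ} (h : Van W Fq (1 + p))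
    (y : W ⟶ (qH (1 + s))⟦1 + p⟧) : ∃ x, step W (rho s) p x = y :=
  (step_surj_iff _ _).mpr (post_surj₂ (rho_triangle s)
    (show Van W Fq (p + 1) by rwa [add_comm]) _)

/-- In the positive cone `ρ` acts injectively: it is onto, and source and target have order two. -/
lemma rho_inj_H {n s p : ℤ} (h : 0 ≤ p) (h' : p ≤ s - n) (x : qH n ⟶ (qH s)⟦p⟧)
    (hx : step (qH n) (rho s) p x = 0) : x = 0 :=
  GOne.inj_of_surjective _ (step_rho_surj (van_H_F (by omega))) (one_HH h h').le
    (one_HH (by omega) (by omega)) x hx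

/-! ### Multiplication by `τ` -/

/-- The nonzero map `H(s) ⟶ H(1 + s)`; for `s ≥ 1` it is multiplication by `τ`, see `exists_tau`. -/
noncomputable def tau (s : ℤ) : qH s ⟶ qH (1 + s) :=
  (one_HH (n := s) (q := 1 + s) le_rfl (by omega)).2.choose ≫ (shiftFunctorZero _ ℤ).hom.app _

lemma kap_tau_ne_zero (s : ℤ) : kap s ≫ tau s ≠ 0 := by
  intro h
  refine (one_HH (n := s) (q := 1 + s) le_rfl (by omega)).2.choose_spec
    (kap_detect (by omega) _ ?_)
  rw [tau, ← Category.assoc] at h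
  exact (Preadditive.IsIso.comp_right_eq_zero _ _).mp h

lemma tau_ne_zero (s : ℤ) : tau s ≠ 0 := fun h =>
  kap_tau_ne_zero s ((congrArg _ h).trans comp_zero)

lemma eq_tau {s : ℤ} {f : qH s ⟶ qH (1 + s)} (hf : f ≠ 0) : f = tau s := by
  rw [← cancel_mono ((shiftFunctorZero (DerivedCategory MackeyMod) ℤ).inv.app _)]
  refine (one_HH (n := s) (q := 1 + s) le_rfl (by omega)).1 _ _ (fun h => hf ?_)
    (fun h => tau_ne_zero s ?_)
  · exact (Preadditive.IsIso.comp_right_eq_zero _ _).mp h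
  · exact (Preadditive.IsIso.comp_right_eq_zero _ _).mp h

/-- Degree zero maps as elements of `[X, Y]^0`. -/
lemma post_zero {X Y Z : DerivedCategory MackeyMod} (f : X ⟶ Y) (g : Y ⟶ Z) :
    post X g 0 (f ≫ (shiftFunctorZero _ ℤ).inv.app Y) =
      (f ≫ g) ≫ (shiftFunctorZero _ ℤ).inv.app Z := by
  rw [post_apply, Category.assoc, Category.assoc]
  congr 1
  exact ((shiftFunctorZero _ ℤ).inv.naturality g).symm

lemma tau_inj_F (s p : ℤ) (x : Fq ⟶ (qH s)⟦p⟧) (hx : post Fq (tau s) p x = 0) : x = 0 := by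
  by_cases hp : p = 0
  · subst hp
    by_contra hne
    refine kap_tau_ne_zero s ?_
    have hk : kap s ≫ (shiftFunctorZero _ ℤ).inv.app (qH s) ≠ 0 := fun h => kap_tau_ne_zero s (by
      rw [(Preadditive.IsIso.comp_right_eq_zero _ _).mp h]
      exact zero_comp)
    rw [← (one_F_H s).1 _ _ hk hne, post_zero] at hx
    exact (Preadditive.IsIso.comp_right_eq_zero _ _).mp hx
  · exact van_F_H hp x

lemma tau_surj_F (s p : ℤ) (y : Fq ⟶ (qH (1 + s))⟦p⟧) : ∃ x, post Fq (tau s) p x = y := by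
  by_cases hp : p = 0
  · subst hp
    exact GOne.surj_of_injective _ (tau_inj_F s 0) (one_F_H s) (one_F_H _).le y
  · exact ⟨0, (map_zero _).trans (van_F_H hp y).symm⟩

/-- A long exact sequence in which a map is bijective. -/
lemma van_cone {T : Triangle (DerivedCategory MackeyMod)}
    (hT : T ∈ distTriang (DerivedCategory MackeyMod)) {W : DerivedCategory MackeyMod} {p : ℤ}
    (hi : ∀ x, post W T.mor₁ (p + 1) x = 0 → x = 0) (hs : ∀ y, ∃ x, post W T.mor₁ p x = y) :
    Van W T.obj₃ p := by
  intro x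
  have h₁ : post W T.mor₃ p x = 0 := by
    let e := homShiftTgt W T.obj₁ (add_comm p 1)
    have h₂ : e (e.symm (post W T.mor₃ p x)) = post W T.mor₃ p x := e.apply_symm_apply _
    rw [hi (e.symm (post W T.mor₃ p x)) ?_, map_zero] at h₂
    · exact h₂.symm
    · change ((x ≫ T.mor₃⟦p⟧') ≫ (shiftFunctorAdd' _ 1 p (p + 1) _).inv.app _) ≫ T.mor₁⟦p + 1⟧' = 0
      rw [Category.assoc, Category.assoc, ← (shiftFunctorAdd' _ 1 p (p + 1) _).inv.naturality,
        Functor.comp_map, ← Functor.map_comp_assoc, comp_distTriang_mor_zero₃₁ _ hT,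
        Functor.map_zero, zero_comp, comp_zero]
  obtain ⟨y, rfl⟩ := post_exact T.rotate (rot_of_distTriang _ hT) W p x h₁
  obtain ⟨z, rfl⟩ := hs y
  change (z ≫ T.mor₁⟦p⟧') ≫ T.mor₂⟦p⟧' = 0
  rw [Category.assoc, ← Functor.map_comp, comp_distTriang_mor_zero₁₂ _ hT, Functor.map_zero,
    comp_zero]

/-- Multiplication by `τ` is bijective on maps from `F`, so its cone is invisible to `F`. -/
lemma exists_tau_triangle (s : ℤ) : ∃ (K : DerivedCategory MackeyMod) (β : qH (1 + s) ⟶ K)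
    (γ : K ⟶ (qH s)⟦(1 : ℤ)⟧), Triangle.mk (tau s) β γ ∈ distTriang (DerivedCategory MackeyMod) ∧
      ∀ p, Van Fq K p := by
  obtain ⟨K, β, γ, hT⟩ := distinguished_cocone_triangle (tau s)
  exact ⟨K, β, γ, hT, fun p => van_cone hT (tau_inj_F s _) (tau_surj_F s p)⟩

/-- The maps `ρ` and `τ` commute, being the only nonzero elements of a group of order two. -/
lemma rho_tau (s : ℤ) : rho s ≫ (tau (1 + s))⟦(1 : ℤ)⟧' = tau s ≫ rho (1 + s) := by
  refine (one_HH (n := s) (q := 1 + (1 + s)) zero_le_one (by omega)).1 _ _ (fun h => ?_)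
    (fun h => ?_)
  · have h₁ : One ((qH (1 + s))⟦(1 : ℤ)⟧) (qH (1 + (1 + s))) 1 :=
      (one_src_iff _ _ (zero_add 1)).mpr (one_HH le_rfl (by omega))
    have h₂ := GOne.inj_of_surjective _ (pre_surj₂ (rho_triangle s)
      (van_F_H (q := 1 + (1 + s)) one_ne_zero)) h₁.le (one_HH zero_le_one (by omega)) _ h
    exact tau_ne_zero (1 + s) ((shiftFunctor _ (1 : ℤ)).map_injective
      (h₂.trans (Functor.map_zero _ _ _).symm))
  · have h₁ := rho_inj_H le_rfl (by omega) (tau s ≫ (shiftFunctorZero _ ℤ).inv.app (qH (1 + s)))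
      ((step_eq_zero_iff _ _).mpr ?_)
    · exact tau_ne_zero s ((Preadditive.IsIso.comp_right_eq_zero _ _).mp h₁)
    · rw [post_zero, h, zero_comp]

lemma step_rho_tau {W : DerivedCategory MackeyMod} {s p : ℤ} (x : W ⟶ (qH s)⟦p⟧) :
    step W (rho (1 + s)) p (post W (tau s) p x) = post W (tau (1 + s)) (1 + p) (step W (rho s) p x) :=
  step_post _ (rho_tau s) x

/-- In the positive cone `τ` acts injectively. In degree `0` this is seen on the image of `F`; each
other element is divisible by `ρ`, which commutes with `τ`. -/
lemma tau_inj_H {n q p : ℤ} (h : 0 ≤ p) (h' : p ≤ q - n) (x : qH n ⟶ (qH q)⟦p⟧)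
    (hx : post (qH n) (tau q) p x = 0) : x = 0 := by
  obtain ⟨m, hm⟩ : ∃ m : ℕ, p = m := ⟨p.toNat, by omega⟩
  induction m generalizing q p with
  | zero =>
    obtain rfl : p = 0 := hm
    refine kap_detect (by omega) x (tau_inj_F q 0 _ ?_)
    exact (Category.assoc _ _ _).trans ((congrArg (kap n ≫ ·) hx).trans comp_zero)
  | succ m ih =>
    obtain ⟨q, rfl⟩ : ∃ q', q = 1 + q' := ⟨q - 1, by ring⟩
    obtain rfl : p = 1 + m := by rw [hm]; push_cast; ring
    obtain ⟨y, rfl⟩ := step_rho_surj (van_H_F (by omega)) x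
    rw [← step_rho_tau] at hx
    rw [ih (by omega) (by omega) y (rho_inj_H (by omega) (by omega) _ hx) rfl, map_zero]

/-! ### Maps from `A_k` -/

/-- An object invisible to `F` is invisible to `A_k`, which is built from copies of `F`. -/
lemma van_A_of_F {K : DerivedCategory MackeyMod} (h : ∀ p, Van Fq K p) (k : ℕ) (p : ℤ) :
    Van (qA k) K p := by
  induction k generalizing p with
  | zero => rw [qA_zero]; exact h p
  | succ k ih =>
    obtain ⟨δ, hT⟩ := (ext_A 0 k).exists_triangle
    rw [show k + 1 = 0 + k + 1 by ring]
    exact van_pre₂ hT (by change Van (qA 0) K p; rw [qA_zero]; exact h p)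
      ((van_sh_src (show p - 1 + ((0 : ℕ) + 1) = p by push_cast; ring)).mpr (ih _))

/-- The cohomology of `A_k` is `τ`-periodic. -/
lemma congr_A_H (k : ℕ) (q p : ℤ) :
    Nonempty ((qA k ⟶ (qH q)⟦p⟧) ≃+ (qA k ⟶ Hq⟦p⟧)) := by
  have succ (q : ℤ) : Nonempty ((qA k ⟶ (qH q)⟦p⟧) ≃+ (qA k ⟶ (qH (1 + q))⟦p⟧)) := by
    obtain ⟨K, β, γ, hT, hK⟩ := exists_tau_triangle q
    exact ⟨postEquiv₁ hT (van_A_of_F hK k _) (van_A_of_F hK k _)⟩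
  rw [← qH_zero]
  induction q with
  | zero => exact ⟨AddEquiv.refl _⟩
  | succ m ih =>
    obtain ⟨e⟩ := ih
    obtain ⟨e'⟩ := succ m
    rw [add_comm (m : ℤ) 1]
    exact ⟨e'.symm.trans e⟩
  | pred m ih =>
    obtain ⟨e⟩ := ih
    obtain ⟨e'⟩ := succ (-m - 1)
    rw [show 1 + (-(m : ℤ) - 1) = -m by ring] at e'
    exact ⟨e'.trans e⟩

lemma van_A_H {k : ℕ} {q p : ℤ} (h : ¬ (0 ≤ p ∧ p ≤ k)) : Van (qA k) (qH q) p := by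
  obtain ⟨e⟩ := congr_A_H k q p
  exact (GVan.congr e).mpr (van_A_Hq h)

lemma one_A_H {k : ℕ} {q p : ℤ} (h : 0 ≤ p) (h' : p ≤ k) : One (qA k) (qH q) p := by
  obtain ⟨e⟩ := congr_A_H k q p
  exact (GOne.congr e).mpr (one_A_Hq ⟨h, h'⟩)

/-- Restriction from `A_{k+1}` to its subcomplex `A_k` reduces the claim to `A_{k+1}`, for which `ρ`
is onto in degree `p`. -/
lemma rho_inj_A {k : ℕ} {q p : ℤ} (h : 0 ≤ p) (h' : p < k) (x : qA k ⟶ (qH q)⟦p⟧)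
    (hx : step (qA k) (rho q) p x = 0) : x = 0 := by
  obtain ⟨δ, hT⟩ := (ext_A k 0).exists_triangle
  have hv (j : ℤ) (hj : j ≠ k + 1) : Van (Q.obj ((A 0).sh (k + 1)).cx) (qH q) j :=
    (van_sh_src (show j - (k + 1) + (k + 1) = j by ring)).mpr (by
      change Van (qA 0) _ _
      rw [qA_zero]; exact van_F_H (by omega))
  have hv' (j : ℤ) (hj : j ≠ k + 1) : Van (Q.obj ((A 0).sh (k + 1)).cx) (qH (1 + q)) j :=
    (van_sh_src (show j - (k + 1) + (k + 1) = j by ring)).mpr (by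
      change Van (qA 0) _ _
      rw [qA_zero]; exact van_F_H (by omega))
  obtain ⟨y, rfl⟩ := pre_surj₁ hT (hv (p + 1) (by omega)) x
  have hy : step (qA (k + 0 + 1)) (rho q) p y = 0 :=
    pre_inj₁ hT (hv' (1 + p) (by omega)) _
      ((pre_step (rho q) (Q.map (thr (ext_A k 0).compat₁)) y).trans hx)
  obtain rfl : y = 0 := GOne.inj_of_surjective _ (step_rho_surj (van_A_F (by push_cast; omega)))
    (one_A_H h (by push_cast; omega)).le (one_A_H (by omega) (by push_cast; omega)) y hy
  exact map_zero _

/-! ### Maps from `B_r` -/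

/-- The cohomology of `B_r` is `ρ`-periodic, as `B_r` has no maps to `F`. -/
lemma congr_B_H (r : ℕ) (q p : ℤ) :
    Nonempty ((qB r ⟶ (qH q)⟦p⟧) ≃+ (qB r ⟶ Hq⟦p - q⟧)) := by
  have succ (q p : ℤ) : Nonempty ((qB r ⟶ (qH q)⟦p⟧) ≃+ (qB r ⟶ (qH (1 + q))⟦1 + p⟧)) :=
    ⟨AddEquiv.ofBijective (step (qB r) (rho q) p) ⟨(injective_iff_map_eq_zero _).mpr
      (step_rho_inj (van_B_F r _)), step_rho_surj (van_B_F r _)⟩⟩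
  rw [← qH_zero]
  induction q generalizing p with
  | zero => rw [sub_zero]; exact ⟨AddEquiv.refl _⟩
  | succ m ih =>
    obtain ⟨e⟩ := ih (p - 1)
    obtain ⟨e'⟩ := succ m (p - 1)
    rw [show p - ((m : ℤ) + 1) = p - 1 - m by ring, add_comm (m : ℤ) 1]
    rw [show 1 + (p - 1) = p by ring] at e'
    exact ⟨e'.symm.trans e⟩
  | pred m ih =>
    obtain ⟨e⟩ := ih (1 + p)
    obtain ⟨e'⟩ := succ (-m - 1) p
    rw [show 1 + (-(m : ℤ) - 1) = -m by ring] at e'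
    rw [show p - (-(m : ℤ) - 1) = 1 + p - -m by ring]
    exact ⟨e'.trans e⟩

lemma van_B_H {r : ℕ} {q p : ℤ} (h : ¬ (-r ≤ p - q ∧ p - q ≤ 0)) : Van (qB r) (qH q) p := by
  obtain ⟨e⟩ := congr_B_H r q p
  exact (GVan.congr e).mpr (van_B_Hq h)

lemma one_B_H {r : ℕ} {q p : ℤ} (h : -r ≤ p - q) (h' : p - q ≤ 0) : One (qB r) (qH q) p := by
  obtain ⟨e⟩ := congr_B_H r q p
  exact (GOne.congr e).mpr (one_B_Hq ⟨h, h'⟩)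

lemma rho_inj_B {r : ℕ} {q p : ℤ} (x : qB r ⟶ (qH q)⟦p⟧)
    (hx : step (qB r) (rho q) p x = 0) : x = 0 := step_rho_inj (van_B_F r _) x hx

lemma van_H_B_zero {n p : ℤ} (h : p + n ≠ 2) : Van (qH n) (qB 0) p := by
  have succ (n p : ℤ) : Van (qH n) (qB 0) p ↔ Van (qH (1 + n)) (qB 0) (p - 1) :=
    (GVan.congr (preEquiv₂ (rho_triangle n) (van_F_B 0 _) (van_F_B 0 _))).symm.trans
      (van_src_iff _ _ (show p - 1 + 1 = p by ring))
  induction n generalizing p with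
  | zero => rw [qH_zero]; exact van_H_B (by omega)
  | succ m ih =>
    rw [add_comm (m : ℤ) 1]
    have := (succ m (p + 1)).mp (ih (by omega))
    rwa [add_sub_cancel_right] at this
  | pred m ih =>
    rw [succ, show 1 + (-(m : ℤ) - 1) = -m by ring]
    exact ih (by omega)

lemma van_B_B_zero {r : ℕ} {p : ℤ} (h : p ≠ 2) (h' : p ≠ -r) : Van (qB r) (qB 0) p := by
  obtain ⟨δ, hT⟩ := (ext_B r).exists_triangle
  exact van_pre₂ hT ((van_sh_src (show p + 1 + -1 = p by ring)).mpr (van_H_B_zero (by omega)))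
    (van_H_B_zero (by omega))

/-- The complex `B_0` is the fibre of `τ : H(0) ⟶ H(1)`. -/
lemma exists_B_triangle : ∃ (f : qB 0 ⟶ qH 0) (h : qH (1 + 0) ⟶ (qB 0)⟦(1 : ℤ)⟧),
    Triangle.mk f (tau 0) h ∈ distTriang (DerivedCategory MackeyMod) := by
  obtain ⟨δ, hT⟩ := (ext_B 0).exists_triangle
  obtain ⟨f, g, h, hT'⟩ := (TriEx.rotate ⟨_, _, _, hT⟩).congr ⟨Iso.refl (qB 0)⟩
    ⟨Iso.refl (qH 0)⟩ (Z' := qH (1 + 0)) (by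
      rw [show (1 + 0 : ℤ) = ((0 : ℕ) : ℤ) + 1 by norm_num]
      exact QshIso_shift _ (by norm_num))
  refine ⟨f, h, ?_⟩
  rwa [← eq_tau (f := g)]
  rintro rfl
  obtain ⟨a, ha⟩ := (one_F_H 0).2
  refine ha (post_inj₂ hT' (van_F_B 0 0) a ?_)
  change a ≫ (0 : qH 0 ⟶ qH (1 + 0))⟦(0 : ℤ)⟧' = 0
  rw [Functor.map_zero]
  exact comp_zero

/-- By `ρ`-periodicity the claim reduces to `q = 0`, where the fibre of `τ` is `B_0`. -/
lemma tau_inj_B {r : ℕ} {q p : ℤ} (hq : 0 ≤ q) (h : -r < p - q) (h' : p - q ≤ 0)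
    (x : qB r ⟶ (qH q)⟦p⟧) (hx : post (qB r) (tau q) p x = 0) : x = 0 := by
  obtain ⟨m, hm⟩ : ∃ m : ℕ, q = m := ⟨q.toNat, by omega⟩
  induction m generalizing q p with
  | zero =>
    obtain rfl : q = 0 := hm
    obtain ⟨f, g, hT⟩ := exists_B_triangle
    exact post_inj₂ hT (van_B_B_zero (by omega) (by omega)) x hx
  | succ m ih =>
    obtain ⟨p, rfl⟩ : ∃ p', p = 1 + p' := ⟨p - 1, by ring⟩
    obtain rfl : q = 1 + m := by rw [hm]; push_cast; ring
    obtain ⟨y, rfl⟩ := step_rho_surj (van_B_F r _) x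
    rw [← step_rho_tau] at hx
    rw [ih (by omega) (by omega) (by omega) y (rho_inj_B _ hx) rfl, map_zero]

/-! ### The box product of complexes as a bifunctor -/

section BoxMap

open HomologicalComplex

variable {K K' K'' L L' L'' : CochainComplex MackeyMod ℤ}

/-- The map of box products given by families of maps which need not commute with the
differentials. -/
noncomputable def boxGr (r : ∀ i, K.X i ⟶ K'.X i) (s : ∀ i, L.X i ⟶ L'.X i) (n : ℤ) :
    (boxC K L).X n ⟶ (boxC K' L').X n :=
  mapBifunctorDesc fun i j h =>
    (box.map (r i)).app (L.X j) ≫ (box.obj (K'.X i)).map (s j) ≫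
      ιMapBifunctor K' L' box (.up ℤ) i j n h

lemma ι_boxGr (r : ∀ i, K.X i ⟶ K'.X i) (s : ∀ i, L.X i ⟶ L'.X i) (n i j : ℤ)
    (h : ComplexShape.π (.up ℤ) (.up ℤ) (.up ℤ) (i, j) = n) :
    ιMapBifunctor K L box (.up ℤ) i j n h ≫ boxGr r s n =
      (box.map (r i)).app (L.X j) ≫ (box.obj (K'.X i)).map (s j) ≫
        ιMapBifunctor K' L' box (.up ℤ) i j n h :=
  ι_mapBifunctorDesc _ _ _ _

lemma boxGr_comp (r : ∀ i, K.X i ⟶ K'.X i) (s : ∀ i, L.X i ⟶ L'.X i)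
    (r' : ∀ i, K'.X i ⟶ K''.X i) (s' : ∀ i, L'.X i ⟶ L''.X i) (n : ℤ) :
    boxGr r s n ≫ boxGr r' s' n = boxGr (fun i => r i ≫ r' i) (fun i => s i ≫ s' i) n := by
  refine mapBifunctor.hom_ext fun i j h => ?_
  rw [← Category.assoc, ι_boxGr, Category.assoc, Category.assoc, ι_boxGr, ι_boxGr]
  simp

lemma boxGr_id (n : ℤ) : boxGr (fun i => 𝟙 (K.X i)) (fun i => 𝟙 (L.X i)) n = 𝟙 _ := by
  refine mapBifunctor.hom_ext fun i j h => ?_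
  rw [ι_boxGr]
  simp

lemma boxGr_congr {r r' : ∀ i, K.X i ⟶ K'.X i} {s s' : ∀ i, L.X i ⟶ L'.X i}
    (h : ∀ i, r i = r' i) (h' : ∀ i, s i = s' i) (n : ℤ) : boxGr r s n = boxGr r' s' n := by
  rw [funext h, funext h']

lemma boxGr_add_left (r r' : ∀ i, K.X i ⟶ K'.X i) (s : ∀ i, L.X i ⟶ L'.X i) (n : ℤ) :
    boxGr (fun i => r i + r' i) s n = boxGr r s n + boxGr r' s n := by
  refine mapBifunctor.hom_ext fun i j h => ?_
  rw [Preadditive.comp_add, ι_boxGr, ι_boxGr, ι_boxGr]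
  simp

lemma boxGr_add_right (r : ∀ i, K.X i ⟶ K'.X i) (s s' : ∀ i, L.X i ⟶ L'.X i) (n : ℤ) :
    boxGr r (fun i => s i + s' i) n = boxGr r s n + boxGr r s' n := by
  refine mapBifunctor.hom_ext fun i j h => ?_
  rw [Preadditive.comp_add, ι_boxGr, ι_boxGr, ι_boxGr]
  simp

/-- The chain map `f □ g`. -/
noncomputable abbrev boxMapC (f : K ⟶ K') (g : L ⟶ L') : boxC K L ⟶ boxC K' L' :=
  mapBifunctorMap f g box (.up ℤ)

lemma boxMapC_f (f : K ⟶ K') (g : L ⟶ L') (n : ℤ) : (boxMapC f g).f n = boxGr f.f g.f n := by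
  refine mapBifunctor.hom_ext fun i j h => ?_
  rw [ι_boxGr, ι_mapBifunctorMap]

lemma boxMapC_id (K L : CochainComplex MackeyMod ℤ) : boxMapC (𝟙 K) (𝟙 L) = 𝟙 (boxC K L) := by
  ext1 n
  rw [boxMapC_f]
  exact boxGr_id n

lemma boxMapC_comp (f : K ⟶ K') (f' : K' ⟶ K'') (g : L ⟶ L') (g' : L' ⟶ L'') :
    boxMapC (f ≫ f') (g ≫ g') = boxMapC f g ≫ boxMapC f' g' := by
  ext1 n
  rw [comp_f, boxMapC_f, boxMapC_f, boxMapC_f]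
  exact (boxGr_comp _ _ _ _ n).symm

/-- Isomorphic complexes have isomorphic box products. -/
noncomputable def boxIso (e : K ≅ K') (e' : L ≅ L') : boxC K L ≅ boxC K' L' where
  hom := boxMapC e.hom e'.hom
  inv := boxMapC e.inv e'.inv
  hom_inv_id := by rw [← boxMapC_comp, e.hom_inv_id, e'.hom_inv_id, boxMapC_id]
  inv_hom_id := by rw [← boxMapC_comp, e.inv_hom_id, e'.inv_hom_id, boxMapC_id]

lemma boxMapC_exchange (f : K ⟶ K') (g : L ⟶ L') :
    boxMapC f (𝟙 L) ≫ boxMapC (𝟙 K') g = boxMapC (𝟙 K) g ≫ boxMapC f (𝟙 L') := by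
  rw [← boxMapC_comp, ← boxMapC_comp, Category.comp_id, Category.id_comp, Category.comp_id,
    Category.id_comp]

lemma boxMapC_zero_left (g : L ⟶ L') : boxMapC (0 : K ⟶ K') g = 0 := by
  ext1 n
  refine mapBifunctor.hom_ext fun i j h => ?_
  rw [ι_mapBifunctorMap]
  simp

lemma boxMapC_zero_right (f : K ⟶ K') : boxMapC f (0 : L ⟶ L') = 0 := by
  ext1 n
  refine mapBifunctor.hom_ext fun i j h => ?_
  rw [ι_mapBifunctorMap]
  simp

/-- Homotopic maps induce the same map on box products in the derived category. -/
lemma Q_boxMapC_congr {f f' : K ⟶ K'} (h : Homotopy f f') (g : L ⟶ L') :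
    Q.map (boxMapC f g) = Q.map (boxMapC f' g) :=
  Q_map_eq_of_homotopy _ (mapBifunctorMapHomotopy₁ h g box (.up ℤ))

end BoxMap

section Split

open HomologicalComplex

variable {T W D : CochainComplex MackeyMod ℤ} {f : T ⟶ W} {g : W ⟶ D} (w : f ≫ g = 0)
  (r : ∀ i, W.X i ⟶ T.X i) (s : ∀ i, D.X i ⟶ W.X i) (fr : ∀ i, f.f i ≫ r i = 𝟙 (T.X i))
  (sg : ∀ i, s i ≫ g.f i = 𝟙 (D.X i)) (id : ∀ i, r i ≫ f.f i + g.f i ≫ s i = 𝟙 (W.X i))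

/-- Taking box products preserves degreewise split sequences. -/
noncomputable def boxSplitting₁ (L : CochainComplex MackeyMod ℤ) (n : ℤ) :
    ((ShortComplex.mk (boxMapC f (𝟙 L)) (boxMapC g (𝟙 L))
      (by rw [← boxMapC_comp, w, boxMapC_zero_left])).map
        (HomologicalComplex.eval MackeyMod (ComplexShape.up ℤ) n)).Splitting :=
  have one : ∀ i, 𝟙 (L.X i) ≫ 𝟙 (L.X i) = 𝟙 (L.X i) := fun i => Category.comp_id _
  { r := boxGr (K := W) (K' := T) r (fun i => 𝟙 (L.X i)) n
    s := boxGr (K := D) (K' := W) s (fun i => 𝟙 (L.X i)) n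
    f_r := by
      change (boxMapC f (𝟙 L)).f n ≫ _ = 𝟙 ((boxC T L).X n)
      rw [boxMapC_f, boxGr_comp]
      exact (boxGr_congr fr one n).trans (boxGr_id n)
    s_g := by
      change _ ≫ (boxMapC g (𝟙 L)).f n = 𝟙 ((boxC D L).X n)
      rw [boxMapC_f, boxGr_comp]
      exact (boxGr_congr sg one n).trans (boxGr_id n)
    id := by
      change boxGr (K := W) (K' := T) r (fun i => 𝟙 (L.X i)) n ≫
        (boxMapC f (𝟙 L)).f n + (boxMapC g (𝟙 L)).f n ≫
          boxGr (K := D) (K' := W) s (fun i => 𝟙 (L.X i)) n = 𝟙 ((boxC W L).X n)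
      rw [boxMapC_f, boxMapC_f, boxGr_comp, boxGr_comp]
      exact (congrArg₂ (· + ·) (boxGr_congr (fun _ => rfl) one n)
        (boxGr_congr (fun _ => rfl) one n)).trans ((boxGr_add_left _ _ _ n).symm.trans
          ((boxGr_congr id (fun _ => rfl) n).trans (boxGr_id n))) }

/-- Taking box products preserves degreewise split sequences. -/
noncomputable def boxSplitting₂ (K : CochainComplex MackeyMod ℤ) (n : ℤ) :
    ((ShortComplex.mk (boxMapC (𝟙 K) f) (boxMapC (𝟙 K) g)
      (by rw [← boxMapC_comp, w, boxMapC_zero_right])).map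
        (HomologicalComplex.eval MackeyMod (ComplexShape.up ℤ) n)).Splitting :=
  have one : ∀ i, 𝟙 (K.X i) ≫ 𝟙 (K.X i) = 𝟙 (K.X i) := fun i => Category.comp_id _
  { r := boxGr (L := W) (L' := T) (fun i => 𝟙 (K.X i)) r n
    s := boxGr (L := D) (L' := W) (fun i => 𝟙 (K.X i)) s n
    f_r := by
      change (boxMapC (𝟙 K) f).f n ≫ _ = 𝟙 ((boxC K T).X n)
      rw [boxMapC_f, boxGr_comp]
      exact (boxGr_congr one fr n).trans (boxGr_id n)
    s_g := by
      change _ ≫ (boxMapC (𝟙 K) g).f n = 𝟙 ((boxC K D).X n)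
      rw [boxMapC_f, boxGr_comp]
      exact (boxGr_congr one sg n).trans (boxGr_id n)
    id := by
      change boxGr (L := W) (L' := T) (fun i => 𝟙 (K.X i)) r n ≫
        (boxMapC (𝟙 K) f).f n + (boxMapC (𝟙 K) g).f n ≫
          boxGr (L := D) (L' := W) (fun i => 𝟙 (K.X i)) s n = 𝟙 ((boxC K W).X n)
      rw [boxMapC_f, boxMapC_f, boxGr_comp, boxGr_comp]
      exact (congrArg₂ (· + ·) (boxGr_congr one (fun _ => rfl) n)
        (boxGr_congr one (fun _ => rfl) n)).trans ((boxGr_add_right _ _ _ n).symm.trans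
          ((boxGr_congr (fun _ => rfl) id n).trans (boxGr_id n))) }

end Split

namespace Word.Ext

variable {T W Hd : Word} (h : Ext T W Hd) (L : CochainComplex MackeyMod ℤ)

lemma exists_box_triangle₁ : ∃ δ : Q.obj (boxC Hd.cx L) ⟶ (Q.obj (boxC T.cx L))⟦(1 : ℤ)⟧,
    Triangle.mk (Q.map (boxMapC (Word.thr h.compat₁) (𝟙 L)))
      (Q.map (boxMapC (Word.thr h.compat₂) (𝟙 L))) δ ∈ distTriang (DerivedCategory MackeyMod) :=
  ⟨_, triangleOfSES_distinguished (HomologicalComplex.shortExact_of_degreewise_shortExact _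
    fun n => (boxSplitting₁ (T := T.cx) (W := W.cx) (D := Hd.cx) h.thr_thr
      (fun i => (h.splitting i).r)
      (fun i => (h.splitting i).s) (fun i => (h.splitting i).f_r) (fun i => (h.splitting i).s_g)
      (fun i => (h.splitting i).id) L n).shortExact)⟩

lemma exists_box_triangle₂ (K : CochainComplex MackeyMod ℤ) :
    ∃ δ : Q.obj (boxC K Hd.cx) ⟶ (Q.obj (boxC K T.cx))⟦(1 : ℤ)⟧,
    Triangle.mk (Q.map (boxMapC (𝟙 K) (Word.thr h.compat₁)))
      (Q.map (boxMapC (𝟙 K) (Word.thr h.compat₂))) δ ∈ distTriang (DerivedCategory MackeyMod) :=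
  ⟨_, triangleOfSES_distinguished (HomologicalComplex.shortExact_of_degreewise_shortExact _
    fun n => (boxSplitting₂ (T := T.cx) (W := W.cx) (D := Hd.cx) h.thr_thr
      (fun i => (h.splitting i).r)
      (fun i => (h.splitting i).s) (fun i => (h.splitting i).f_r) (fun i => (h.splitting i).s_g)
      (fun i => (h.splitting i).id) K n).shortExact)⟩

end Word.Ext

/-! ### Box products with complexes concentrated in degree zero -/

section Unit

open HomologicalComplex

variable (K L : CochainComplex MackeyMod ℤ)

lemma ι_zero_left_d (hK : K.d 0 1 = 0) (n m : ℤ) (hnm : (ComplexShape.up ℤ).Rel n m) :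
    ιMapBifunctor K L box (.up ℤ) 0 n n (zero_add n) ≫ (boxC K L).d n m =
      (box.obj (K.X 0)).map (L.d n m) ≫ ιMapBifunctor K L box (.up ℤ) 0 m m (zero_add m) := by
  rw [mapBifunctor.d_eq, Preadditive.comp_add, mapBifunctor.ι_D₁, mapBifunctor.ι_D₂,
    mapBifunctor.d₁_eq' _ _ _ _ (show (ComplexShape.up ℤ).Rel 0 1 from rfl),
    mapBifunctor.d₂_eq _ _ _ _ _ hnm _ (zero_add m), hK, Functor.map_zero]
  have : ComplexShape.ε₂ (.up ℤ) (.up ℤ) (.up ℤ) ((0 : ℤ), n) = 1 := Int.negOnePow_zero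
  rw [this, one_smul, zero_app, zero_comp, smul_zero, zero_add]

lemma ι_zero_right_d (hL : L.d 0 1 = 0) (n m : ℤ) (hnm : (ComplexShape.up ℤ).Rel n m) :
    ιMapBifunctor K L box (.up ℤ) n 0 n (add_zero n) ≫ (boxC K L).d n m =
      (box.map (K.d n m)).app (L.X 0) ≫ ιMapBifunctor K L box (.up ℤ) m 0 m (add_zero m) := by
  rw [mapBifunctor.d_eq, Preadditive.comp_add, mapBifunctor.ι_D₁, mapBifunctor.ι_D₂,
    mapBifunctor.d₂_eq' _ _ _ _ _ (show (ComplexShape.up ℤ).Rel 0 1 from rfl),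
    mapBifunctor.d₁_eq _ _ _ _ hnm _ _ (add_zero m), hL, Functor.map_zero]
  have : ComplexShape.ε₁ (.up ℤ) (.up ℤ) (.up ℤ) (n, (0 : ℤ)) = 1 := rfl
  rw [this, one_smul, zero_comp, smul_zero, add_zero]

lemma isIso_ι_zero_left (hK : ∀ i, i ≠ 0 → IsZero (K.X i)) (n : ℤ) :
    IsIso (ιMapBifunctor K L box (.up ℤ) 0 n n (zero_add n)) := by
  refine ⟨mapBifunctorDesc fun i j hij => if hi : i = 0 then
    (by
      have hj : j = n := by
        have : i + j = n := hij
        omega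
      subst hi hj; exact 𝟙 _) else 0, ?_, ?_⟩
  · rw [ι_mapBifunctorDesc]
    rfl
  · refine mapBifunctor.hom_ext fun i j hij => ?_
    rw [ι_mapBifunctorDesc_assoc, Category.comp_id]
    by_cases hi : i = 0
    · subst hi
      obtain rfl : j = n := by
        have : 0 + j = n := hij
        omega
      exact Category.id_comp _
    · exact ((box.flip.obj (L.X j)).map_isZero (hK i hi)).eq_of_src _ _

lemma isIso_ι_zero_right (hL : ∀ i, i ≠ 0 → IsZero (L.X i)) (n : ℤ) :
    IsIso (ιMapBifunctor K L box (.up ℤ) n 0 n (add_zero n)) := by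
  refine ⟨mapBifunctorDesc fun i j hij => if hj : j = 0 then
    (by
      have hi : i = n := by
        have : i + j = n := hij
        omega
      subst hi hj; exact 𝟙 _) else 0, ?_, ?_⟩
  · rw [ι_mapBifunctorDesc]
    rfl
  · refine mapBifunctor.hom_ext fun i j hij => ?_
    rw [ι_mapBifunctorDesc_assoc, Category.comp_id]
    by_cases hj : j = 0
    · subst hj
      obtain rfl : i = n := by
        have : i + 0 = n := hij
        omega
      exact Category.id_comp _
    · exact ((box.obj (K.X i)).map_isZero (hL j hj)).eq_of_src _ _

/-- The comparison map `c □ L ⟶ (c in degree 0) □ L`. -/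
noncomputable def boxPtLeft (c : Cell) :
    ((box.obj c.obj).mapHomologicalComplex (.up ℤ)).obj L ⟶ boxC (pt c).cx L where
  f n := ιMapBifunctor (pt c).cx L box (.up ℤ) 0 n n (zero_add n)
  comm' n m hnm := ι_zero_left_d (pt c).cx L (pt_d _ _ _) n m hnm

/-- The comparison map `K □ c ⟶ K □ (c in degree 0)`. -/
noncomputable def boxPtRight (c : Cell) :
    ((box.flip.obj c.obj).mapHomologicalComplex (.up ℤ)).obj K ⟶ boxC K (pt c).cx where
  f n := ιMapBifunctor K (pt c).cx box (.up ℤ) n 0 n (add_zero n)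
  comm' n m hnm := ι_zero_right_d K (pt c).cx (pt_d _ _ _) n m hnm

instance (c : Cell) : IsIso (boxPtLeft L c) := by
  have (n : ℤ) : IsIso ((boxPtLeft L c).f n) :=
    isIso_ι_zero_left (pt c).cx L (fun i hi => isZero_pt_X c hi) n
  exact HomologicalComplex.Hom.isIso_of_components _

instance (c : Cell) : IsIso (boxPtRight K c) := by
  have (n : ℤ) : IsIso ((boxPtRight K c).f n) :=
    isIso_ι_zero_right K (pt c).cx (fun i hi => isZero_pt_X c hi) n
  exact HomologicalComplex.Hom.isIso_of_components _

variable {K L}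

lemma ι_naturality_right (K : CochainComplex MackeyMod ℤ) {L' : CochainComplex MackeyMod ℤ}
    (g : L ⟶ L') (n : ℤ) :
    ιMapBifunctor K L box (.up ℤ) 0 n n (zero_add n) ≫ (boxMapC (𝟙 K) g).f n =
      (box.obj (K.X 0)).map (g.f n) ≫ ιMapBifunctor K L' box (.up ℤ) 0 n n (zero_add n) := by
  rw [ι_mapBifunctorMap, id_f, CategoryTheory.Functor.map_id, NatTrans.id_app, Category.id_comp]

lemma ι_naturality_left (L : CochainComplex MackeyMod ℤ) {K' : CochainComplex MackeyMod ℤ}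
    (f : K ⟶ K') (n : ℤ) :
    ιMapBifunctor K L box (.up ℤ) n 0 n (add_zero n) ≫ (boxMapC f (𝟙 L)).f n =
      (box.map (f.f n)).app (L.X 0) ≫ ιMapBifunctor K' L box (.up ℤ) n 0 n (add_zero n) := by
  rw [ι_mapBifunctorMap, id_f, CategoryTheory.Functor.map_id, Category.id_comp]

lemma boxPtLeft_naturality (c : Cell) {L' : CochainComplex MackeyMod ℤ} (g : L ⟶ L') :
    boxPtLeft L c ≫ boxMapC (𝟙 _) g =
      ((box.obj c.obj).mapHomologicalComplex (.up ℤ)).map g ≫ boxPtLeft L' c := by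
  ext1 n
  exact ι_naturality_right (pt c).cx g n

lemma boxPtRight_naturality (c : Cell) {K' : CochainComplex MackeyMod ℤ} (f : K ⟶ K') :
    boxPtRight K c ≫ boxMapC f (𝟙 _) =
      ((box.flip.obj c.obj).mapHomologicalComplex (.up ℤ)).map f ≫ boxPtRight K' c := by
  ext1 n
  exact ι_naturality_left (pt c).cx f n

end Unit

/-! ### Box products of modules with `H` and with `F` -/

section BoxCells

open TensorProduct

variable {M N P : MackeyMod}

/-- The universal property of the box product: a map `M □ N ⟶ P` is a pair of bilinear maps
`M_Θ × N_Θ → P_Θ` and `M_• × N_• → P_•` compatible with `t`, `p_*` and `p^*`. -/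
noncomputable def boxDesc (a : M.top ⊗[ZMod 2] N.top →ₗ[ZMod 2] P.top)
    (b : M.bot ⊗[ZMod 2] N.bot →ₗ[ZMod 2] P.bot)
    (ht : ∀ m n, a (M.t.hom m ⊗ₜ N.t.hom n) = P.t.hom (a (m ⊗ₜ n)))
    (h₁ : ∀ m n, P.tr.hom (a (M.res.hom m ⊗ₜ n)) = b (m ⊗ₜ N.tr.hom n))
    (h₂ : ∀ m n, P.tr.hom (a (m ⊗ₜ N.res.hom n)) = b (M.tr.hom m ⊗ₜ n))
    (h₃ : ∀ m n, a (M.res.hom m ⊗ₜ N.res.hom n) = P.res.hom (b (m ⊗ₜ n))) : boxObj M N ⟶ P where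
  top := ModuleCat.ofHom a
  bot := ModuleCat.ofHom ((boxRel M N).liftQ (b.coprod (P.tr.hom ∘ₗ a)) (by
    refine Submodule.span_le.mpr ?_
    rintro z ((⟨m, n, rfl⟩ | ⟨m, n, rfl⟩) | ⟨m, n, rfl⟩)
    · simp [h₁]
    · simp [h₂]
    · simp [ht, t_tr_apply]))
  t_comm := ModuleCat.hom_ext (TensorProduct.ext' ht)
  tr_comm := ModuleCat.hom_ext (TensorProduct.ext' fun m n =>
    (congrArg (· + P.tr.hom (a (m ⊗ₜ n))) (map_zero b)).trans (zero_add _))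
  res_comm := by
    refine ModuleCat.hom_ext (Submodule.linearMap_qext _ (LinearMap.prod_ext ?_ ?_))
    · refine TensorProduct.ext' fun m n => ?_
      change a (boxResPre M N (m ⊗ₜ n, 0)) = P.res.hom (b (m ⊗ₜ n) + P.tr.hom (a 0))
      simp [boxResPre, h₃]
    · refine TensorProduct.ext' fun m n => ?_
      change a (boxResPre M N (0, m ⊗ₜ n)) = P.res.hom (b 0 + P.tr.hom (a (m ⊗ₜ n)))
      simp [boxResPre, boxT, ht, tr_res_apply]

lemma boxDesc_bot {a : M.top ⊗[ZMod 2] N.top →ₗ[ZMod 2] P.top}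
    {b : M.bot ⊗[ZMod 2] N.bot →ₗ[ZMod 2] P.bot} {ht h₁ h₂ h₃} (x : M.bot ⊗[ZMod 2] N.bot) :
    (boxDesc a b ht h₁ h₂ h₃).bot.hom ((boxRel M N).mkQ (x, 0)) = b x := by
  change b x + P.tr.hom (a 0) = b x
  simp

lemma mkQ_res_left (m : M.bot) (n : N.top) :
    (boxRel M N).mkQ (0, M.res.hom m ⊗ₜ n) = (boxRel M N).mkQ (m ⊗ₜ N.tr.hom n, 0) :=
  (Submodule.Quotient.eq (boxRel M N)).mpr (Submodule.subset_span (Or.inl (Or.inl ⟨m, n, rfl⟩)))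

lemma mkQ_res_right (m : M.top) (n : N.bot) :
    (boxRel M N).mkQ (0, m ⊗ₜ N.res.hom n) = (boxRel M N).mkQ (M.tr.hom m ⊗ₜ n, 0) :=
  (Submodule.Quotient.eq (boxRel M N)).mpr (Submodule.subset_span (Or.inl (Or.inr ⟨m, n, rfl⟩)))

section Linear

variable {V : Type} [AddCommGroup V] [Module (ZMod 2) V]

lemma one_tmul_smul (c : ZMod 2) (m : V) : (1 : ZMod 2) ⊗ₜ[ZMod 2] (c • m) = c ⊗ₜ m := by
  rw [← TensorProduct.smul_tmul, smul_eq_mul, mul_one]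

lemma smul_tmul_one (c : ZMod 2) (m : V) : (c • m) ⊗ₜ[ZMod 2] (1 : ZMod 2) = m ⊗ₜ c := by
  rw [TensorProduct.smul_tmul, smul_eq_mul, mul_one]

/-- The map `V ⊗ 𝔽₂² ⟶ V²`, `m ⊗ (c, c') ↦ (c m, c' t m)`. -/
noncomputable def tensorPair (t : V →ₗ[ZMod 2] V) :
    V ⊗[ZMod 2] (ZMod 2 × ZMod 2) →ₗ[ZMod 2] V × V :=
  ((TensorProduct.rid (ZMod 2) V).toLinearMap ∘ₗ LinearMap.lTensor V (LinearMap.fst _ _ _)).prod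
    (t ∘ₗ (TensorProduct.rid (ZMod 2) V).toLinearMap ∘ₗ
      LinearMap.lTensor V (LinearMap.snd _ _ _))

/-- The map `V² ⟶ V ⊗ 𝔽₂²`, `(m, m') ↦ m ⊗ (1, 0) + t m' ⊗ (0, 1)`. -/
noncomputable def pairTensor (t : V →ₗ[ZMod 2] V) :
    V × V →ₗ[ZMod 2] V ⊗[ZMod 2] (ZMod 2 × ZMod 2) :=
  ((TensorProduct.mk (ZMod 2) V (ZMod 2 × ZMod 2)).flip (1, 0)).coprod
    ((TensorProduct.mk (ZMod 2) V (ZMod 2 × ZMod 2)).flip (0, 1) ∘ₗ t)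

lemma pairTensor_apply (t : V →ₗ[ZMod 2] V) (m m' : V) :
    pairTensor t (m, m') = m ⊗ₜ (1, 0) + t m' ⊗ₜ (0, 1) := rfl

lemma pairTensor_tensorPair {t : V →ₗ[ZMod 2] V} (h : ∀ m, t (t m) = m) (m : V)
    (c : ZMod 2 × ZMod 2) : pairTensor t (tensorPair t (m ⊗ₜ c)) = m ⊗ₜ c := by
  change (c.1 • m) ⊗ₜ[ZMod 2] ((1, 0) : ZMod 2 × ZMod 2) +
    t (t (c.2 • m)) ⊗ₜ[ZMod 2] ((0, 1) : ZMod 2 × ZMod 2) = m ⊗ₜ[ZMod 2] c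
  rw [h, TensorProduct.smul_tmul, TensorProduct.smul_tmul, ← TensorProduct.tmul_add]
  simp

lemma tensorPair_pairTensor {t : V →ₗ[ZMod 2] V} (h : ∀ m, t (t m) = m) (m m' : V) :
    tensorPair t (pairTensor t (m, m')) = (m, m') := by
  rw [pairTensor_apply, map_add]
  change (((1 : ZMod 2) • m, t ((0 : ZMod 2) • m)) : V × V) +
    ((0 : ZMod 2) • t m', t ((1 : ZMod 2) • t m')) = (m, m')
  simp [h]

end Linear

/-- `M ⟶ H □ M`, `m ↦ 1 ⊗ m`. -/
noncomputable def toHBox (M : MackeyMod) : M ⟶ boxObj H M where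
  top := ModuleCat.ofHom (TensorProduct.mk (ZMod 2) (ZMod 2) M.top 1)
  bot := ModuleCat.ofHom ((boxRel H M).mkQ ∘ₗ LinearMap.inl (ZMod 2) _ _ ∘ₗ
    TensorProduct.mk (ZMod 2) (ZMod 2) M.bot 1)
  t_comm := rfl
  tr_comm := by
    ext m
    exact (mkQ_res_left (M := H) (1 : ZMod 2) m).symm
  res_comm := by
    ext m
    change _ = boxRes H M ((boxRel H M).mkQ (_, 0))
    simp [boxRes, boxResPre]
    rfl

/-- `H □ M ⟶ M`, `c ⊗ m ↦ c m`. -/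
noncomputable def ofHBox (M : MackeyMod) : boxObj H M ⟶ M :=
  boxDesc (TensorProduct.lid (ZMod 2) M.top).toLinearMap
    (TensorProduct.lid (ZMod 2) M.bot).toLinearMap
    (fun (c : ZMod 2) m => (map_smul M.t.hom c m).symm)
    (fun (c : ZMod 2) m => map_smul M.tr.hom c m)
    (fun (c : ZMod 2) m => (congrArg M.tr.hom (map_smul M.res.hom c m).symm).trans
      ((res_tr_apply _ _).trans (zero_smul (ZMod 2) m).symm))
    (fun (c : ZMod 2) m => (map_smul M.res.hom c m).symm)

lemma ofHBox_bot (M : MackeyMod) (c : ZMod 2) (m : M.bot) :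
    (ofHBox M).bot.hom ((boxRel H M).mkQ (c ⊗ₜ m, 0)) = c • m := boxDesc_bot _

/-- The isomorphism `H □ M ≅ M`. -/
noncomputable def hBoxIso (M : MackeyMod) : boxObj H M ≅ M where
  hom := ofHBox M
  inv := toHBox M
  hom_inv_id := box_hom_ext
    (fun (c : ZMod 2) m => one_tmul_smul c m)
    (fun (c : ZMod 2) m => (congrArg (toHBox M).bot.hom (ofHBox_bot M c m)).trans
      (congrArg (fun z => (boxRel H M).mkQ (z, 0)) (one_tmul_smul c m)))
  inv_hom_id := by
    ext m
    · exact one_smul _ m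
    · exact (ofHBox_bot M 1 m).trans (one_smul _ m)

/-- The natural isomorphism `H □ M ≅ M`. -/
noncomputable def hBoxNatIso : box.obj H ≅ 𝟭 MackeyMod :=
  NatIso.ofComponents hBoxIso fun {M N} f => box_hom_ext
    (fun (c : ZMod 2) m => (map_smul f.top.hom c m).symm)
    (fun (c : ZMod 2) m => (ofHBox_bot N c (f.bot.hom m)).trans
      ((map_smul f.bot.hom c m).symm.trans (congrArg f.bot.hom (ofHBox_bot M c m)).symm))

/-- `M ⟶ M □ H`, `m ↦ m ⊗ 1`. -/
noncomputable def toBoxH (M : MackeyMod) : M ⟶ boxObj M H where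
  top := ModuleCat.ofHom ((TensorProduct.mk (ZMod 2) M.top (ZMod 2)).flip 1)
  bot := ModuleCat.ofHom ((boxRel M H).mkQ ∘ₗ LinearMap.inl (ZMod 2) _ _ ∘ₗ
    (TensorProduct.mk (ZMod 2) M.bot (ZMod 2)).flip 1)
  t_comm := rfl
  tr_comm := by
    ext m
    exact (mkQ_res_right (N := H) m (1 : ZMod 2)).symm
  res_comm := by
    ext m
    change _ = boxRes M H ((boxRel M H).mkQ (_, 0))
    simp [boxRes, boxResPre]
    rfl

/-- `M □ H ⟶ M`, `m ⊗ c ↦ c m`. -/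
noncomputable def ofBoxH (M : MackeyMod) : boxObj M H ⟶ M :=
  boxDesc (TensorProduct.rid (ZMod 2) M.top).toLinearMap
    (TensorProduct.rid (ZMod 2) M.bot).toLinearMap
    (fun m (c : ZMod 2) => (map_smul M.t.hom c m).symm)
    (fun m (c : ZMod 2) => (congrArg M.tr.hom (map_smul M.res.hom c m).symm).trans
      ((res_tr_apply _ _).trans (zero_smul (ZMod 2) m).symm))
    (fun m (c : ZMod 2) => map_smul M.tr.hom c m)
    (fun m (c : ZMod 2) => (map_smul M.res.hom c m).symm)

lemma ofBoxH_bot (M : MackeyMod) (c : ZMod 2) (m : M.bot) :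
    (ofBoxH M).bot.hom ((boxRel M H).mkQ (m ⊗ₜ c, 0)) = c • m := boxDesc_bot _

/-- The isomorphism `M □ H ≅ M`. -/
noncomputable def boxHIso (M : MackeyMod) : boxObj M H ≅ M where
  hom := ofBoxH M
  inv := toBoxH M
  hom_inv_id := box_hom_ext
    (fun m (c : ZMod 2) => smul_tmul_one c m)
    (fun m (c : ZMod 2) => (congrArg (toBoxH M).bot.hom (ofBoxH_bot M c m)).trans
      (congrArg (fun z => (boxRel M H).mkQ (z, 0)) (smul_tmul_one c m)))
  inv_hom_id := by
    ext m
    · exact one_smul _ m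
    · exact (ofBoxH_bot M 1 m).trans (one_smul _ m)

/-- The natural isomorphism `M □ H ≅ M`. -/
noncomputable def boxHNatIso : box.flip.obj H ≅ 𝟭 MackeyMod :=
  NatIso.ofComponents boxHIso fun {M N} f => box_hom_ext
    (fun m (c : ZMod 2) => (map_smul f.top.hom c m).symm)
    (fun m (c : ZMod 2) => (ofBoxH_bot N c (f.bot.hom m)).trans
      ((map_smul f.bot.hom c m).symm.trans (congrArg f.bot.hom (ofBoxH_bot M c m)).symm))

/-- The induced module of a vector space `V`: two copies of `V` interchanged by `t`. -/
noncomputable def ind : ModuleCat.{0} (ZMod 2) ⥤ MackeyMod where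
  obj V :=
    { top := ModuleCat.of (ZMod 2) (V × V)
      bot := V
      t := ModuleCat.ofHom ((LinearMap.snd _ _ _).prod (LinearMap.fst _ _ _))
      tr := ModuleCat.ofHom (LinearMap.fst _ _ _ + LinearMap.snd _ _ _)
      res := ModuleCat.ofHom (LinearMap.id.prod LinearMap.id)
      res_t := rfl
      t_tr := by ext <;> simp
      t_t := rfl
      tr_res := by ext <;> simp
      res_tr := by
        ext v
        exact (two_smul (ZMod 2) v).symm.trans (zero_smul (ZMod 2) v) }
  map f :=
    { top := ModuleCat.ofHom (f.hom.prodMap f.hom)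
      bot := f
      t_comm := rfl
      tr_comm := by
        ext v
        · exact (map_add f.hom _ _)
        · exact (map_add f.hom _ _)
      res_comm := rfl }

instance : ind.Additive where

/-- The map `Ind(M_Θ) ⟶ M □ F` with `(m, m') ↦ m ⊗ g + t m' ⊗ t g`. -/
noncomputable def toBoxF (M : MackeyMod) : ind.obj M.top ⟶ boxObj M F where
  top := ModuleCat.ofHom (pairTensor M.t.hom)
  bot := ModuleCat.ofHom (boxTr M F ∘ₗ
    (TensorProduct.mk (ZMod 2) M.top (ZMod 2 × ZMod 2)).flip (1, 0))
  t_comm := by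
    refine ModuleCat.hom_ext (LinearMap.ext fun ⟨m, m'⟩ => ?_)
    change m' ⊗ₜ[ZMod 2] ((1, 0) : ZMod 2 × ZMod 2) + M.t.hom m ⊗ₜ ((0, 1) : ZMod 2 × ZMod 2) =
      boxT M F (pairTensor M.t.hom (m, m'))
    rw [pairTensor_apply, add_comm (m ⊗ₜ[ZMod 2] ((1, 0) : ZMod 2 × ZMod 2))]
    refine Eq.trans ?_ (map_add (boxT M F) _ _).symm
    change _ = M.t.hom (M.t.hom m') ⊗ₜ[ZMod 2] ((1, 0) : ZMod 2 × ZMod 2) +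
      M.t.hom m ⊗ₜ[ZMod 2] ((0, 1) : ZMod 2 × ZMod 2)
    rw [t_t_apply]
    rfl
  tr_comm := by
    refine ModuleCat.hom_ext (LinearMap.ext fun ⟨m, m'⟩ => ?_)
    change boxTr M F ((m + m' : M.top) ⊗ₜ ((1, 0) : ZMod 2 × ZMod 2)) =
      boxTr M F (pairTensor M.t.hom (m, m'))
    rw [pairTensor_apply]
    refine (congrArg (boxTr M F) (TensorProduct.add_tmul m m' _)).trans ?_
    refine (map_add (boxTr M F) _ _).trans (Eq.trans ?_ (map_add (boxTr M F) _ _).symm)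
    exact congrArg (_ + ·) (LinearMap.congr_fun (boxT_tr M F)
      (m' ⊗ₜ ((1, 0) : ZMod 2 × ZMod 2))).symm
  res_comm := by
    refine ModuleCat.hom_ext (LinearMap.ext fun m => ?_)
    exact (LinearMap.congr_fun (boxTr_res M F) (m ⊗ₜ ((1, 0) : ZMod 2 × ZMod 2))).symm

/-- `M □ F ⟶ Ind(M_Θ)`, `m ⊗ (c g + c' t g) ↦ (c m, c' t m)`. -/
noncomputable def ofBoxF (M : MackeyMod) : boxObj M F ⟶ ind.obj M.top :=
  boxDesc (P := ind.obj M.top) (tensorPair M.t.hom)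
    (M.res.hom ∘ₗ (TensorProduct.rid (ZMod 2) M.bot).toLinearMap)
    (fun m (c : ZMod 2 × ZMod 2) => by
      change (c.2 • M.t.hom m, M.t.hom (c.1 • M.t.hom m)) = (M.t.hom (c.2 • m), c.1 • m)
      rw [map_smul, t_t_apply, map_smul])
    (fun m (c : ZMod 2 × ZMod 2) => by
      change c.1 • M.res.hom m + M.t.hom (c.2 • M.res.hom m) = M.res.hom ((c.1 + c.2) • m)
      rw [map_smul, res_t_apply, map_smul, add_smul])
    (fun m (c : ZMod 2) => by
      change c • m + M.t.hom (c • m) = M.res.hom (c • M.tr.hom m)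
      rw [map_smul, map_smul, tr_res_apply, smul_add])
    (fun m (c : ZMod 2) => by
      change (c • M.res.hom m, M.t.hom (c • M.res.hom m)) =
        (M.res.hom (c • m), M.res.hom (c • m))
      rw [map_smul, res_t_apply, map_smul])

lemma ofBoxF_bot (M : MackeyMod) (c : ZMod 2) (m : M.bot) :
    (ofBoxF M).bot.hom ((boxRel M F).mkQ (m ⊗ₜ c, 0)) = M.res.hom (c • m) := boxDesc_bot _

lemma ofBoxF_tr (M : MackeyMod) (c : ZMod 2 × ZMod 2) (m : M.top) :
    (ofBoxF M).bot.hom (boxTr M F (m ⊗ₜ c)) = c.1 • m + M.t.hom (c.2 • m) :=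
  (tr_apply (ofBoxF M) (m ⊗ₜ c)).symm

/-- The isomorphism `M □ F ≅ Ind(M_Θ)`. -/
noncomputable def boxFIso (M : MackeyMod) : boxObj M F ≅ ind.obj M.top where
  hom := ofBoxF M
  inv := toBoxF M
  hom_inv_id := box_hom_ext
    (fun m (c : ZMod 2 × ZMod 2) => pairTensor_tensorPair M.t_t_apply m c)
    (fun m (c : ZMod 2) => (congrArg (toBoxF M).bot.hom (ofBoxF_bot M c m)).trans
      ((mkQ_res_left (N := F) (c • m) ((1, 0) : ZMod 2 × ZMod 2)).trans
        (congrArg (fun z => (boxRel M F).mkQ (z, 0)) (by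
          refine Eq.trans ?_ (smul_tmul_one c m)
          exact congrArg ((c • m) ⊗ₜ[ZMod 2] ·) (add_zero (1 : ZMod 2))))))
  inv_hom_id := by
    refine hom_ext (ModuleCat.hom_ext (LinearMap.ext fun ⟨m, m'⟩ => ?_))
      (ModuleCat.hom_ext (LinearMap.ext fun (m : M.top) => ?_))
    · exact tensorPair_pairTensor M.t_t_apply m m'
    · refine (ofBoxF_tr M (1, 0) m).trans ?_
      change (1 : ZMod 2) • m + M.t.hom ((0 : ZMod 2) • m) = m
      rw [one_smul, zero_smul, map_zero, add_zero]

/-- The natural isomorphism `M □ F ≅ Ind(M_Θ)`. -/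
noncomputable def boxFNatIso : box.flip.obj F ≅ evTop ⋙ ind :=
  NatIso.ofComponents boxFIso fun {M N} f => box_hom_ext
    (fun m (c : ZMod 2 × ZMod 2) => by
      change (c.1 • f.top.hom m, N.t.hom (c.2 • f.top.hom m)) =
        (f.top.hom (c.1 • m), f.top.hom (M.t.hom (c.2 • m)))
      rw [← t_apply f, map_smul f.top.hom, map_smul f.top.hom])
    (fun m (c : ZMod 2) => (ofBoxF_bot N c (f.bot.hom m)).trans
      (((congrArg N.res.hom (map_smul f.bot.hom c m).symm).trans (res_apply f (c • m))).trans
        (congrArg f.top.hom (ofBoxF_bot M c m)).symm))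

end BoxCells

/-! ### Box products of complexes with `H` and with `F` -/

section

variable (K L : CochainComplex MackeyMod ℤ)

instance : (𝟭 MackeyMod).Additive where

/-- The comparison map `boxPtLeft` as an isomorphism. -/
noncomputable def boxPtLeftIso (c : Cell) :
    ((box.obj c.obj).mapHomologicalComplex (.up ℤ)).obj L ≅ boxC (pt c).cx L :=
  asIso (boxPtLeft L c)

/-- The comparison map `boxPtRight` as an isomorphism. -/
noncomputable def boxPtRightIso (c : Cell) :
    ((box.flip.obj c.obj).mapHomologicalComplex (.up ℤ)).obj K ≅ boxC K (pt c).cx :=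
  asIso (boxPtRight K c)

/-- The natural isomorphism `H □ L ≅ L` of complexes. -/
noncomputable def unitLeft : L ≅ boxC (pt .fixed).cx L :=
  (NatIso.mapHomologicalComplex hBoxNatIso (.up ℤ)).symm.app L ≪≫ boxPtLeftIso L .fixed

/-- The natural isomorphism `K □ H ≅ K` of complexes. -/
noncomputable def unitRight : K ≅ boxC K (pt .fixed).cx :=
  (NatIso.mapHomologicalComplex boxHNatIso (.up ℤ)).symm.app K ≪≫ boxPtRightIso K .fixed

/-- The natural isomorphism `K □ F ≅ Ind(K_Θ)` of complexes. -/
noncomputable def freeRight :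
    ((evTop ⋙ ind).mapHomologicalComplex (.up ℤ)).obj K ≅ boxC K (pt .free).cx :=
  (NatIso.mapHomologicalComplex boxFNatIso (.up ℤ)).symm.app K ≪≫ boxPtRightIso K .free

variable {K L}

/-- Pasting of two commutative squares. -/
lemma comp_square {C : Type*} [Category* C] {A A' B B' D D' : C} {u : A ⟶ B} {v : B ⟶ D}
    {u' : A' ⟶ B'} {v' : B' ⟶ D'} {f : A ⟶ A'} {g : B ⟶ B'} {h : D ⟶ D'} (h₁ : f ≫ u' = u ≫ g)
    (h₂ : v ≫ h = g ≫ v') : (u ≫ v) ≫ h = f ≫ u' ≫ v' := by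
  rw [Category.assoc, h₂, ← Category.assoc, ← h₁, Category.assoc]

lemma unitLeft_naturality {L' : CochainComplex MackeyMod ℤ} (g : L ⟶ L') :
    (unitLeft L).hom ≫ boxMapC (𝟙 _) g = g ≫ (unitLeft L').hom :=
  comp_square ((NatIso.mapHomologicalComplex hBoxNatIso (.up ℤ)).inv.naturality g)
    (boxPtLeft_naturality .fixed g)

lemma freeRight_naturality {K' : CochainComplex MackeyMod ℤ} (f : K ⟶ K') :
    (freeRight K).hom ≫ boxMapC f (𝟙 _) =
      ((evTop ⋙ ind).mapHomologicalComplex (.up ℤ)).map f ≫ (freeRight K').hom :=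
  comp_square ((NatIso.mapHomologicalComplex boxFNatIso (.up ℤ)).inv.naturality f)
    (boxPtRight_naturality .free f)

/-- As `H □ L ≅ L` naturally, `g` vanishes in the derived category if `H □ g` does. -/
lemma Q_boxMapC_unit_eq_zero {L' : CochainComplex MackeyMod ℤ} {g : L ⟶ L'}
    (h : Q.map (boxMapC (𝟙 (pt .fixed).cx) g) = 0) : Q.map g = 0 := by
  have e := congrArg Q.map (unitLeft_naturality g)
  rw [Q.map_comp, Q.map_comp, h, comp_zero] at e
  exact (Preadditive.IsIso.comp_right_eq_zero _ _).mp e.symm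

/-- The maps of which the contraction of `(B_0)_Θ` is made: `c ↦ (0, c)` from `H_Θ` to `F_Θ` and
`(c, c') ↦ c` from `F_Θ` to `H_Θ`. -/
noncomputable def Cell.sigma : (c c' : Cell) → (c.obj.top ⟶ c'.obj.top)
  | fixed, free => ModuleCat.ofHom (LinearMap.inr (ZMod 2) (ZMod 2) (ZMod 2))
  | free, fixed => ModuleCat.ofHom (LinearMap.fst (ZMod 2) (ZMod 2) (ZMod 2))
  | _, _ => 0

lemma sigma_fixed_free_fixed : Cell.sigma .fixed .free ≫ (Cell.d .free .fixed).top = 𝟙 _ := by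
  ext
  exact zero_add _

lemma sigma_fixed_free_fixed' : (Cell.d .fixed .free).top ≫ Cell.sigma .free .fixed = 𝟙 _ := rfl

lemma sigma_free : Cell.sigma .free .fixed ≫ (Cell.d .fixed .free).top +
    (Cell.d .free .fixed).top ≫ Cell.sigma .fixed .free = 𝟙 _ := by
  refine ModuleCat.hom_ext (LinearMap.ext fun (x : ZMod 2 × ZMod 2) => ?_)
  change (x.1, x.1) + ((0 : ZMod 2), x.1 + x.2) = x
  ext
  · exact add_zero _
  · change x.1 + (x.1 + x.2) = x.2
    rw [← add_assoc, CharTwo.add_self_eq_zero, zero_add]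

/-- The pairs of neighbours of a cell for which `sigma` is a contraction at that cell. -/
lemma sigma_contraction {x y z : Cell} (h : y = .zero ∨ (x = .zero ∧ y = .fixed ∧ z = .free) ∨
    (x = .fixed ∧ y = .free ∧ z = .fixed) ∨ (x = .free ∧ y = .fixed ∧ z = .zero)) :
    (Cell.d y z).top ≫ Cell.sigma z y + Cell.sigma y x ≫ (Cell.d x y).top = 𝟙 y.obj.top := by
  rcases h with rfl | ⟨rfl, rfl, rfl⟩ | ⟨rfl, rfl, rfl⟩ | ⟨rfl, rfl, rfl⟩
  · exact (evTop.map_isZero isZero_zero_obj).eq_of_src _ _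
  · rw [sigma_fixed_free_fixed']
    exact (congrArg (𝟙 _ + ·) zero_comp).trans (add_zero _)
  · rw [add_comm]
    exact sigma_free
  · rw [sigma_fixed_free_fixed]
    exact (congrArg (· + 𝟙 _) comp_zero).trans (zero_add _)

/-- The contracting homotopy of `(B_0)_Θ`. -/
noncomputable def sigmaB (i j : ℤ) : ((evTop.mapHomologicalComplex (.up ℤ)).obj (B 0).cx).X i ⟶
    ((evTop.mapHomologicalComplex (.up ℤ)).obj (B 0).cx).X j :=
  if j + 1 = i then Cell.sigma ((B 0).c i) ((B 0).c j) else 0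

lemma sigmaB_succ (j : ℤ) :
    sigmaB (j + 1) j = Cell.sigma ((B 0).c (j + 1)) ((B 0).c j) := if_pos rfl

/-- The complex `(B_0)_Θ`, which is the exact sequence `𝔽₂ ⟶ 𝔽₂² ⟶ 𝔽₂`, is contractible. -/
noncomputable def contractionB : Homotopy
    (𝟙 ((evTop.mapHomologicalComplex (.up ℤ)).obj (B 0).cx)) 0 where
  hom := sigmaB
  zero i j h := if_neg h
  comm i := by
    obtain ⟨j, rfl⟩ : ∃ j, i = j + 1 := ⟨i - 1, by ring⟩
    rw [dNext_eq _ (show (ComplexShape.up ℤ).Rel (j + 1) (j + 1 + 1) from rfl),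
      prevD_eq _ (show (ComplexShape.up ℤ).Rel j (j + 1) from rfl), sigmaB_succ, sigmaB_succ]
    refine (sigma_contraction (x := (B 0).c j) (y := (B 0).c (j + 1)) (z := (B 0).c (j + 1 + 1))
      ?_).symm.trans ?_
    · simp only [B]
      push_cast
      split_ifs <;> simp <;> omega
    · exact (congrArg₂ (· + ·) (congrArg (fun f => Hom.top f ≫ _) (d_eq (B 0) (j + 1)).symm)
        (congrArg (fun f => _ ≫ Hom.top f) (d_eq (B 0) j).symm)).trans (add_zero _).symm

/-- `B_0 □ F ≅ Ind((B_0)_Θ)` is acyclic. -/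
lemma isZero_B_box_free : IsZero (Q.obj (boxC (B 0).cx (pt .free).cx)) := by
  have e : Q.map (𝟙 (((evTop ⋙ ind).mapHomologicalComplex (.up ℤ)).obj (B 0).cx)) = 0 := by
    have h := Q_map_eq_of_homotopy _ (ind.mapHomotopy contractionB)
    rw [Functor.map_zero, Functor.map_zero, CategoryTheory.Functor.map_id] at h
    exact h
  rw [CategoryTheory.Functor.map_id] at e
  exact ((IsZero.iff_id_eq_zero _).mpr e).of_iso (Q.mapIso (freeRight (B 0).cx)).symm

end

/-! ### Maps to `F` -/

section MapsToF

open Cell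

lemma d_free_comp_tF (x : Cell) : d x free ≫ tF = d x free := by
  cases x
  · exact zero_comp
  · change (𝟙 F + tF) ≫ tF = 𝟙 F + tF
    rw [Preadditive.add_comp, tF_tF, Category.id_comp, add_comm]
  · exact pHF_tF

lemma d_to_free_ne_zero {x : Cell} (hx : x ≠ zero) : d x free ≠ 0 := by
  cases x
  · exact absurd rfl hx
  · exact one_add_tF_ne_zero
  · exact pHF_ne_zero

lemma eps_coboundary {u : Cell} (h : u ≠ zero) : ∃ y : u.obj ⟶ F, 𝟙 F + tF = d free u ≫ y := by
  cases u
  · exact absurd rfl h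
  · exact ⟨𝟙 F, (Category.comp_id _).symm⟩
  · exact ⟨pHF, pFH_pHF.symm⟩

lemma mapPt_eq {c : Cell} {K : CochainComplex MackeyMod ℤ} (hK : K.IsKProjective)
    {z z' : K.X 0 ⟶ c.obj} {hz : K.d (-1) 0 ≫ z = 0} {hz' : K.d (-1) 0 ≫ z' = 0}
    (y : K.X 1 ⟶ c.obj) (h : z - z' = K.d 0 1 ≫ y) :
    Q.map (mapPt z hz) = Q.map (mapPt z' hz') := by
  rw [← sub_eq_zero, ← Functor.map_sub]
  exact (Q_to_pt_eq_zero_iff hK _).mpr ⟨y, h⟩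

/-- There is at most one nonzero class of maps from a word to `F`, except when the cell in degree `0`
is an isolated `F`. -/
lemma cole_F_of {w : Word} (hw : w.Bdd) (h : w.c 0 = free → w.c 1 = zero → w.c (-1) ≠ zero) :
    GLe (Q.obj w.cx ⟶ Q.obj (pt free).cx) := by
  intro a b ha hb
  obtain ⟨z, hz, rfl⟩ := exists_cocycle (isKProjective hw) a
  obtain ⟨z', hz', rfl⟩ := exists_cocycle (isKProjective hw) b
  rw [Ne, Q_to_pt_eq_zero_iff (isKProjective hw), d_zero_one] at ha hb
  suffices ∃ y, z - z' = Cell.d (w.c 0) (w.c 1) ≫ y by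
    obtain ⟨y, hy⟩ := this
    exact mapPt_eq (isKProjective hw) y (by rw [d_zero_one]; exact hy)
  rw [d_neg_one_zero] at hz hz'
  suffices aux : ∀ (x y u : Cell) (z z' : y.obj ⟶ Cell.free.obj), (y = free → u = zero → x ≠ zero) →
      Cell.d x y ≫ z = 0 → Cell.d x y ≫ z' = 0 → (¬ ∃ y', z = Cell.d y u ≫ y') →
      (¬ ∃ y', z' = Cell.d y u ≫ y') → ∃ y', z - z' = Cell.d y u ≫ y' from
    aux _ _ _ z z' h hz hz' ha hb
  clear * -
  intro x y u z z' h hz hz' ha hb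
  cases y
  · exact ⟨0, isZero_zero_obj.eq_of_src _ _⟩
  · by_cases hu : u = zero
    · have hx := h rfl hu
      have aux : ∀ z : F ⟶ F, d x free ≫ z = 0 → (¬ ∃ y : u.obj ⟶ F, z = d free u ≫ y) →
          z = 𝟙 F + tF := by
        intro z hz ha
        rcases hom_F_F z with rfl | rfl | rfl | rfl
        · exact absurd ⟨0, comp_zero.symm⟩ ha
        · exact absurd ((Category.comp_id _).symm.trans hz) (d_to_free_ne_zero hx)
        · exact absurd ((d_free_comp_tF x).symm.trans hz) (d_to_free_ne_zero hx)
        · rfl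
      refine ⟨0, ?_⟩
      rw [aux z hz ha, aux z' hz' hb]
      exact (sub_self (𝟙 F + tF)).trans comp_zero.symm
    · obtain ⟨y, hy⟩ := eps_coboundary hu
      have aux : ∀ z : F ⟶ F, (¬ ∃ y : u.obj ⟶ F, z = d free u ≫ y) → z = 𝟙 F ∨ z = tF := by
        intro z ha
        rcases hom_F_F z with rfl | rfl | rfl | rfl
        · exact absurd ⟨0, comp_zero.symm⟩ ha
        · exact Or.inl rfl
        · exact Or.inr rfl
        · exact absurd ⟨y, hy⟩ ha
      rcases aux z ha with rfl | rfl <;> rcases aux z' hb with rfl | rfl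
      · exact ⟨0, (sub_self (𝟙 F)).trans comp_zero.symm⟩
      · exact ⟨y, (hom_sub_eq (𝟙 F) tF).trans hy⟩
      · exact ⟨y, ((hom_sub_eq tF (𝟙 F)).trans (add_comm _ _)).trans hy⟩
      · exact ⟨0, (sub_self tF).trans comp_zero.symm⟩
  · have aux : ∀ z : H ⟶ F, (¬ ∃ y : u.obj ⟶ F, z = d fixed u ≫ y) → z = pHF := by
      intro z ha
      exact (hom_H_F z).resolve_left fun e => ha ⟨0, e.trans comp_zero.symm⟩
    refine ⟨0, ?_⟩
    rw [aux z ha, aux z' hb]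
    exact (sub_self pHF).trans comp_zero.symm

/-- Two nonzero maps `H(n) ⟶ F` are equal. -/
lemma le_H_F (n : ℤ) : GLe (qH n ⟶ Fq) := cole_F_of (bdd_H n) (by
  simp only [Word.H]; split_ifs <;> simp <;> omega)

/-- Two nonzero maps `F ⟶ H(n)` are equal. -/
lemma le_F_H (n : ℤ) : GLe (Fq ⟶ qH n) := le_F_of (by
  simp only [Word.H]; split_ifs <;> simp <;> omega)

end MapsToF

/-! ### Box products of the complexes `H(n)` -/

section BoxH

/-- The box product in the derived category of two bounded complexes of projectives. -/
noncomputable abbrev bx (K L : CochainComplex MackeyMod ℤ) : DerivedCategory MackeyMod :=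
  Q.obj (boxC K L)

lemma bx_sh_left (w : Word) (a : ℤ) (L : CochainComplex MackeyMod ℤ) :
    Nonempty (bx (w.sh a).cx L ≅ (bx w.cx L)⟦a⟧) :=
  ⟨Q.mapIso (boxIso (w.shIso a) (Iso.refl L) ≪≫
    CochainComplex.mapBifunctorShift₁Iso w.cx L box a) ≪≫
      (Q.commShiftIso (C := CochainComplex MackeyMod ℤ) a).app (boxC w.cx L)⟩

lemma bx_sh_right (K : CochainComplex MackeyMod ℤ) (w : Word) (a : ℤ) :
    Nonempty (bx K (w.sh a).cx ≅ (bx K w.cx)⟦a⟧) :=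
  ⟨Q.mapIso (boxIso (Iso.refl K) (w.shIso a) ≪≫
    CochainComplex.mapBifunctorShift₂Iso K w.cx box a) ≪≫
      (Q.commShiftIso (C := CochainComplex MackeyMod ℤ) a).app (boxC K w.cx)⟩

variable {T W D : Word}

lemma Word.Ext.bx₁ (h : Ext T W D) (L : CochainComplex MackeyMod ℤ) :
    TriEx (bx T.cx L) (bx W.cx L) (bx D.cx L) := by
  obtain ⟨δ, hT⟩ := h.exists_box_triangle₁ L
  exact ⟨_, _, _, hT⟩

lemma Word.Ext.bx₂ (h : Ext T W D) (K : CochainComplex MackeyMod ℤ) :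
    TriEx (bx K T.cx) (bx K W.cx) (bx K D.cx) := by
  obtain ⟨δ, hT⟩ := h.exists_box_triangle₂ K
  exact ⟨_, _, _, hT⟩

lemma bx_unit_left (L : CochainComplex MackeyMod ℤ) :
    Nonempty (bx (Word.H 0).cx L ≅ Q.obj L) := by
  rw [pt_fixed]; exact ⟨(Q.mapIso (unitLeft L)).symm⟩

lemma bx_unit_right (K : CochainComplex MackeyMod ℤ) :
    Nonempty (bx K (Word.H 0).cx ≅ Q.obj K) := by
  rw [pt_fixed]; exact ⟨(Q.mapIso (unitRight K)).symm⟩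

lemma shift_shift_iso (X : DerivedCategory MackeyMod) {a b : ℤ} (h : a + b = 0) :
    Nonempty (X⟦a⟧⟦b⟧ ≅ X) :=
  ⟨(shiftFunctorAdd' _ a b 0 h).symm.app _ ≪≫ (shiftFunctorZero _ ℤ).app _⟩

lemma bx_sh_left_shift (w : Word) {a b : ℤ} (h : a + b = 0) (L : CochainComplex MackeyMod ℤ) :
    Nonempty ((bx (w.sh a).cx L)⟦b⟧ ≅ bx w.cx L) := by
  obtain ⟨e⟩ := bx_sh_left w a L
  obtain ⟨e'⟩ := shift_shift_iso (bx w.cx L) h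
  exact ⟨(shiftFunctor _ b).mapIso e ≪≫ e'⟩

lemma bx_sh_right_shift (K : CochainComplex MackeyMod ℤ) (w : Word) {a b : ℤ} (h : a + b = 0) :
    Nonempty ((bx K (w.sh a).cx)⟦b⟧ ≅ bx K w.cx) := by
  obtain ⟨e⟩ := bx_sh_right K w a
  obtain ⟨e'⟩ := shift_shift_iso (bx K w.cx) h
  exact ⟨(shiftFunctor _ b).mapIso e ≪≫ e'⟩

/-- The triangle of multiplication by `ρ` in the second factor. -/
lemma triEx_bx_rho (K : CochainComplex MackeyMod ℤ) (s : ℤ) :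
    TriEx (bx K (pt .free).cx) (bx K (Word.H s).cx) ((bx K (Word.H (1 + s)).cx)⟦(1 : ℤ)⟧) := by
  rw [← pt_free]
  rcases lt_or_ge s 0 with hs | hs
  · exact ((ext_rho_neg hs).bx₂ K).congr ⟨Iso.refl _⟩ ⟨Iso.refl _⟩ (bx_sh_right _ _ _)
  · exact ((ext_rho_nonneg hs).bx₂ K).rotate.rotate.congr ⟨Iso.refl _⟩
      (bx_sh_right_shift _ _ (by norm_num)) ⟨Iso.refl _⟩

lemma int_induction_iff {P : ℤ → Prop} (h₀ : P 0) (h : ∀ s, P s ↔ P (1 + s)) (s : ℤ) : P s := by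
  induction s with
  | zero => exact h₀
  | succ m ih => rw [add_comm]; exact (h _).mp ih
  | pred m ih => rw [h]; convert ih using 1; ring

lemma TriEx.van_iff₂ {X Y Z W : DerivedCategory MackeyMod} {p : ℤ} (h : TriEx X Y (Z⟦(1 : ℤ)⟧))
    (hX : ∀ p, Van W X p) : Van W Y p ↔ Van W Z (1 + p) := by
  obtain ⟨f, g, δ, hT⟩ := h
  exact (GVan.congr (postEquiv₂ hT (hX _) (hX _))).trans
    (van_tgt_iff W Z (show 1 + p = 1 + p from rfl))

lemma van_isZero {W X : DerivedCategory MackeyMod} (h : IsZero X) (p : ℤ) : Van W X p :=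
  fun _ => ((shiftFunctor _ p).map_isZero h).eq_of_tgt _ _

/-- There are no maps from `F` to suspensions of `B_0 □ H(s)`: the `ρ`-triangles reduce this to
`s = 0`, as `B_0 □ F` vanishes. -/
lemma van_F_bx_B (s p : ℤ) : Van Fq (bx (B 0).cx (Word.H s).cx) p := by
  refine int_induction_iff (P := fun s => ∀ p, Van Fq (bx (B 0).cx (Word.H s).cx) p) ?_ ?_ s p
  · intro p
    obtain ⟨e⟩ := bx_unit_right (B 0).cx
    exact (van_congr (Iso.refl _) e).mpr (van_F_B 0 p)
  · intro s
    have h (p : ℤ) := (triEx_bx_rho (B 0).cx s).van_iff₂ (W := Fq) (p := p)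
      (fun p => van_isZero isZero_B_box_free p)
    exact ⟨fun h' p => by simpa using (h (p - 1)).mp (h' _), fun h' p => (h p).mpr (h' _)⟩

/-- The box product with `L` of the triangle `B_0 ⟶ H ⟶ H(1) ⟶ B_0[1]`. -/
lemma triEx_bx_B (L : CochainComplex MackeyMod ℤ) :
    TriEx (bx (B 0).cx L) (Q.obj L) (bx (Word.H 1).cx L) := by
  have h := ((ext_B 0).bx₁ L).rotate
  exact h.congr ⟨Iso.refl _⟩ (bx_unit_left L) (bx_sh_left_shift (Word.H 1) (by norm_num) L)

lemma bx_H_one_free : Nonempty (bx (Word.H 1).cx (pt .free).cx ≅ Fq) := by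
  obtain ⟨f, g, δ, hT⟩ := triEx_bx_B (pt .free).cx
  have : IsIso g := (Triangle.isZero₁_iff_isIso₂ _ hT).mp isZero_B_box_free
  exact ⟨(asIso g).symm⟩

/-- Multiplication by `H ⟶ H(1)` identifies `[F, H(s)]^p` with `[F, H(1) □ H(s)]^p`. -/
lemma congr_F_bx (s p : ℤ) :
    Nonempty ((Fq ⟶ (qH s)⟦p⟧) ≃+ (Fq ⟶ (bx (Word.H 1).cx (Word.H s).cx)⟦p⟧)) := by
  obtain ⟨f, g, δ, hT⟩ := triEx_bx_B (Word.H s).cx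
  exact ⟨postEquiv₂ hT (van_F_bx_B s _) (van_F_bx_B s _)⟩

lemma van_F_bx {s p : ℤ} (h : p ≠ 0) : Van Fq (bx (Word.H 1).cx (Word.H s).cx) p := by
  obtain ⟨e⟩ := congr_F_bx s p
  exact (GVan.congr e).mp (van_F_H h)

lemma one_F_bx (s : ℤ) : One Fq (bx (Word.H 1).cx (Word.H s).cx) 0 := by
  obtain ⟨e⟩ := congr_F_bx s 0
  exact (GOne.congr e).mp (one_F_H s)

lemma post_zero_map {W Y Z : DerivedCategory MackeyMod} {p : ℤ} (x : W ⟶ Y⟦p⟧) :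
    post W (0 : Y ⟶ Z) p x = 0 := by
  rw [post_apply, Functor.map_zero, comp_zero]

/-- In a triangle `F ⟶ X ⟶ Y[1]` in which `X` and `Y` have the cohomology of `H(n)` on `F`, the
maps `F ⟶ X` and `Y[1] ⟶ F[1]` do not vanish. -/
lemma ne_zero_of_triangle {X Y : DerivedCategory MackeyMod} {f : Fq ⟶ X} {g : X ⟶ Y⟦(1 : ℤ)⟧}
    {h : Y⟦(1 : ℤ)⟧ ⟶ Fq⟦(1 : ℤ)⟧}
    (hT : Triangle.mk f g h ∈ distTriang (DerivedCategory MackeyMod))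
    (hX : ∀ p, p ≠ 0 → Van Fq X p) (hX' : One Fq X 0) (hY : ∀ p, p ≠ 0 → Van Fq Y p)
    (hY' : One Fq Y 0) : f ≠ 0 ∧ h ≠ 0 := by
  constructor
  · rintro rfl
    obtain ⟨x, hx⟩ := hX'.2
    obtain ⟨y, rfl⟩ := post_surj₁ hT
      ((van_tgt_iff Fq Y (show (1 : ℤ) = 1 + 0 by norm_num)).mpr (hY 1 (by norm_num))) x
    exact hx (post_zero_map (Y := Fq) (Z := X) y)
  · rintro rfl
    obtain ⟨x, hx⟩ := ((one_tgt_iff Fq Y (show (0 : ℤ) = 1 + -1 by norm_num)).mpr hY').2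
    refine hx (post_inj₂ (rot_of_distTriang _ hT) (hX (-1) (by norm_num)) x
      (post_zero_map (Y := Y⟦(1 : ℤ)⟧) (Z := Fq⟦(1 : ℤ)⟧) x))

lemma kap_ne_zero (s : ℤ) : kap s ≠ 0 :=
  (ne_zero_of_triangle (rho_triangle s) (fun _ h => van_F_H h) (one_F_H _) (fun _ h => van_F_H h)
    (one_F_H _)).1

lemma rhoCo_ne_zero (s : ℤ) : rhoCo s ≠ 0 :=
  (ne_zero_of_triangle (rho_triangle s) (fun _ h => van_F_H h) (one_F_H _) (fun _ h => van_F_H h)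
    (one_F_H _)).2

lemma iso_of_shift_iso {X Y : DerivedCategory MackeyMod} {a : ℤ} (e : X⟦a⟧ ≅ Y⟦a⟧) :
    Nonempty (X ≅ Y) := ⟨(shiftFunctor _ a).preimageIso e⟩

/-- `H(s)` determines `H(1 + s)` through the triangle of multiplication by `ρ`. -/
lemma iso_H_succ {s : ℤ} {X Y : DerivedCategory MackeyMod} (h : TriEx Fq X (Y⟦(1 : ℤ)⟧))
    (hX : ∀ p, p ≠ 0 → Van Fq X p) (hX' : One Fq X 0) (hY : ∀ p, p ≠ 0 → Van Fq Y p)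
    (hY' : One Fq Y 0) (e : X ≅ qH s) : Nonempty (Y ≅ qH (1 + s)) := by
  obtain ⟨f, g, δ, hT⟩ := h
  obtain ⟨hf, -⟩ := ne_zero_of_triangle hT hX hX' hY hY'
  obtain ⟨e'⟩ := cone_unique hT (rho_triangle s) e (le_F_H s _ _
    (fun h => hf ((Preadditive.IsIso.comp_right_eq_zero _ _).mp h)) (kap_ne_zero s))
  exact iso_of_shift_iso e'

/-- `H(1 + s)` determines `H(s)` through the triangle of multiplication by `ρ`. -/
lemma iso_H_pred {s : ℤ} {X Y : DerivedCategory MackeyMod} (h : TriEx Fq X (Y⟦(1 : ℤ)⟧))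
    (hX : ∀ p, p ≠ 0 → Van Fq X p) (hX' : One Fq X 0) (e : Y ≅ qH (1 + s)) : Nonempty (X ≅ qH s) := by
  obtain ⟨f, g, δ, hT⟩ := h.congr ⟨Iso.refl _⟩ ⟨Iso.refl _⟩ ⟨(shiftFunctor _ (1 : ℤ)).mapIso e⟩
  obtain ⟨-, hδ⟩ := ne_zero_of_triangle hT hX hX' (fun _ h => van_F_H h) (one_F_H _)
  obtain ⟨δ', rfl⟩ := (shiftFunctor (DerivedCategory MackeyMod) (1 : ℤ)).map_surjective δ
  obtain ⟨r, hr⟩ := (shiftFunctor (DerivedCategory MackeyMod) (1 : ℤ)).map_surjective (rhoCo s)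
  have h₁ : δ' ≠ 0 := fun h => hδ (by rw [h, Functor.map_zero])
  have h₂ : r ≠ 0 := fun h => rhoCo_ne_zero s (by rw [← hr, h, Functor.map_zero])
  have hT' : Triangle.mk (δ'⟦(1 : ℤ)⟧') (-f⟦(1 : ℤ)⟧') (-g⟦(1 : ℤ)⟧') ∈
      distTriang (DerivedCategory MackeyMod) := rot_of_distTriang _ (rot_of_distTriang _ hT)
  have hT'' : Triangle.mk (rhoCo s) (-(kap s)⟦(1 : ℤ)⟧') (-(rho s)⟦(1 : ℤ)⟧') ∈
      distTriang (DerivedCategory MackeyMod) :=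
    rot_of_distTriang _ (rot_of_distTriang _ (rho_triangle s))
  obtain ⟨e'⟩ := cone_unique hT' hT'' (Iso.refl _) (by
    rw [Iso.refl_hom, Category.comp_id, ← hr, le_H_F _ _ _ h₁ h₂])
  exact iso_of_shift_iso e'

/-- The equivalence `H(1) □ H(s) ≃ H(1 + s)`, by induction on `s` in both directions: both sides lie
in triangles `F ⟶ H(1) □ H(s) ⟶ (H(1) □ H(1 + s))[1]` and `F ⟶ H(1 + s) ⟶ H(2 + s)[1]`, and the
maps `F ⟶ H(n)` and `H(n) ⟶ F` in such triangles are unique. -/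
lemma bx_H_one (s : ℤ) : Nonempty (bx (Word.H 1).cx (Word.H s).cx ≅ qH (1 + s)) := by
  refine int_induction_iff (P := fun s => Nonempty (bx (Word.H 1).cx (Word.H s).cx ≅ qH (1 + s)))
    ?_ (fun s => ?_) s
  · exact bx_unit_right _
  · have h := (triEx_bx_rho (Word.H 1).cx s).congr bx_H_one_free ⟨Iso.refl _⟩ ⟨Iso.refl _⟩
    exact ⟨fun ⟨e⟩ => iso_H_succ h (fun _ h => van_F_bx h) (one_F_bx _) (fun _ h => van_F_bx h)
      (one_F_bx _) e, fun ⟨e⟩ => iso_H_pred h (fun _ h => van_F_bx h) (one_F_bx _) e⟩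

end BoxH

/-! ### The maps given by multiplication with elements of `𝕄₂` -/

lemma isIso_boxEquiv (s : ℤ) : IsIso (boxEquiv 1 s) := by
  obtain ⟨e⟩ := bx_H_one s
  exact Classical.epsilon_spec (p := fun e : Q.obj (boxC (complexH 1) (complexH s)) ⟶
    Q.obj (complexH (1 + s)) => IsIso e) ⟨e.hom, e.isIso_hom⟩

lemma isIso_boxUnit (s : ℤ) : IsIso (boxUnit s) := by
  obtain ⟨e⟩ := bx_unit_left (Word.H s).cx
  exact Classical.epsilon_spec (p := fun e : Q.obj (complexH s) ⟶
    Q.obj (boxC (complexH 0) (complexH s)) => IsIso e) ⟨e.inv, e.isIso_inv⟩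

lemma homotopy_of_Q_map_eq {K L : CochainComplex MackeyMod ℤ} (hK : K.IsKProjective)
    {f g : K ⟶ L} (h : Q.map f = Q.map g) : Nonempty (Homotopy f g) := by
  rw [← sub_eq_zero, ← Functor.map_sub, Q_map_eq_zero_iff hK] at h
  exact h.map Homotopy.equivSubZero.symm

/-- The element of `𝕄₂` represented by a chain map. -/
noncomputable def ofChainMap {p q : ℤ} (f : complexH 0 ⟶ (complexH q)⟦p⟧) : M2 p q :=
  Q.map f ≫ (Q.commShiftIso p).hom.app (complexH q)

/-- Multiplication by the class of a chain map `f` is nonzero if `f □ H(s)` is. -/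
lemma mulMap_ofChainMap_ne_zero {p : ℤ} (f : complexH 0 ⟶ (complexH 1)⟦p⟧) {s : ℤ}
    (h : Q.map (boxMapC f (𝟙 (complexH s))) ≠ 0) : mulMap (ofChainMap f) s ≠ 0 := by
  intro h0
  have hr : Q.map (rep (ofChainMap f)) = Q.map f := by
    rw [← cancel_mono ((Q.commShiftIso p).hom.app (complexH 1))]
    exact (exists_rep_M2 (ofChainMap f)).choose_spec
  obtain ⟨e⟩ := homotopy_of_Q_map_eq inferInstance hr
  have := isIso_boxEquiv s
  have := isIso_boxUnit s
  have h₁ := (Preadditive.IsIso.comp_left_eq_zero _ _).mp h0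
  have h₂ : Q.map (boxMapC (rep (ofChainMap f)) (𝟙 (complexH s))) = 0 :=
    (Preadditive.IsIso.comp_right_eq_zero _ (Q.map
      (CochainComplex.mapBifunctorShift₁Iso (complexH 1) (complexH s) box p).hom ≫
        (Q.commShiftIso p).hom.app (boxC (complexH 1) (complexH s)) ≫ (boxEquiv 1 s)⟦p⟧')).mp h₁
  exact h ((Q_boxMapC_congr e _).symm.trans h₂)

/-! ### Multiplication by `ρ` -/

lemma van_B_bx_free_free (p : ℤ) : Van (qB 0) (bx (pt .free).cx (pt .free).cx) p := by
  have h := (ext_rho_nonneg le_rfl).bx₁ (pt .free).cx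
  rw [add_zero, pt_free] at h
  obtain ⟨f, g, δ, hT⟩ := (h.rotate.congr bx_H_one_free ⟨Iso.refl _⟩
    ⟨(shiftFunctor _ (1 : ℤ)).mapIso (bx_sh_left _ _ _).some⟩).congr ⟨Iso.refl _⟩ ⟨Iso.refl _⟩
      ⟨(shiftFunctor _ (1 : ℤ)).mapIso ((shiftFunctor _ (-1 : ℤ)).mapIso (bx_unit_left _).some)⟩
  refine van_post₂ hT (van_B_F 0 p) ?_
  exact (van_tgt_iff (qB 0) _ (show (1 + p : ℤ) = 1 + p from rfl)).mpr
    ((van_tgt_iff (qB 0) Fq (show (-1 + (1 + p) : ℤ) = -1 + (1 + p) from rfl)).mpr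
      (van_B_F 0 _))

/-- There are no maps from `B_0` to suspensions of `F □ H(s)`. -/
lemma van_B_bx_free (s p : ℤ) : Van (qB 0) (bx (pt .free).cx (Word.H s).cx) p := by
  refine int_induction_iff (P := fun s => ∀ p, Van (qB 0) (bx (pt .free).cx (Word.H s).cx) p)
    ?_ ?_ s p
  · intro p
    obtain ⟨e⟩ := bx_unit_right (pt .free).cx
    exact (van_congr (Iso.refl _) e).mpr (van_B_F 0 p)
  · intro s
    have h (p : ℤ) := (triEx_bx_rho (pt .free).cx s).van_iff₂ (W := qB 0) (p := p)
      van_B_bx_free_free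
    exact ⟨fun h' p => by simpa using (h (p - 1)).mp (h' _), fun h' p => (h p).mpr (h' _)⟩

lemma ext_rho : Ext (Word.H 0) ((Word.H 1).sh 1) ((A 0).sh 1) := by
  have h := (ext_rho_nonneg le_rfl).sh 1
  rwa [add_zero, sh_sh, neg_add_cancel, sh_zero] at h

/-- A chain map representing `ρ`: the inclusion `H ⟶ H(1)[1]`. -/
noncomputable def rhoC : complexH 0 ⟶ (complexH 1)⟦(1 : ℤ)⟧ :=
  Word.thr ext_rho.compat₁ ≫ ((Word.H 1).shIso 1).hom

lemma Q_boxMapC_iso_ne_zero {K K' K'' L : CochainComplex MackeyMod ℤ} {f : K ⟶ K'} (e : K' ≅ K'')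
    (h : Q.map (boxMapC f (𝟙 L)) ≠ 0) : Q.map (boxMapC (f ≫ e.hom) (𝟙 L)) ≠ 0 := by
  have e₁ : boxMapC (f ≫ e.hom) (𝟙 L) = boxMapC f (𝟙 L) ≫ (boxIso e (Iso.refl L)).hom := by
    change _ = boxMapC f (𝟙 L) ≫ boxMapC e.hom (𝟙 L)
    rw [← boxMapC_comp, Category.comp_id]
  rw [e₁, Q.map_comp]
  exact fun h₀ => h ((Preadditive.IsIso.comp_right_eq_zero _ _).mp h₀)

lemma post_eq_zero_of_eq_zero {W Y Z : DerivedCategory MackeyMod} {g : Y ⟶ Z} (h : g = 0) {p : ℤ}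
    (x : W ⟶ Y⟦p⟧) : post W g p x = 0 := by
  rw [h, post_zero_map]

/-- The fibre of `ρ □ H(s)` is a suspension of `F □ H(s)`, so `ρ □ H(s)` is injective on the nonzero
group of maps from `B_0`. -/
lemma rhoC_box_ne_zero (s : ℤ) : Q.map (boxMapC rhoC (𝟙 (complexH s))) ≠ 0 := by
  refine Q_boxMapC_iso_ne_zero _ fun h₀ => ?_
  obtain ⟨δ, hT⟩ := ext_rho.exists_box_triangle₁ (Word.H s).cx
  have hv (p : ℤ) : Van (qB 0) (bx ((A 0).sh 1).cx (Word.H s).cx) p := by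
    obtain ⟨e⟩ := bx_sh_left (A 0) 1 (Word.H s).cx
    rw [van_congr (Iso.refl _) e, van_tgt_iff _ _ (show (1 + p : ℤ) = 1 + p from rfl), pt_free]
    exact van_B_bx_free s _
  obtain ⟨e⟩ := bx_unit_left (Word.H s).cx
  obtain ⟨x, hx⟩ := ((one_congr (Iso.refl _) e).mpr
    (one_B_H (r := 0) (q := s) (p := s) (by simp) (by simp))).2
  exact hx (post_inj₁ hT (hv _) x (post_eq_zero_of_eq_zero h₀ x))

lemma rho_ne_zero (s : ℤ) : rho s ≠ 0 := by
  intro h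
  obtain ⟨x, hx⟩ := (one_HH (n := s) (q := s) le_rfl (by omega)).2
  refine hx (rho_inj_H le_rfl (by omega) x ((step_eq_zero_iff _ _).mpr ?_))
  rw [h, post_zero_map]

/-- There is an element `ρ` of `H^{1,1}(H)` which acts by the maps `rho`. -/
lemma exists_rho : ∃ a : M2 1 1, ∀ s, mulMap a s = rho s :=
  ⟨ofChainMap rhoC, fun s => (one_HH (n := s) (q := 1 + s) zero_le_one (by omega)).1 _ _
    (mulMap_ofChainMap_ne_zero rhoC (rhoC_box_ne_zero s)) (rho_ne_zero s)⟩

/-! ### Multiplication by `τ` -/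

/-- The chain map `H ⟶ H(1)` given by `p : H ⟶ F`. -/
noncomputable def tauC' : (Word.H 0).cx ⟶ (Word.H 1).cx :=
  Word.thr (compat_H 0 1 (by norm_num) (Or.inl le_rfl))

/-- The projection `F ⟶ H` to the first factor retracts `H_Θ ⟶ H(1)_Θ`. -/
noncomputable def tauRetraction : (evTop.mapHomologicalComplex (.up ℤ)).obj (Word.H 1).cx ⟶
    (evTop.mapHomologicalComplex (.up ℤ)).obj (Word.H 0).cx where
  f i := Cell.sigma ((Word.H 1).c i) ((Word.H 0).c i)
  comm' i j hij := by
    obtain rfl : i + 1 = j := hij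
    have h₁ : (Word.H 0).cx.d i (i + 1) = 0 := by rw [pt_fixed]; exact pt_d _ _ _
    change _ ≫ Hom.top ((Word.H 0).cx.d i (i + 1)) = Hom.top ((Word.H 1).cx.d i (i + 1)) ≫ _
    rw [h₁, d_eq]
    refine comp_zero.trans ?_
    by_cases hi : i + 1 = 0
    · have : (Word.H 1).c i = .zero := by
        obtain rfl : i = -1 := by omega
        simp [Word.H]
      exact ((evTop.map_isZero (X := ((Word.H 1).c i).obj)
        (by rw [this]; exact isZero_zero_obj)).eq_of_src _ _)
    · have : (Word.H 0).c (i + 1) = .zero := by rw [pt_fixed]; exact pt_ne hi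
      exact ((evTop.map_isZero (X := ((Word.H 0).c (i + 1)).obj)
        (by rw [this]; exact isZero_zero_obj)).eq_of_tgt _ _)

lemma tauC'_retraction :
    (evTop.mapHomologicalComplex (.up ℤ)).map tauC' ≫ tauRetraction = 𝟙 _ := by
  ext1 i
  by_cases hi : i = 0
  · subst hi
    rfl
  · have : (Word.H 0).c i = .zero := by rw [pt_fixed]; exact pt_ne hi
    exact ((evTop.map_isZero (X := ((Word.H 0).c i).obj)
        (by rw [this]; exact isZero_zero_obj)).eq_of_src _ _)

/-- The map `τ □ F` is split, because `τ` splits over `Θ`. -/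
lemma mono_tauC'_box_free : Mono (Q.map (boxMapC tauC' (𝟙 (pt .free).cx))) := by
  have e := freeRight_naturality tauC'
  have h : ((evTop ⋙ ind).mapHomologicalComplex (.up ℤ)).map tauC' ≫
      (ind.mapHomologicalComplex (.up ℤ)).map tauRetraction = 𝟙 _ := by
    have h := congrArg (ind.mapHomologicalComplex (.up ℤ)).map tauC'_retraction
    rw [Functor.map_comp, CategoryTheory.Functor.map_id] at h
    exact h
  have h' : boxMapC tauC' (𝟙 (pt .free).cx) ≫ (freeRight _).inv ≫
      (ind.mapHomologicalComplex (.up ℤ)).map tauRetraction ≫ (freeRight _).hom = 𝟙 _ := by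
    rw [← cancel_epi (freeRight _).hom, ← Category.assoc, e, Category.assoc,
      Iso.hom_inv_id_assoc]
    exact (Category.assoc _ _ _).symm.trans ((congrArg (· ≫ _) h).trans
      ((Category.id_comp _).trans (Category.comp_id _).symm))
  have h'' := congrArg Q.map h'
  rw [Functor.map_comp, CategoryTheory.Functor.map_id] at h''
  exact mono_of_mono_fac h''

/-- If `τ □ H(1 + s)` vanished, then so would its composite with `H(1) □ (H(1 + s) ⟶ F)`, which is
`H □ (H(1 + s) ⟶ F)` followed by the monomorphism `τ □ F`. For weight at least one the map
`H(1 + s) ⟶ F` does not vanish: it is the projection to the lowest cell. -/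
lemma tauC'_box_ne_zero {s : ℤ} (hs : 0 ≤ s) :
    Q.map (boxMapC tauC' (𝟙 (Word.H (1 + s)).cx)) ≠ 0 := by
  intro h₀
  have h := ext_rho_nonneg hs
  have e := congrArg Q.map (boxMapC_exchange tauC' (Word.thr h.compat₂))
  rw [Functor.map_comp, Functor.map_comp, h₀, zero_comp] at e
  have h₁ : Q.map (boxMapC (𝟙 (Word.H 0).cx) (Word.thr h.compat₂)) = 0 := by
    have hm := mono_tauC'_box_free
    rw [← pt_free] at hm
    exact zero_of_comp_mono _ e.symm
  rw [pt_fixed] at h₁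
  have h₂ := Q_boxMapC_unit_eq_zero h₁
  obtain ⟨δ, hT⟩ := h.exists_triangle
  obtain ⟨x, hx⟩ := (one_F_H (1 + s)).2
  exact hx (post_inj₂ hT ((van_sh_tgt (show (-1 + 0 : ℤ) = -1 by norm_num)).mpr
    (van_F_H (by norm_num))) x (post_eq_zero_of_eq_zero h₂ x))

/-- A chain map representing `τ`. -/
noncomputable def tauC : complexH 0 ⟶ (complexH 1)⟦(0 : ℤ)⟧ :=
  tauC' ≫ ((shiftFunctorZero (CochainComplex MackeyMod ℤ) ℤ).symm.app (Word.H 1).cx).hom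

/-- There is an element `τ` of `H^{0,1}(H)` which acts by the maps `tau`. -/
lemma exists_tau : ∃ a : M2 0 1, ∀ s, 1 ≤ s →
    mulMap a s = tau s ≫ (shiftFunctorZero (DerivedCategory MackeyMod) ℤ).inv.app (qH (1 + s)) :=
  ⟨ofChainMap tauC, fun s hs => (one_HH (n := s) (q := 1 + s) le_rfl (by omega)).1 _ _
    (mulMap_ofChainMap_ne_zero tauC (by
      obtain ⟨s, rfl⟩ : ∃ s', s = 1 + s' := ⟨s - 1, by ring⟩
      exact Q_boxMapC_iso_ne_zero _ (tauC'_box_ne_zero (by omega))))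
    (fun h => tau_ne_zero s ((Preadditive.IsIso.comp_right_eq_zero _ _).mp h))⟩

/-! ### Cohomology as an invariant -/

/-- The action of `𝕄₂` is by composition with maps of coefficients, so precomposition with an
isomorphism respects it. -/
lemma QIso.cohomologyIso {X Y : CochainComplex MackeyMod ℤ} (h : QIso X Y) :
    CohomologyIso X Y := by
  obtain ⟨e⟩ := h
  refine ⟨fun p q =>
    { toFun := fun x => e.inv ≫ x
      invFun := fun x => e.hom ≫ x
      left_inv := e.hom_inv_id_assoc
      right_inv := e.inv_hom_id_assoc
      map_add' := fun x y => Preadditive.comp_add _ _ _ _ x y }, fun p q r s a x => ?_⟩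
  exact pre_step (mulMap a s) e.inv x

lemma CohomologyIso.symm {X Y : CochainComplex MackeyMod ℤ} (h : CohomologyIso X Y) :
    CohomologyIso Y X := by
  obtain ⟨φ, hφ⟩ := h
  refine ⟨fun p q => (φ p q).symm, fun p q r s a x => ?_⟩
  rw [AddEquiv.symm_apply_eq, hφ, AddEquiv.apply_symm_apply]

lemma CohomologyIso.trans {X Y Z : CochainComplex MackeyMod ℤ} (h : CohomologyIso X Y)
    (h' : CohomologyIso Y Z) : CohomologyIso X Z := by
  obtain ⟨φ, hφ⟩ := h
  obtain ⟨ψ, hψ⟩ := h'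
  refine ⟨fun p q => (φ p q).trans (ψ p q), fun p q r s a x => ?_⟩
  rw [AddEquiv.trans_apply, hφ, hψ, AddEquiv.trans_apply]

/-! ### Multiplication by powers of `ρ` and `τ` -/

/-- The degree `n * a + p`, in the form in which it arises from `n` multiplications by an element
of degree `a`. -/
def addIter (a : ℤ) : ℕ → ℤ → ℤ
  | 0, p => p
  | n + 1, p => a + addIter a n p

lemma addIter_one (n : ℕ) (p : ℤ) : addIter 1 n p = n + p := by
  induction n with
  | zero => simp [addIter]
  | succ n ih => rw [addIter, ih]; push_cast; ring

lemma addIter_zero (n : ℕ) (p : ℤ) : addIter 0 n p = p := by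
  induction n with
  | zero => rfl
  | succ n ih => rw [addIter, ih, zero_add]

/-- Multiplication by `a ^ n` on `[W, H(s)]^p`, for `a` of weight one. -/
noncomputable def actPow (W : DerivedCategory MackeyMod) {d : ℤ} (a : M2 d 1) (s p : ℤ) :
    ∀ n : ℕ, (W ⟶ (Q.obj (complexH s))⟦p⟧) →+
      (W ⟶ (Q.obj (complexH (addIter 1 n s)))⟦addIter d n p⟧)
  | 0 => AddMonoidHom.id _
  | n + 1 => (step W (mulMap a (addIter 1 n s)) (addIter d n p)).comp (actPow W a s p n)

/-- Multiplication by `a ^ n` commutes with precomposition. -/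
lemma comp_actPow {W W' : DerivedCategory MackeyMod} {d : ℤ} (a : M2 d 1) (s p : ℤ) (n : ℕ)
    (f : W' ⟶ W) (x : W ⟶ (Q.obj (complexH s))⟦p⟧) :
    f ≫ actPow W a s p n x = actPow W' a s p n (f ≫ x) := by
  induction n with
  | zero => rfl
  | succ n ih => exact (pre_step _ f _).trans (congrArg _ ih)

/-- Multiplication by `a ^ n` on isomorphic modules has images of the same size. -/
lemma CohomologyIso.card_range_actPow {X Y : CochainComplex MackeyMod ℤ} (h : CohomologyIso X Y)
    {d : ℤ} (a : M2 d 1) (s p : ℤ) (n : ℕ) :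
    Nat.card (Set.range (actPow (Q.obj X) a s p n)) =
      Nat.card (Set.range (actPow (Q.obj Y) a s p n)) := by
  obtain ⟨φ, hφ⟩ := h
  have key (n : ℕ) (x : Coh X p s) : φ (addIter d n p) (addIter 1 n s)
      (actPow (Q.obj X) a s p n x) = actPow (Q.obj Y) a s p n (φ p s x) := by
    induction n with
    | zero => rfl
    | succ n ih =>
      exact (hφ d 1 (addIter d n p) (addIter 1 n s) a (actPow (Q.obj X) a s p n x)).trans
        (congrArg (act a) ih)
  refine Nat.card_congr ((φ (addIter d n p) (addIter 1 n s)).toEquiv.subtypeEquiv fun y => ?_)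
  constructor
  · rintro ⟨x, rfl⟩
    exact ⟨φ p s x, (key n x).symm⟩
  · rintro ⟨x, hx⟩
    refine ⟨(φ p s).symm x, (φ (addIter d n p) (addIter 1 n s)).injective ?_⟩
    rw [key, AddEquiv.apply_symm_apply]
    exact hx

/-! ### Sizes of images -/

/-- A homomorphism which is an injection of a group of order two if `P` holds, and is zero
otherwise. -/
def Detects {A B : Type*} [AddCommGroup A] [AddCommGroup B] (f : A →+ B) (P : Prop) : Prop :=
  (P → GOne A ∧ ∀ x, f x = 0 → x = 0) ∧ (¬ P → ∀ x, f x = 0)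

open scoped Classical in
lemma Detects.card_range {A B : Type*} [AddCommGroup A] [AddCommGroup B] {f : A →+ B} {P : Prop}
    (h : Detects f P) : Nat.card (Set.range f) = if P then 2 else 1 := by
  split_ifs with hP
  · obtain ⟨⟨hle, a, ha⟩, hf⟩ := h.1 hP
    have hr : Set.range f = {0, f a} := by
      ext y
      constructor
      · rintro ⟨x, rfl⟩
        by_cases hx : x = 0
        · exact Or.inl (by rw [hx, map_zero])
        · exact Or.inr (by rw [hle x a hx ha]; rfl)
      · rintro (rfl | rfl)
        · exact ⟨0, map_zero f⟩
        · exact ⟨a, rfl⟩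
    rw [Nat.card_coe_set_eq, hr, Set.ncard_pair fun e => ha (hf a e.symm)]
  · have hr : Set.range f = {0} := by
      ext y
      constructor
      · rintro ⟨x, rfl⟩
        exact h.2 hP x
      · rintro rfl
        exact ⟨0, map_zero f⟩
    rw [Nat.card_coe_set_eq, hr, Set.ncard_singleton]

/-- The image of a product of maps is the product of the images. -/
lemma card_range_eq_prod {ι : Type} [Fintype ι] {A B : Type*} {A' B' : ι → Type*}
    {f : A → B} {f' : ∀ i, A' i → B' i} (e : A ≃ ∀ i, A' i) (e' : B ≃ ∀ i, B' i)
    (h : ∀ x i, e' (f x) i = f' i (e x i)) :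
    Nat.card (Set.range f) = ∏ i, Nat.card (Set.range (f' i)) := by
  rw [← Nat.card_pi]
  refine Nat.card_congr ((e'.subtypeEquiv (q := fun y => ∀ i, y i ∈ Set.range (f' i))
    fun y => ⟨?_, fun hy => ?_⟩).trans (Equiv.subtypePiEquivPi))
  · rintro ⟨x, rfl⟩ i
    exact ⟨_, (h x i).symm⟩
  · choose x hx using hy
    refine ⟨e.symm x, e'.injective (funext fun i => ?_)⟩
    rw [h, Equiv.apply_symm_apply, hx]

/-- Maps in the derived category out of a direct sum of complexes. -/
noncomputable def homBiproductEquiv {ι : Type} [Fintype ι] (K : ι → CochainComplex MackeyMod ℤ)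
    (Z : DerivedCategory MackeyMod) : (Q.obj (⨁ K) ⟶ Z) ≃ ∀ i, Q.obj (K i) ⟶ Z where
  toFun x i := Q.map (biproduct.ι K i) ≫ x
  invFun y := ∑ i, Q.map (biproduct.π K i) ≫ y i
  left_inv x := by
    simp only [← Category.assoc, ← Functor.map_comp]
    rw [← Preadditive.sum_comp, ← Functor.map_sum, biproduct.total, CategoryTheory.Functor.map_id]
    exact Category.id_comp x
  right_inv y := by
    classical
    funext j
    dsimp only
    rw [Preadditive.comp_sum, Finset.sum_eq_single j]
    · rw [← Category.assoc, ← Functor.map_comp, biproduct.ι_π_self,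
        CategoryTheory.Functor.map_id, Category.id_comp]
    · intro i _ hi
      rw [← Category.assoc, ← Functor.map_comp, biproduct.ι_π_ne _ hi.symm, Functor.map_zero,
        zero_comp]
    · exact fun h => absurd (Finset.mem_univ j) h

open scoped Classical in
/-- The size of an image on a sum of strands, in terms of the number of strands on which the map
is nonzero. -/
lemma card_range_strandSum {ι : Type} [Fintype ι] {S : ι → Strand} {m : ι → ℤ} {d : ℤ} {a : M2 d 1}
    {s p : ℤ} {n : ℕ} {P : ι → Prop}
    (h : ∀ i, Detects (actPow (Q.obj ((S i).complex⟦m i⟧)) a s p n) (P i)) :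
    Nat.card (Set.range (actPow (Q.obj (strandSum S m)) a s p n)) =
      2 ^ (Finset.univ.filter P).card := by
  refine (card_range_eq_prod (homBiproductEquiv (fun i => (S i).complex⟦m i⟧) _)
    (homBiproductEquiv (fun i => (S i).complex⟦m i⟧) _)
    (f' := fun i => actPow (Q.obj ((S i).complex⟦m i⟧)) a s p n)
    fun x i => comp_actPow a s p n (Q.map (biproduct.ι (fun i => (S i).complex⟦m i⟧) i)) x).trans ?_
  rw [Finset.prod_congr rfl fun i _ => (h i).card_range, Finset.prod_ite]
  simp

/-! ### The action of `ρ` and `τ` on the cohomology of a strand -/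

/-- Composition with `g` is injective on `[W, Y]^p`. -/
def PostInj (W : DerivedCategory MackeyMod) {Y Z : DerivedCategory MackeyMod} (g : Y ⟶ Z)
    (p : ℤ) : Prop := ∀ x : W ⟶ Y⟦p⟧, post W g p x = 0 → x = 0

section Suspension

variable {W V : DerivedCategory MackeyMod} {m q p : ℤ} (e : W ≅ V⟦m⟧) (h : q + m = p)
include e h

lemma van_iff_of_iso (Y : DerivedCategory MackeyMod) : Van W Y p ↔ Van V Y q :=
  (van_congr e (Iso.refl Y)).trans (van_src_iff V Y h)

lemma one_iff_of_iso (Y : DerivedCategory MackeyMod) : One W Y p ↔ One V Y q :=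
  (one_congr e (Iso.refl Y)).trans (one_src_iff V Y h)

lemma PostInj.of_iso {Y Z : DerivedCategory MackeyMod} {g : Y ⟶ Z} (hg : PostInj V g q) :
    PostInj W g p := by
  intro x hx
  obtain ⟨y, hy⟩ := (homShiftSrc V Y h).surjective (e.inv ≫ x)
  have hz : homShiftSrc V Z h (post V g q y) = e.inv ≫ post W g p x := by
    have : e.inv ≫ post W g p x = post _ g p (homShiftSrc V Y h y) := by
      rw [hy, post_apply, post_apply, Category.assoc]
    rw [this]
    change (y ≫ g⟦q⟧')⟦m⟧' ≫ _ = (y⟦m⟧' ≫ _) ≫ g⟦p⟧'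
    rw [Functor.map_comp, Category.assoc, Category.assoc]
    exact congrArg (y⟦m⟧' ≫ ·) ((shiftFunctorAdd' _ q m p h).inv.naturality g)
  rw [hx, comp_zero, map_eq_zero_iff _ (homShiftSrc V Z h).injective] at hz
  rw [hg y hz, map_zero] at hy
  exact (Preadditive.IsIso.comp_left_eq_zero _ _).mp hy.symm

end Suspension

/-- A power of `a` detects `P` if it is injective step by step when `P` holds, and has vanishing
source or target otherwise. -/
lemma detects_actPow {W : DerivedCategory MackeyMod} {d : ℤ} {a : M2 d 1} {s p : ℤ} {n : ℕ}
    {P : Prop} (h₁ : P → One W (qH s) p)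
    (h₂ : P → ∀ j < n, PostInj W (mulMap a (addIter 1 j s)) (addIter d j p))
    (h₃ : ¬ P → Van W (qH s) p ∨ Van W (qH (addIter 1 n s)) (addIter d n p)) :
    Detects (actPow W a s p n) P := by
  refine ⟨fun hP => ⟨h₁ hP, ?_⟩, fun hP x => ?_⟩
  · replace h₂ := h₂ hP
    clear h₁ h₃
    clear hP
    induction n with
    | zero => exact fun x hx => hx
    | succ n ih =>
      exact fun x hx => ih (fun j hj => h₂ j (by omega)) x
        (h₂ n (by omega) _ ((step_eq_zero_iff _ _).mp hx))
  · rcases h₃ hP with h | h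
    · exact (congrArg _ (h x)).trans (map_zero _)
    · exact h _

lemma PostInj.congr {W Y Z : DerivedCategory MackeyMod} {g g' : Y ⟶ Z} {p : ℤ} (h : g = g')
    (hg : PostInj W g' p) : PostInj W g p := h ▸ hg

lemma postInj_of_step {W Y Z : DerivedCategory MackeyMod} {a : ℤ} {g : Y ⟶ Z⟦a⟧} {p : ℤ}
    (h : ∀ x, step W g p x = 0 → x = 0) : PostInj W g p :=
  fun x hx => h x ((step_eq_zero_iff _ _).mpr hx)

lemma PostInj.comp_iso {W Y Z Z' : DerivedCategory MackeyMod} {g : Y ⟶ Z} (f : Z ⟶ Z') [IsIso f]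
    {p : ℤ} (hg : PostInj W g p) : PostInj W (g ≫ f) p := by
  intro x hx
  refine hg x ((Preadditive.IsIso.comp_right_eq_zero _ (f⟦p⟧')).mp ?_)
  rw [post_apply, Functor.map_comp, ← Category.assoc] at hx
  exact hx

/-- The condition for `ρ ^ n` to be nonzero in degree `p` and large weight on the cohomology of the
strand suspended by `m`. -/
def Strand.RhoStable (p n : ℤ) : Strand × ℤ → Prop
  | (.A k, m) => m ≤ p ∧ p + n ≤ m + k
  | (.H _, m) => m ≤ p
  | (.B _, _) => False

/-- The condition for `τ ^ n` to be nonzero in large weight `s` and degree `d + s` on the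
cohomology of the strand suspended by `m`. -/
def Strand.TauStable (d n : ℤ) : Strand × ℤ → Prop
  | (.A _, _) => False
  | (.H l, m) => d ≤ m - l
  | (.B r, m) => d ≤ m ∧ m - r ≤ d - n

/-- The condition for all powers of `ρ` to be nonzero in degree `p` and weight `p - d` on the
cohomology of the strand suspended by `m`. -/
def Strand.RhoPeriodic (p d : ℤ) : Strand × ℤ → Prop
  | (.A _, _) => False
  | (.H l, m) => m ≤ p ∧ d ≤ m - l
  | (.B r, m) => m - r ≤ d ∧ d ≤ m

section Strands

variable {m p s : ℤ}

section

variable {a : M2 1 1} (ha : ∀ s, mulMap a s = rho s)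
include ha

lemma detects_rho_A {k : ℕ} {W : DerivedCategory MackeyMod} (e : W ≅ (qA k)⟦m⟧) {n : ℕ} :
    Detects (actPow W a s p n) (m ≤ p ∧ p + n ≤ m + k) := by
  refine detects_actPow (fun hP => ?_) (fun hP j hj => ?_) fun hP => ?_
  · exact (one_iff_of_iso e (sub_add_cancel p m) _).mpr (one_A_H (by omega) (by omega))
  · rw [addIter_one j p]
    exact PostInj.of_iso e (sub_add_cancel _ m) (PostInj.congr (ha _)
      (postInj_of_step (rho_inj_A (by omega) (by omega))))
  · rw [van_iff_of_iso e (sub_add_cancel _ m), van_iff_of_iso e (sub_add_cancel _ m),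
      addIter_one n p]
    by_contra! h
    exact hP ⟨by_contra fun h' => h.1 (van_A_H (by omega)),
      by_contra fun h' => h.2 (van_A_H (by omega))⟩

/-- The hypothesis `h` excludes products within the negative cone: either the source lies above the
negative cone, or the target lies in degrees to which the negative cone does not extend. -/
lemma detects_rho_H {l : ℤ} {W : DerivedCategory MackeyMod} (e : W ≅ (qH l)⟦m⟧) {n : ℕ}
    (h : p - m ≤ s - l ∨ m < p + n) :
    Detects (actPow W a s p n) (m ≤ p ∧ p - m ≤ s - l) := by
  refine detects_actPow (fun hP => ?_) (fun hP j hj => ?_) fun hP => ?_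
  · exact (one_iff_of_iso e (sub_add_cancel p m) _).mpr (one_HH (by omega) (by omega))
  · rw [addIter_one j p, addIter_one j s]
    exact PostInj.of_iso e (sub_add_cancel _ m) (PostInj.congr (ha _)
      (postInj_of_step (rho_inj_H (by omega) (by omega))))
  · rw [van_iff_of_iso e (sub_add_cancel _ m), van_iff_of_iso e (sub_add_cancel _ m),
      addIter_one n p, addIter_one n s]
    by_cases h' : p - m ≤ s - l
    · exact Or.inl (van_HH (by omega) (by omega) (by omega))
    · exact Or.inr (van_HH (by omega) (by omega) (by omega))

lemma detects_rho_B {r : ℕ} {W : DerivedCategory MackeyMod} (e : W ≅ (qB r)⟦m⟧) {n : ℕ} :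
    Detects (actPow W a s p n) (m - r ≤ p - s ∧ p - s ≤ m) := by
  refine detects_actPow (fun hP => ?_) (fun hP j hj => ?_) fun hP => ?_
  · exact (one_iff_of_iso e (sub_add_cancel p m) _).mpr (one_B_H (by omega) (by omega))
  · exact PostInj.of_iso e (sub_add_cancel _ m) (PostInj.congr (ha _) (postInj_of_step rho_inj_B))
  · rw [van_iff_of_iso e (sub_add_cancel _ m)]
    exact Or.inl (van_B_H (by omega))

end

section

variable {a : M2 0 1} (ha : ∀ s, 1 ≤ s →
  mulMap a s = tau s ≫ (shiftFunctorZero (DerivedCategory MackeyMod) ℤ).inv.app (qH (1 + s)))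
include ha

lemma detects_tau_H {l : ℤ} {W : DerivedCategory MackeyMod} (e : W ≅ (qH l)⟦m⟧) {n : ℕ}
    (hs : 1 ≤ s) (hp : m < p) :
    Detects (actPow W a s p n) (p - m ≤ s - l) := by
  refine detects_actPow (fun hP => ?_) (fun hP j hj => ?_) fun hP => ?_
  · exact (one_iff_of_iso e (sub_add_cancel p m) _).mpr (one_HH (by omega) (by omega))
  · rw [addIter_zero j p, addIter_one j s]
    exact PostInj.of_iso e (sub_add_cancel _ m) (PostInj.congr (ha _ (by omega))
      (PostInj.comp_iso ((shiftFunctorZero _ ℤ).app _).inv (tau_inj_H (by omega) (by omega))))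
  · rw [van_iff_of_iso e (sub_add_cancel _ m)]
    exact Or.inl (van_HH (by omega) (by omega) (by omega))

lemma detects_tau_B {r : ℕ} {W : DerivedCategory MackeyMod} (e : W ≅ (qB r)⟦m⟧) {n : ℕ}
    (hs : 1 ≤ s) : Detects (actPow W a s p n) (p - s ≤ m ∧ m - r ≤ p - s - n) := by
  refine detects_actPow (fun hP => ?_) (fun hP j hj => ?_) fun hP => ?_
  · exact (one_iff_of_iso e (sub_add_cancel p m) _).mpr (one_B_H (by omega) (by omega))
  · rw [addIter_zero j p, addIter_one j s]
    exact PostInj.of_iso e (sub_add_cancel _ m) (PostInj.congr (ha _ (by omega))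
      (PostInj.comp_iso ((shiftFunctorZero _ ℤ).app _).inv (tau_inj_B (by omega) (by omega) (by omega))))
  · rw [van_iff_of_iso e (sub_add_cancel _ m), van_iff_of_iso e (sub_add_cancel _ m),
      addIter_zero n p, addIter_one n s]
    by_contra! h
    exact hP ⟨by_contra fun h' => h.1 (van_B_H (by omega)),
      by_contra fun h' => h.2 (van_B_H (by omega))⟩

end

/-- A multiplication map with vanishing source or target is zero. -/
lemma Detects.zero_of_van {W : DerivedCategory MackeyMod} {d : ℤ} {a : M2 d 1} {n : ℕ}
    (h : Van W (qH s) p ∨ Van W (qH (addIter 1 n s)) (addIter d n p)) :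
    Detects (actPow W a s p n) False :=
  detects_actPow False.elim False.elim fun _ => h

end Strands

open Filter in
lemma eventually_rhoStable {a : M2 1 1} (ha : ∀ s, mulMap a s = rho s) (S : Strand) (m p : ℤ)
    (n : ℕ) : ∀ᶠ s : ℤ in atTop,
      Detects (actPow (Q.obj (S.complex⟦m⟧)) a s p n) (Strand.RhoStable p n (S, m)) := by
  cases S with
  | A k => exact Eventually.of_forall fun s => detects_rho_A ha ((Q.commShiftIso m).app (A k).cx)
  | H l =>
    filter_upwards [eventually_ge_atTop (p - m + l)] with s hs
    have := detects_rho_H ha ((Q.commShiftIso m).app (Word.H l).cx) (n := n) (s := s) (p := p)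
      (Or.inl (by omega))
    rwa [and_iff_left (by omega)] at this
  | B r =>
    filter_upwards [eventually_gt_atTop (p - m + r)] with s hs
    have := detects_rho_B ha ((Q.commShiftIso m).app (B r).cx) (n := n) (s := s) (p := p)
    rwa [iff_false_intro (a := _ ∧ _) (by omega)] at this

open Filter in
lemma eventually_tauStable {a : M2 0 1} (ha : ∀ s, 1 ≤ s →
    mulMap a s = tau s ≫ (shiftFunctorZero (DerivedCategory MackeyMod) ℤ).inv.app (qH (1 + s)))
    (S : Strand) (m d : ℤ) (n : ℕ) : ∀ᶠ s : ℤ in atTop,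
      Detects (actPow (Q.obj (S.complex⟦m⟧)) a s (d + s) n) (Strand.TauStable d n (S, m)) := by
  cases S with
  | A k =>
    filter_upwards [eventually_gt_atTop (m + k - d)] with s hs
    exact Detects.zero_of_van (Or.inl ((van_iff_of_iso ((Q.commShiftIso m).app (A k).cx)
      (sub_add_cancel _ m) _).mpr (van_A_H (by omega))))
  | H l =>
    filter_upwards [eventually_gt_atTop (m - d), eventually_ge_atTop 1] with s hs hs'
    have := detects_tau_H ha ((Q.commShiftIso m).app (Word.H l).cx) (n := n) (s := s) (p := d + s)
      hs' (by omega)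
    rwa [show d + s - m ≤ s - l ↔ d ≤ m - l by omega] at this
  | B r =>
    filter_upwards [eventually_ge_atTop 1] with s hs
    have := detects_tau_B ha ((Q.commShiftIso m).app (B r).cx) (n := n) (s := s) (p := d + s) hs
    rwa [add_sub_cancel_right] at this

open Filter in
lemma eventually_rhoPeriodic {a : M2 1 1} (ha : ∀ s, mulMap a s = rho s) (S : Strand)
    (m p d : ℤ) : ∀ᶠ n : ℕ in atTop,
      Detects (actPow (Q.obj (S.complex⟦m⟧)) a (p - d) p n) (Strand.RhoPeriodic p d (S, m)) := by
  cases S with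
  | A k =>
    filter_upwards [eventually_gt_atTop (m + k - p).toNat] with n hn
    refine Detects.zero_of_van (Or.inr ((van_iff_of_iso ((Q.commShiftIso m).app (A k).cx)
      (sub_add_cancel _ m) _).mpr (van_A_H ?_)))
    rw [addIter_one n p]
    omega
  | H l =>
    filter_upwards [eventually_gt_atTop (m - p).toNat] with n hn
    have := detects_rho_H ha ((Q.commShiftIso m).app (Word.H l).cx) (n := n) (s := p - d) (p := p)
      (Or.inr (by omega))
    rwa [show p - m ≤ p - d - l ↔ d ≤ m - l by omega] at this
  | B r =>
    refine Eventually.of_forall fun n => ?_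
    have := detects_rho_B ha ((Q.commShiftIso m).app (B r).cx) (n := n) (s := p - d) (p := p)
    rwa [sub_sub_cancel] at this

/-! ### Multiplicities -/

open scoped Classical in
/-- If for both families of strands the nonzero strands of a multiplication map are given by `P`,
eventually along a filter, then `P` holds for equally many members of both families. -/
lemma CohomologyIso.card_filter_eq {ι κ : Type} [Fintype ι] [Fintype κ] {S : ι → Strand}
    {m : ι → ℤ} {T : κ → Strand} {n : κ → ℤ}
    (h : CohomologyIso (strandSum S m) (strandSum T n)) {d : ℤ} {a : M2 d 1} {α : Type}
    {l : Filter α} [l.NeBot] {s p : α → ℤ} {N : α → ℕ} {P : Strand × ℤ → Prop}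
    (hP : ∀ (S : Strand) (m : ℤ), ∀ᶠ x in l,
      Detects (actPow (Q.obj (S.complex⟦m⟧)) a (s x) (p x) (N x)) (P (S, m))) :
    (Finset.univ.filter fun i => P (S i, m i)).card =
      (Finset.univ.filter fun j => P (T j, n j)).card := by
  obtain ⟨x, hx₁, hx₂⟩ := ((Filter.eventually_all.mpr fun i => hP (S i) (m i)).and
    (Filter.eventually_all.mpr fun j => hP (T j) (n j))).exists
  have := h.card_range_actPow a (s x) (p x) (N x)
  rw [card_range_strandSum hx₁, card_range_strandSum hx₂] at this
  exact Nat.pow_right_injective le_rfl this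

open scoped Classical in
/-- The indicator function of a predicate. -/
noncomputable def ind01 (P : Prop) : ℤ := if P then 1 else 0

/-- The indicator function of a suspended `A_k` is a second difference of the indicator functions of
the predicates detected by `ρ`. The predicate for `ρ ^ n` in degree `p` concerns those strands `A_k`
whose interval `[m, m + k]` contains `[p, p + n]`, besides the strands `H(l)` with `m ≤ p`, which
cancel. -/
lemma indicator_A (k : ℕ) (m : ℤ) (x : Strand × ℤ) :
    ind01 (x = (.A k, m)) = ind01 (Strand.RhoStable m k x) -
      ind01 (Strand.RhoStable (m - 1) ((k + 1 : ℕ) : ℤ) x) -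
      ind01 (Strand.RhoStable m ((k + 1 : ℕ) : ℤ) x) +
      ind01 (Strand.RhoStable (m - 1) ((k + 2 : ℕ) : ℤ) x) := by
  obtain ⟨S, n⟩ := x
  cases S <;> simp only [ind01, Strand.RhoStable, Prod.mk.injEq, Strand.A.injEq, reduceCtorEq,
    false_and, if_false] <;> push_cast <;> split_ifs <;> omega

/-- The analogue of `indicator_A` for `τ`, with the intervals `[m - r, m]` of the strands `B_r` and
with the intervals `[d - n, d]`. -/
lemma indicator_B (r : ℕ) (m : ℤ) (x : Strand × ℤ) :
    ind01 (x = (.B r, m)) = ind01 (Strand.TauStable m r x) -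
      ind01 (Strand.TauStable (m + 1) ((r + 1 : ℕ) : ℤ) x) -
      ind01 (Strand.TauStable m ((r + 1 : ℕ) : ℤ) x) +
      ind01 (Strand.TauStable (m + 1) ((r + 2 : ℕ) : ℤ) x) := by
  obtain ⟨S, n⟩ := x
  cases S <;> simp only [ind01, Strand.TauStable, Prod.mk.injEq, Strand.B.injEq, reduceCtorEq,
    false_and, if_false] <;> push_cast <;> split_ifs <;> omega

/-- The analogue of `indicator_A` for all powers of `ρ`. Here the strands `B_r` cancel, since the
predicate for them does not depend on the degree `p`. -/
lemma indicator_H (l m : ℤ) (x : Strand × ℤ) :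
    ind01 (x = (.H l, m)) = ind01 (Strand.RhoPeriodic m (m - l) x) -
      ind01 (Strand.RhoPeriodic (m - 1) (m - l) x) -
      ind01 (Strand.RhoPeriodic m (m - l + 1) x) +
      ind01 (Strand.RhoPeriodic (m - 1) (m - l + 1) x) := by
  obtain ⟨S, n⟩ := x
  cases S <;> simp only [ind01, Strand.RhoPeriodic, Prod.mk.injEq, Strand.H.injEq, reduceCtorEq,
    false_and, if_false] <;> split_ifs <;> simp <;> omega

/-- Two finite families in which all elements have the same multiplicity agree up to a
permutation. -/
lemma exists_equiv_of_card_fiber_eq {ι κ β : Type} [Finite ι] [Finite κ] {f : ι → β} {g : κ → β}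
    (h : ∀ b, Nat.card {i // f i = b} = Nat.card {j // g j = b}) :
    ∃ e : ι ≃ κ, ∀ i, g (e i) = f i := by
  have e (b : β) : {i // f i = b} ≃ {j // g j = b} := (Finite.card_eq.mp (h b)).some
  refine ⟨(Equiv.sigmaFiberEquiv f).symm.trans ((Equiv.sigmaCongrRight e).trans
    (Equiv.sigmaFiberEquiv g)), fun i => (e (f i) ⟨i, rfl⟩).2⟩

open scoped Classical in
/-- A multiplicity is determined by the four numbers that an inclusion-exclusion formula for its
indicator function involves. -/
lemma card_fiber_eq_of_ind01 {ι κ β : Type} [Fintype ι] [Fintype κ] {f : ι → β} {g : κ → β} {b : β}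
    {P₁ P₂ P₃ P₄ : β → Prop} (hb : ∀ x, ind01 (x = b) = ind01 (P₁ x) - ind01 (P₂ x) -
      ind01 (P₃ x) + ind01 (P₄ x))
    (h₁ : (Finset.univ.filter fun i => P₁ (f i)).card = (Finset.univ.filter fun j => P₁ (g j)).card)
    (h₂ : (Finset.univ.filter fun i => P₂ (f i)).card = (Finset.univ.filter fun j => P₂ (g j)).card)
    (h₃ : (Finset.univ.filter fun i => P₃ (f i)).card = (Finset.univ.filter fun j => P₃ (g j)).card)
    (h₄ : (Finset.univ.filter fun i => P₄ (f i)).card =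
      (Finset.univ.filter fun j => P₄ (g j)).card) :
    Nat.card {i // f i = b} = Nat.card {j // g j = b} := by
  have key {σ : Type} [Fintype σ] (u : σ → β) (P : β → Prop) :
      ((Finset.univ.filter fun i => P (u i)).card : ℤ) = ∑ i, ind01 (P (u i)) := by
    simp [ind01, Finset.sum_boole]
  rw [Nat.card_eq_fintype_card, Nat.card_eq_fintype_card, Fintype.card_subtype,
    Fintype.card_subtype]
  zify at h₁ h₂ h₃ h₄ ⊢
  rw [key, key] at h₁ h₂ h₃ h₄
  rw [key f (· = b), key g (· = b)]
  simp only [hb, Finset.sum_add_distrib, Finset.sum_sub_distrib, h₁, h₂, h₃, h₄]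

/-- The cohomology of a sum of strands determines the strands. -/
theorem CohomologyIso.exists_equiv {ι κ : Type} [Finite ι] [Finite κ] {S : ι → Strand}
    {m : ι → ℤ} {T : κ → Strand} {n : κ → ℤ}
    (h : CohomologyIso (strandSum S m) (strandSum T n)) :
    ∃ e : ι ≃ κ, ∀ i, T (e i) = S i ∧ n (e i) = m i := by
  cases nonempty_fintype ι
  cases nonempty_fintype κ
  obtain ⟨ρ, hρ⟩ := exists_rho
  obtain ⟨τ, hτ⟩ := exists_tau
  obtain ⟨e, he⟩ := exists_equiv_of_card_fiber_eq (f := fun i => (S i, m i))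
    (g := fun j => (T j, n j)) fun b => by
      obtain ⟨S₀, m₀⟩ := b
      cases S₀ with
      | A k =>
        have H (p : ℤ) (c : ℕ) := h.card_filter_eq (eventually_rhoStable hρ · · p c)
        exact card_fiber_eq_of_ind01 (indicator_A k m₀) (H _ _) (H _ _) (H _ _) (H _ _)
      | H l =>
        have H (p d : ℤ) := h.card_filter_eq (eventually_rhoPeriodic hρ · · p d)
        exact card_fiber_eq_of_ind01 (indicator_H l m₀) (H _ _) (H _ _) (H _ _) (H _ _)
      | B r =>
        have H (d : ℤ) (c : ℕ) := h.card_filter_eq (eventually_tauStable hτ · · d c)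
        exact card_fiber_eq_of_ind01 (indicator_B r m₀) (H _ _) (H _ _) (H _ _) (H _ _)
  exact ⟨e, fun i => Prod.ext_iff.mp (he i)⟩

lemma QIso.strandSum_of_equiv {ι κ : Type} [Finite ι] [Finite κ] {S : ι → Strand}
    {m : ι → ℤ} {T : κ → Strand} {n : κ → ℤ} (e : ι ≃ κ)
    (he : ∀ i, T (e i) = S i ∧ n (e i) = m i) : QIso (strandSum S m) (strandSum T n) :=
  ⟨Q.mapIso (biproduct.whiskerEquiv e fun i => eqToIso (by rw [(he i).1, (he i).2]))⟩

end MackeyMod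

theorem proposition4p20 :
    (∀ (ι κ : Type) [Finite ι] [Finite κ]
      (S : ι → MackeyMod.Strand) (m : ι → ℤ) (T : κ → MackeyMod.Strand) (n : κ → ℤ),
      MackeyMod.QIso (MackeyMod.strandSum S m) (MackeyMod.strandSum T n) →
        ∃ e : ι ≃ κ, ∀ i, T (e i) = S i ∧ n (e i) = m i) ∧
    (∀ X Y : CochainComplex MackeyMod ℤ, MackeyMod.IsPerfect X → MackeyMod.IsPerfect Y →
      (MackeyMod.QIso X Y ↔ MackeyMod.CohomologyIso X Y)) := by
  refine ⟨fun ι κ _ _ S m T n h => h.cohomologyIso.exists_equiv,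
    fun X Y hX hY => ⟨MackeyMod.QIso.cohomologyIso, fun h => ?_⟩⟩
  obtain ⟨ι, _, S, m, hX⟩ := hX.exists_strandSum
  obtain ⟨κ, _, T, n, hY⟩ := hY.exists_strandSum
  obtain ⟨e, he⟩ := (hX.cohomologyIso.symm.trans (h.trans hY.cohomologyIso)).exists_equiv
  obtain ⟨f⟩ := hX
  obtain ⟨g⟩ := hY
  obtain ⟨u⟩ := MackeyMod.QIso.strandSum_of_equiv e he
  exact ⟨f ≪≫ u ≪≫ g.symm⟩
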